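/- **Setting.** Let $X_0,X_1,\dots$ be a stationary sequence of real random variables on a probability space $(\Omega,\mathcal F,\mathbb P)$ and $M_n=\max\{X_0,\dots,X_{n-1}\}$. For each $n\ge 1$ let $u_n:D_n\to\mathbb R$ be a continuous, strictly decreasing level function on an interval $D_n\subseteq[0,\infty)$, such that every $\tau>0$ lies in $D_n$ for all large $n$, $n\,\mathbb P(X_0>u_n(\tau))\to\tau$ as $n\to\infty$ for every $\tau>0$, and every $X_j$ takes values almost surely in the range of $u_n$; $u_n^{-1}$ denotes the inverse function. Let $$N_n=\sum_{j=0}^\infty\delta_{(j/n,\;u_n^{-1}(X_j))},\qquad Z_n(t)=u_n^{-1}\big(M_{\lfloor nt\rfloor+1}\big),\quad t\ge 0 .$$ Let $M_p([0,\infty)^2)$ be the space of Radon point measures on $[0,\infty)^2$ with the vague topology. For $\theta\in(0,1]$, a point process $\tilde N$ on $[0,\infty)^2$ is *of Mori–Hsing type with parameter $\theta$* if almost surely $$\tilde N=\sum_{i,j=1}^\infty\sum_{\ell=1}^{K_{i,j}}\delta_{(T_{i,j},\,U_{i,j}Y_{i,j,\ell})},\qquad T_{i,j}=\sum_{\ell=1}^j\bar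 T_{i,\ell},$$ where the $\bar T_{i,j}$ are i.i.d. exponential with rate $\theta$, the $U_{i,j}$ are independent with $U_{i,j}$ uniform on $(i-1,i]$, $(Y_{i,j,\ell})_{1\le\ell\le K_{i,j}}$ ($K_{i,j}\le\infty$) are the points of a (locally finite) point process $\gamma_{i,j}$ on $[1,\infty)$ that almost surely has an atom at $1$, the $\gamma_{i,j}$ are identically distributed, and the three families $(\bar T_{i,j})$, $(U_{i,j})$, $(\gamma_{i,j})$ are mutually independent. Put $\bar H(\tau)=e^{-\theta\tau}$. Let $Z_H$ be the process with càdlàg paths whose finite-dimensional distributions are given, for $k\ge 1$, $0\le t_1<\dots<t_k$ and $y_1,\dots,y_k\ge 0$, by $$\mathbb P\big(Z_H(t_1)\ge y_1,\dots,Z_H(t_k)\ge y_k\big)=\prod_{i=1}^k\bar H\Big(\bigvee_{j=i}^k y_j\Big)^{t_i-t_{i-1}},\qquad t_0:=0 .\tag{1}$$ Since (1) forces $Z_H(0)=+\infty$ almost surely, $\mathbb D([0,\infty))$ denotes here the space of càdlàg functions from $[0,\infty)$ to the compact interval $[0,\infty]$, and $\mathbb D((0,\infty))$ the space of real càdlàg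 functions on $(0,\infty)$. For real càdlàg $g_1,g_2$ on $[a,b]$ let $d_{M_1,[a,b]}(g_1,g_2)=\inf\{\|\lambda_1-\lambda_2\|\vee\|\gamma_1-\gamma_2\|\}$, the infimum being over all continuous order-preserving parametrizations $(\lambda_i,\gamma_i)$ of the completed graphs of $g_i$ on $[a,b]$. The $M_1$ topology on $\mathbb D((0,\infty))$ is the one in which $g_n\to g$ iff $d_{M_1,[a,b]}(g_n,g)\to0$ for all continuity points $a<b$ of $g$; the $M_1$ topology on $\mathbb D([0,\infty))$ is the one in which $g_n\to g$ iff $d_{M_1,[0,T]}(\phi\circ g_n,\phi\circ g)\to 0$ for every continuity point $T$ of $g$, where $\phi(x)=x/(1+x)$, $\phi(\infty)=1$. **Proposition.** Suppose that $N_n$ converges weakly in $M_p([0,\infty)^2)$ to a process $\tilde N$ of Mori–Hsing type with parameter $\theta\in(0,1]$. Then a process $Z_H$ with paths in $\mathbb D([0,\infty))$ and finite-dimensional distributions (1) exists, and $Z_n$ converges weakly to $Z_H$ in $\mathbb D([0,\infty))$ with the $M_1$ topology. Likewise $Z_H$, restricted to $t>0$, has a version with real paths in $\mathbb D((0,\infty))$,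 with finite-dimensional distributions (1) for $0<t_1<\dots<t_k$, and $(Z_n(t))_{t>0}$ converges weakly to it in $\mathbb D((0,\infty))$ with the $M_1$ topology. -/

import Mathlib

open MeasureTheory ProbabilityTheory Filter Set
open scoped Topology NNReal ENNReal CompactlySupported

namespace REPP

noncomputable section

/-! ### Point measures, the vague topology, and point processes -/

/-- The space `M_p(E)` of Radon point measures on `E`: countable sums of Dirac masses that are
finite on compact sets. -/
structure PointMeasure (E : Type*) [TopologicalSpace E] [MeasurableSpace E] where
  /-- the underlying measure -/
  toMeasure : Measure E
  exists_eq_sum_dirac : ∃ (ι : Type) (_ : Countable ι) (x : ι → E),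
    toMeasure = Measure.sum fun i => Measure.dirac (x i)
  lt_top_of_isCompact : ∀ K : Set E, IsCompact K → toMeasure K < ∞

/-- The vague topology on `M_p(E)`: the coarsest topology for which `m ↦ ∫ f dm` is continuous for
every continuous compactly supported `f : E → ℝ`. -/
instance {E : Type*} [TopologicalSpace E] [MeasurableSpace E] :
    TopologicalSpace (PointMeasure E) :=
  ⨅ f : C_c(E, ℝ), TopologicalSpace.induced (fun m => ∫ x, f x ∂m.toMeasure) inferInstance

/-- The Borel `σ`-algebra of the vague topology. -/
instance {E : Type*} [TopologicalSpace E] [MeasurableSpace E] :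
    MeasurableSpace (PointMeasure E) := borel _

instance {E : Type*} [TopologicalSpace E] [MeasurableSpace E] :
    BorelSpace (PointMeasure E) := ⟨rfl⟩

/-! ### Levels, partial maxima and the empirical process -/

/-- The standing assumptions on the normalising levels `u_n : D_n → ℝ` of the process `X`.  Here
`D_n ⊆ [0, ∞)` is the interval of frequencies on which the `n`-th level function is defined (for
instance `(0, ∞)`, `[0, ∞)` or `[0, n]`); every `τ > 0` belongs to `D_n` for all large `n`. -/
structure IsLevelSequence {Ω : Type*} [MeasurableSpace Ω] (P : Measure Ω) (X : ℕ → Ω → ℝ)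
    (D : ℕ+ → Set ℝ) (u : ℕ+ → ℝ → ℝ) : Prop where
  nonneg : ∀ n, D n ⊆ Ici 0
  ordConnected : ∀ n, (D n).OrdConnected
  eventually_mem : ∀ τ : ℝ, 0 < τ → ∀ᶠ n in atTop, τ ∈ D n
  continuousOn : ∀ n, ContinuousOn (u n) (D n)
  strictAntiOn : ∀ n, StrictAntiOn (u n) (D n)
  /-- `n P(X_0 > u_n(τ)) → τ` -/
  tendsto : ∀ τ : ℝ, 0 < τ →
    Tendsto (fun n : ℕ+ => (n : ℝ) * P.real {ω | u n τ < X 0 ω}) atTop (𝓝 τ)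
  /-- `X_j` takes its values, almost surely, in the range of `u_n`, where `u_n⁻¹` is defined -/
  mem_range : ∀ n j, ∀ᵐ ω ∂P, X j ω ∈ u n '' D n

/-- The inverse level function `u_n⁻¹ : u_n(D_n) → D_n`. -/
def levelInv (D : ℕ+ → Set ℝ) (u : ℕ+ → ℝ → ℝ) (n : ℕ+) (z : ℝ) : ℝ :=
  Function.invFunOn (u n) (D n) z

/-- `k ↦ u_n⁻¹(M_{k+1})`, where `M_{k+1} = max {x_0, …, x_k}`. -/
def levelMax (D : ℕ+ → Set ℝ) (u : ℕ+ → ℝ → ℝ) (n : ℕ+) (x : ℕ → ℝ) (k : ℕ) : ℝ :=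
  levelInv D u n (partialSups x k)

lemma lt_top_of_isCompact_aux (n : ℕ+) (y : ℕ → ℝ≥0) (K : Set (ℝ≥0 × ℝ≥0)) (hK : IsCompact K) :
    Measure.sum (fun j : ℕ => Measure.dirac (((j : ℝ≥0) / (n : ℝ≥0), y j) : ℝ≥0 × ℝ≥0)) K < ∞ := by
  obtain ⟨c, hc⟩ := (hK.image continuous_fst).bddAbove
  obtain ⟨N, hN⟩ := exists_nat_gt (c * (n : ℝ≥0))
  have hn : (0 : ℝ≥0) < (n : ℝ≥0) := by exact_mod_cast n.pos
  rw [Measure.sum_apply _ hK.measurableSet, tsum_eq_sum (s := Finset.range N)]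
  · refine ENNReal.sum_lt_top.2 fun j _ => ?_
    exact measure_lt_top _ _
  · intro j hj
    rw [Measure.dirac_apply' _ hK.measurableSet, Set.indicator_of_notMem]
    intro hmem
    have h1 : (j : ℝ≥0) / (n : ℝ≥0) ≤ c := hc ⟨_, hmem, rfl⟩
    rw [div_le_iff₀ hn] at h1
    have h2 : (j : ℝ≥0) < N := lt_of_le_of_lt h1 hN
    exact hj (Finset.mem_range.2 (by exact_mod_cast h2))

/-- The empirical two-dimensional rare events point process
`N_n = ∑_{j ≥ 0} δ_{(j/n, u_n⁻¹(X_j))}` on `[0, ∞)²`. -/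
def empirical {Ω : Type*} (X : ℕ → Ω → ℝ) (D : ℕ+ → Set ℝ) (u : ℕ+ → ℝ → ℝ) (n : ℕ+) (ω : Ω) :
    PointMeasure (ℝ≥0 × ℝ≥0) where
  toMeasure := Measure.sum fun j : ℕ =>
    Measure.dirac ((j : ℝ≥0) / (n : ℝ≥0), (levelInv D u n (X j ω)).toNNReal)
  exists_eq_sum_dirac := ⟨ℕ, inferInstance, _, rfl⟩
  lt_top_of_isCompact := lt_top_of_isCompact_aux n _

/-! ### Processes of Mori–Hsing type -/

/-- `Ntil` is a process of Mori–Hsing type with parameter `θ`: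
`Ntil = ∑_{i,j} ∑_ℓ δ_{(T_{i,j}, U_{i,j} Y_{i,j,ℓ})}` almost surely, where
`T_{i,j} = Tbar_{i,0} + ⋯ + Tbar_{i,j}` and the `Y_{i,j,ℓ}` are the points of `γ_{i,j}`.  All indices
start at `0`, so that `U_{i,j}` is uniform on `(i, i + 1]`.  The inner sum is the image of the point
measure `γ_{i,j}` under `y ↦ (T_{i,j}, U_{i,j} y)`. -/
def IsMoriHsing {Ω : Type*} [MeasurableSpace Ω] (P : Measure Ω) (θ : ℝ)
    (Ntil : Ω → PointMeasure (ℝ≥0 × ℝ≥0)) : Prop :=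
  ∃ (Tbar U : ℕ × ℕ → Ω → ℝ) (γ : ℕ × ℕ → Ω → PointMeasure (Ici (1 : ℝ))),
    (∀ p, Measurable (Tbar p)) ∧ (∀ p, Measurable (U p)) ∧ (∀ p, Measurable (γ p)) ∧
    -- the `Tbar` are iid exponential, the `U` are independent and uniform
    (∀ p, HasLaw (Tbar p) (expMeasure θ) P) ∧ iIndepFun Tbar P ∧
    (∀ p, HasLaw (U p) (volume.restrict (Ioc (p.1 : ℝ) (p.1 + 1))) P) ∧ iIndepFun U P ∧
    -- the `γ` are identically distributed and have an atom at `1`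
    (∀ p q, IdentDistrib (γ p) (γ q) P P) ∧
    (∀ p, ∀ᵐ ω ∂P, 1 ≤ (γ p ω).toMeasure {⟨1, le_refl (1 : ℝ)⟩}) ∧
    -- the three families are mutually independent
    IndepFun (fun ω p => Tbar p ω) (fun ω p => U p ω) P ∧
    IndepFun (fun ω => ((fun p => Tbar p ω), fun p => U p ω)) (fun ω p => γ p ω) P ∧
    ∀ᵐ ω ∂P, (Ntil ω).toMeasure = Measure.sum fun p : ℕ × ℕ =>
      (γ p ω).toMeasure.map fun y : Ici (1 : ℝ) =>
        ((∑ l ∈ Finset.range (p.2 + 1), Tbar (p.1, l) ω).toNNReal, (U p ω * (y : ℝ)).toNNReal)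

/-! ### Càdlàg paths and the `M₁` topology -/

/-- Càdlàg paths: right continuous functions with left limits. -/
structure Cadlag (I V : Type*) [TopologicalSpace I] [Preorder I] [TopologicalSpace V] where
  /-- the underlying function -/
  toFun : I → V
  rightContinuous : ∀ t, ContinuousWithinAt toFun (Ici t) t
  exists_leftLimit : ∀ t, ∃ l, Tendsto toFun (𝓝[<] t) (𝓝 l)

instance (I V : Type*) [TopologicalSpace I] [Preorder I] [TopologicalSpace V] :
    CoeFun (Cadlag I V) (fun _ => I → V) := ⟨Cadlag.toFun⟩

section M1

variable {I : Type*} [LinearOrder I] [MetricSpace I]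

/-- The left limit at `t` of the restriction of `g` to `[a, b]`, with the convention that it is
`g a` at the left end point. -/
def leftLimFrom (a : I) (g : I → ℝ) (t : I) : ℝ := if t = a then g a else Function.leftLim g t

/-- The completed graph of the restriction of `g` to `[a, b]`. -/
def completedGraph (a b : I) (g : I → ℝ) : Set (I × ℝ) :=
  {p | p.1 ∈ Icc a b ∧ p.2 ∈ uIcc (leftLimFrom a g p.1) (g p.1)}

/-- Parametrizations `G = (λ, γ)` of the completed graph of `g` on `[a, b]`: continuous maps from
`[a, b]` onto the completed graph that trace it out in its natural order. -/
def IsParametrization (a b : I) (g : I → ℝ) (G : I → I × ℝ) : Prop :=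
  ContinuousOn G (Icc a b) ∧ G '' Icc a b = completedGraph a b g ∧
    ∀ s' ∈ Icc a b, ∀ s ∈ Icc a b, s' < s →
      (G s').1 < (G s).1 ∨
        ((G s').1 = (G s).1 ∧ |(G s).2 - g (G s).1| < |(G s').2 - g (G s).1|)

/-- The `M₁` distance of the restrictions of two real functions to `[a, b]`: the infimum over
parametrizations `(λᵢ, γᵢ)` of `gᵢ` of `‖λ₁ - λ₂‖ ∨ ‖γ₁ - γ₂‖`. -/
def m1Dist (a b : I) (g₁ g₂ : I → ℝ) : ℝ≥0∞ :=
  ⨅ (G₁ : I → I × ℝ) (_ : IsParametrization a b g₁ G₁)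
    (G₂ : I → I × ℝ) (_ : IsParametrization a b g₂ G₂),
    (⨆ s ∈ Icc a b, edist (G₁ s).1 (G₂ s).1) ⊔ (⨆ s ∈ Icc a b, edist (G₁ s).2 (G₂ s).2)

end M1

/-- The topology determined by a notion of convergence of sequences: `U` is open if every sequence
that converges to a point of `U` is eventually in `U`. -/
@[reducible] def sequentialTopology {α : Type*} (Conv : (ℕ → α) → α → Prop) :
    TopologicalSpace α where
  IsOpen U := ∀ g ∈ U, ∀ s, Conv s g → ∀ᶠ n in atTop, s n ∈ U
  isOpen_univ := by simp
  isOpen_inter := fun U V hU hV g hg s hs => (hU g hg.1 s hs).and (hV g hg.2 s hs)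
  isOpen_sUnion := fun S hS g ⟨U, hUS, hgU⟩ s hs =>
    (hS U hUS g hgU s hs).mono fun _ h => ⟨U, hUS, h⟩

/-- The order isomorphism `x ↦ x / (1 + x)` of `[0, ∞]` onto `[0, 1]` (with `∞ ↦ 1`), written as
`1 - 1 / (1 + x)`; it metrizes the compact interval `[0, ∞]`. -/
def compactify (x : ℝ≥0∞) : ℝ := 1 - ((1 + x)⁻¹).toReal

/-- `D([0, ∞))`, the càdlàg paths on `[0, ∞)` with values in the compact interval `[0, ∞]`. -/
abbrev PathSpace : Type := Cadlag ℝ≥0 ℝ≥0∞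

/-- `M₁` convergence `g_n → g` in `D([0, ∞))`: the `M₁` distances on `[0, T]` tend to `0` for every
continuity point `T` of `g`. -/
def PathSpace.M1Conv (gs : ℕ → PathSpace) (g : PathSpace) : Prop :=
  ∀ T : ℝ≥0, ContinuousAt g T →
    Tendsto (fun n => m1Dist 0 T (compactify ∘ gs n) (compactify ∘ g)) atTop (𝓝 0)

/-- The `M₁` topology on `D([0, ∞))`.  It is metrizable, hence determined by its convergent
sequences. -/
instance : TopologicalSpace PathSpace := sequentialTopology PathSpace.M1Conv

instance : MeasurableSpace PathSpace := borel _

instance : BorelSpace PathSpace := ⟨rfl⟩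

/-- `D((0, ∞))`, the real càdlàg paths on `(0, ∞)`. -/
abbrev OpenPathSpace : Type := Cadlag (Ioi (0 : ℝ)) ℝ

/-- `M₁` convergence `g_n → g` in `D((0, ∞))`: the `M₁` distances on `[a, b]` tend to `0` for all
continuity points `a < b` of `g`. -/
def OpenPathSpace.M1Conv (gs : ℕ → OpenPathSpace) (g : OpenPathSpace) : Prop :=
  ∀ a b : Ioi (0 : ℝ), a < b → ContinuousAt g a → ContinuousAt g b →
    Tendsto (fun n => m1Dist a b (gs n) g) atTop (𝓝 0)

/-- The `M₁` topology on `D((0, ∞))`.  It is metrizable, hence determined by its convergent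
sequences. -/
instance : TopologicalSpace OpenPathSpace := sequentialTopology OpenPathSpace.M1Conv

instance : MeasurableSpace OpenPathSpace := borel _

instance : BorelSpace OpenPathSpace := ⟨rfl⟩

/-! ### The normalised extremal process -/

lemma rightContinuous_step {I V : Type*} [TopologicalSpace I] [LinearOrder I] [TopologicalSpace V]
    (F : ℕ → V) (c : I → ℝ) (hc : Continuous c) (hm : StrictMono c) (n : ℕ+) (t : I) :
    ContinuousWithinAt (fun s => F ⌊(n : ℝ) * c s⌋₊) (Ici t) t := by
  have hopen : IsOpen {s : I | (n : ℝ) * c s < ⌊(n : ℝ) * c t⌋₊ + 1} :=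
    isOpen_lt (by fun_prop) (by fun_prop)
  have hmem : {s : I | (n : ℝ) * c s < ⌊(n : ℝ) * c t⌋₊ + 1} ∈ 𝓝 t :=
    hopen.mem_nhds (Nat.lt_floor_add_one ((n : ℝ) * c t))
  refine (continuousWithinAt_const (b := F ⌊(n : ℝ) * c t⌋₊)).congr_of_eventuallyEq ?_ rfl
  filter_upwards [mem_nhdsWithin_of_mem_nhds hmem, self_mem_nhdsWithin] with s hs hts
  have h1 : ⌊(n : ℝ) * c t⌋₊ ≤ ⌊(n : ℝ) * c s⌋₊ :=
    Nat.floor_mono (mul_le_mul_of_nonneg_left (hm.monotone hts) (Nat.cast_nonneg _))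
  have h2 : ⌊(n : ℝ) * c s⌋₊ < ⌊(n : ℝ) * c t⌋₊ + 1 := by
    rw [Nat.floor_lt' (Nat.succ_ne_zero _)]
    exact_mod_cast hs
  rw [show ⌊(n : ℝ) * c s⌋₊ = ⌊(n : ℝ) * c t⌋₊ by omega]

lemma exists_leftLimit_step {I V : Type*} [TopologicalSpace I] [LinearOrder I]
    [TopologicalSpace V] (F : ℕ → V) (c : I → ℝ) (hc : Continuous c) (hm : StrictMono c) (n : ℕ+)
    (t : I) : ∃ l, Tendsto (fun s => F ⌊(n : ℝ) * c s⌋₊) (𝓝[<] t) (𝓝 l) := by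
  have hn : (0 : ℝ) < (n : ℝ) := by exact_mod_cast n.pos
  have hopen : IsOpen {s : I | ((⌈(n : ℝ) * c t⌉₊ : ℝ) - 1) < (n : ℝ) * c s ∨
      (n : ℝ) * c t ≤ 0} := by
    have h1 : IsOpen {s : I | ((⌈(n : ℝ) * c t⌉₊ : ℝ) - 1) < (n : ℝ) * c s} :=
      isOpen_lt (by fun_prop) (by fun_prop)
    exact h1.union isOpen_const
  have hmem : {s : I | ((⌈(n : ℝ) * c t⌉₊ : ℝ) - 1) < (n : ℝ) * c s ∨ (n : ℝ) * c t ≤ 0} ∈ 𝓝 t := by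
    refine hopen.mem_nhds ?_
    rcases le_or_gt ((n : ℝ) * c t) 0 with h | h
    · exact Or.inr h
    · exact Or.inl (by linarith [Nat.ceil_lt_add_one h.le])
  refine ⟨F (⌈(n : ℝ) * c t⌉₊ - 1), tendsto_const_nhds.congr' ?_⟩
  filter_upwards [mem_nhdsWithin_of_mem_nhds hmem, self_mem_nhdsWithin] with s hs hst
  have h1 : (n : ℝ) * c s < (n : ℝ) * c t := mul_lt_mul_of_pos_left (hm hst) hn
  have h2 := Nat.le_ceil ((n : ℝ) * c t)
  rcases le_or_gt ((n : ℝ) * c t) 0 with h | h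
  · rw [Nat.ceil_eq_zero.2 h, Nat.floor_of_nonpos (by linarith)]
  · have hpos : 1 ≤ ⌈(n : ℝ) * c t⌉₊ := Nat.ceil_pos.2 h
    have hs' : ((⌈(n : ℝ) * c t⌉₊ : ℝ) - 1) < (n : ℝ) * c s := hs.resolve_right (not_le.2 h)
    have h4 : ((⌈(n : ℝ) * c t⌉₊ - 1 : ℕ) : ℝ) = (⌈(n : ℝ) * c t⌉₊ : ℝ) - 1 := by
      push_cast [Nat.cast_sub hpos]; ring
    have h3 : ⌊(n : ℝ) * c s⌋₊ = ⌈(n : ℝ) * c t⌉₊ - 1 := by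
      have h0 : (0 : ℝ) ≤ ((⌈(n : ℝ) * c t⌉₊ - 1 : ℕ) : ℝ) := Nat.cast_nonneg _
      rw [Nat.floor_eq_iff (by linarith), h4]
      constructor <;> linarith
    rw [h3]

/-- The normalised extremal process `Z_n(t) = u_n⁻¹(M_{⌊nt⌋+1})`, `t ∈ [0, ∞)`, as a random element
of `D([0, ∞))`. -/
def extremalProcess {Ω : Type*} (X : ℕ → Ω → ℝ) (D : ℕ+ → Set ℝ) (u : ℕ+ → ℝ → ℝ) (n : ℕ+)
    (ω : Ω) : PathSpace where
  toFun t := ENNReal.ofReal (levelMax D u n (fun j => X j ω) ⌊(n : ℝ) * (t : ℝ)⌋₊)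
  rightContinuous := rightContinuous_step
    (fun k => ENNReal.ofReal (levelMax D u n (fun j => X j ω) k)) (fun t : ℝ≥0 => (t : ℝ))
    NNReal.continuous_coe (fun _ _ h => h) n
  exists_leftLimit := exists_leftLimit_step
    (fun k => ENNReal.ofReal (levelMax D u n (fun j => X j ω) k)) (fun t : ℝ≥0 => (t : ℝ))
    NNReal.continuous_coe (fun _ _ h => h) n

/-- The normalised extremal process `Z_n(t) = u_n⁻¹(M_{⌊nt⌋+1})`, `t ∈ (0, ∞)`, as a random element
of `D((0, ∞))`. -/
def openExtremalProcess {Ω : Type*} (X : ℕ → Ω → ℝ) (D : ℕ+ → Set ℝ) (u : ℕ+ → ℝ → ℝ) (n : ℕ+)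
    (ω : Ω) : OpenPathSpace where
  toFun t := levelMax D u n (fun j => X j ω) ⌊(n : ℝ) * (t : ℝ)⌋₊
  rightContinuous := rightContinuous_step
    (fun k => levelMax D u n (fun j => X j ω) k) (fun t : Ioi (0 : ℝ) => (t : ℝ))
    continuous_subtype_val (fun _ _ h => h) n
  exists_leftLimit := exists_leftLimit_step
    (fun k => levelMax D u n (fun j => X j ω) k) (fun t : Ioi (0 : ℝ) => (t : ℝ))
    continuous_subtype_val (fun _ _ h => h) n

/-! ### The limit process -/

/-- `H̄(τ) = exp(-θ τ)`. -/
def Hbar (θ τ : ℝ) : ℝ := Real.exp (-θ * τ)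

/-- `∏_{i=1}^k H̄(y_i ∨ ⋯ ∨ y_k)^{t_i - t_{i-1}}`, with `t_0 = 0`. -/
def fddProduct (θ : ℝ) (k : ℕ) (t : ℕ → ℝ) (y : ℕ → ℝ≥0) : ℝ :=
  ∏ i ∈ Finset.Icc 1 k,
    Hbar θ ((Finset.Icc i k).sup y : ℝ≥0) ^ (t i - if i = 1 then 0 else t (i - 1))

/-- `Z` is a version of the process `Z_H` with paths in `D([0, ∞))`: for `0 ≤ t_1 < ⋯ < t_k` and
`y_1, …, y_k ≥ 0`, the probability of `Z(t_1) ≥ y_1, …, Z(t_k) ≥ y_k` is the product above. -/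
def IsZH {Ω : Type*} [MeasurableSpace Ω] (P : Measure Ω) (θ : ℝ) (Z : Ω → PathSpace) : Prop :=
  (∀ t, Measurable fun ω => Z ω t) ∧
  ∀ (k : ℕ) (t : ℕ → ℝ≥0) (y : ℕ → ℝ≥0), StrictMonoOn t (Icc 1 k) →
    P.real {ω | ∀ i ∈ Icc 1 k, (y i : ℝ≥0∞) ≤ Z ω (t i)} = fddProduct θ k (fun i => t i) y

/-- `Z` is a version of the process `Z_H` with paths in `D((0, ∞))`. -/
def IsOpenZH {Ω : Type*} [MeasurableSpace Ω] (P : Measure Ω) (θ : ℝ) (Z : Ω → OpenPathSpace) :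
    Prop :=
  (∀ t, Measurable fun ω => Z ω t) ∧
  ∀ (k : ℕ) (t : ℕ → Ioi (0 : ℝ)) (y : ℕ → ℝ≥0), StrictMonoOn t (Icc 1 k) →
    P.real {ω | ∀ i ∈ Icc 1 k, (y i : ℝ) ≤ Z ω (t i)} = fddProduct θ k (fun i => t i) y

end

end REPP

open REPP

/-! All paths in play are decreasing, and this makes the `M₁` topology nearly trivial. Decreasing
right continuous functions that converge on a dense set of times, and at the end points of an
interval, converge in `m1Dist` on that interval. So on the decreasing paths the topology is
controlled by countably many yes/no questions "is `y ≤ g q`?" with `q` in a countable dense set and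
`y` rational. Answering them maps paths into a Cantor space, where weak convergence is convergence
of cylinder probabilities. By inclusion-exclusion only the probabilities of `Z_n(q) ≥ y` for
finitely many pairs `(q, y)` matter. `tendstoInDistribution_of_setCode` carries out this reduction,
so tightness never has to be treated separately.

It remains to find the limits of these probabilities. The event `y ≤ Z_n(t)` says that `N_n` has no
point in `[0, t] × [0, y)`. Integrals of the functions `tent F ε` turn this void event into a closed
condition (`∫ ≤ 0`) and an open one (`∫ < ε²`) on a vaguely continuous functional. The portmanteau
theorem bounds the limit on both sides by void probabilities of the limit process, and the bounds
meet because the one-time probabilities `exp (-θ y t)` are continuous. This is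
`tendsto_measureReal_extremalProcess`.

For the limit only the points `(T_{i,j}, U_{i,j})` count: each is present because of the atom at
`1`, and the others in its cluster lie above it. The limit path is therefore the running minimum of
the marks `U`. These points should form a Poisson process of intensity `θ dt du`, so that no mark
lies below a decreasing level function `f` with probability `exp (-θ ∫ f)`. `measure_forall_le_mark`
proves this by revealing the points of each strip `(i, i + 1]` one at a time, with the conditional
void probability as a martingale. Applied to a staircase function it gives exactly the product in
(1). -/

open REPP

/-! ### Weak convergence through countably many yes/no questions -/

section Coding

variable {E C : Type*}

open Classical in
/-- The sequence of answers to the questions `x ∈ A c`. -/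
noncomputable def setCode (A : C → Set E) (x : E) : C → Bool := fun c => decide (x ∈ A c)

lemma setCode_eq_iff (A : C → Set E) (x y : E) (c : C) :
    setCode A x c = setCode A y c ↔ (x ∈ A c ↔ y ∈ A c) := by
  simp [setCode]

/-- If a point of `D ∩ U` were not covered, a countable neighbourhood basis of its code would yield
a sequence in `D` outside `U` whose codes converge. Each coordinate is discrete, so every answer
stabilises and the sequence would converge into `U`. Only sequential convergence inside `D` is
needed, which is what a sequential topology supplies. -/
lemma exists_isOpen_setCode [TopologicalSpace E] [Countable C] {A : C → Set E} {D : Set E}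
    (hconv : ∀ x ∈ D, ∀ s : ℕ → E, (∀ n, s n ∈ D) →
      (∀ c, ∀ᶠ n in atTop, (s n ∈ A c ↔ x ∈ A c)) → Tendsto s atTop (𝓝 x))
    {U : Set E} (hU : IsOpen U) :
    ∃ V : Set (C → Bool), IsOpen V ∧ ∀ x ∈ D, (x ∈ U ↔ setCode A x ∈ V) := by
  refine ⟨⋃₀ {W | IsOpen W ∧ ∀ x ∈ D, setCode A x ∈ W → x ∈ U}, isOpen_sUnion fun W hW => hW.1,
    fun x hx => ⟨fun hxU => ?_, fun ⟨W, hW, hxW⟩ => hW.2 x hx hxW⟩⟩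
  by_contra hcon
  obtain ⟨B, hB⟩ := (𝓝 (setCode A x)).exists_antitone_basis
  have h : ∀ n, ∃ y ∈ D, setCode A y ∈ B n ∧ y ∉ U := by
    intro n
    by_contra! h
    refine hcon ⟨interior (B n), ⟨isOpen_interior, fun y hy hyB => ?_⟩,
      mem_interior_iff_mem_nhds.2 (hB.1.mem_of_mem trivial)⟩
    exact h y hy (interior_subset hyB)
  choose y hyD hyB hyU using h
  have hlim : Tendsto (fun n => setCode A (y n)) atTop (𝓝 (setCode A x)) := hB.tendsto hyB
  have := hconv x hx y hyD fun c => by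
    have h1 := (tendsto_pi_nhds.1 hlim c).eventually (IsOpen.mem_nhds
      (isOpen_discrete {setCode A x c}) rfl)
    filter_upwards [h1] with n hn
    exact (setCode_eq_iff A _ _ c).1 hn
  obtain ⟨n, hn⟩ := (this.eventually (hU.mem_nhds hxU)).exists
  exact hyU n hn

lemma aemeasurable_setCode [Countable C] {A : C → Set E} {Ω : Type*} [MeasurableSpace Ω]
    {P : Measure Ω} {Y : Ω → E} (hY : ∀ c, NullMeasurableSet {ω | Y ω ∈ A c} P) :
    AEMeasurable (fun ω => setCode A (Y ω)) P := by
  classical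
  refine aemeasurable_pi_iff.2 fun c => NullMeasurable.aemeasurable fun s _ => ?_
  have h : (fun ω => setCode A (Y ω) c) ⁻¹' s =
      ({ω | Y ω ∈ A c} ∩ {_ω | true ∈ s}) ∪ ({ω | Y ω ∈ A c}ᶜ ∩ {_ω | false ∈ s}) := by
    ext ω
    by_cases h : Y ω ∈ A c <;> simp [setCode, h]
  rw [h]
  exact ((hY c).inter (MeasurableSet.const _).nullMeasurableSet).union
    ((hY c).compl.inter (MeasurableSet.const _).nullMeasurableSet)

/-- On a measurable set of full measure, the preimage of an open set under `Y` is the preimage of an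
open set of codes. Off that set `Y` is replaced by one of its own values, which keeps all preimages
measurable. -/
lemma aemeasurable_of_setCode [TopologicalSpace E] [MeasurableSpace E] [BorelSpace E]
    [Countable C] {A : C → Set E} {D : Set E}
    (hconv : ∀ x ∈ D, ∀ s : ℕ → E, (∀ n, s n ∈ D) →
      (∀ c, ∀ᶠ n in atTop, (s n ∈ A c ↔ x ∈ A c)) → Tendsto s atTop (𝓝 x))
    {Ω : Type*} [MeasurableSpace Ω] {P : Measure Ω} [IsProbabilityMeasure P] {Y : Ω → E}
    (hYD : ∀ᵐ ω ∂P, Y ω ∈ D) (hY : ∀ c, NullMeasurableSet {ω | Y ω ∈ A c} P) :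
    AEMeasurable Y P := by
  classical
  have hb := aemeasurable_setCode hY
  obtain ⟨G, hG, hGm, hGD⟩ := (hYD.and hb.ae_eq_mk).exists_measurable_mem
  have : Nonempty Ω := nonempty_of_isProbabilityMeasure P
  obtain ⟨ω₀⟩ := this
  refine ⟨G.piecewise Y fun _ => Y ω₀, measurable_of_isOpen fun U hU => ?_, ?_⟩
  · obtain ⟨V, hV, hUV⟩ := exists_isOpen_setCode hconv hU
    rw [Set.piecewise_preimage, Set.ite]
    have h1 : Y ⁻¹' U ∩ G = hb.mk _ ⁻¹' V ∩ G := by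
      ext ω
      refine and_congr_left fun hω => ?_
      rw [Set.mem_preimage, hUV _ (hGD ω hω).1, Set.mem_preimage, ← (hGD ω hω).2]
    rw [h1]
    exact ((hb.measurable_mk hV.measurableSet).inter hGm).union
      ((MeasurableSet.const _).diff hGm)
  · filter_upwards [hG] with ω hω
    simp [hω]

/-- The inclusion-exclusion step: one negative answer is traded for a difference of two cylinders
with one negative answer fewer. -/
lemma measureReal_cylinder_insert {Ω : Type*} [MeasurableSpace Ω] {P : Measure Ω}
    [IsProbabilityMeasure P] {A : C → Set E} [DecidableEq C] {W : Ω → E} {a : C}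
    (hW : NullMeasurableSet {ω | W ω ∈ A a} P) (F G : Finset C) :
    P.real {ω | (∀ c ∈ F, W ω ∈ A c) ∧ ∀ c ∈ insert a G, W ω ∉ A c} =
      P.real {ω | (∀ c ∈ F, W ω ∈ A c) ∧ ∀ c ∈ G, W ω ∉ A c} -
      P.real {ω | (∀ c ∈ insert a F, W ω ∈ A c) ∧ ∀ c ∈ G, W ω ∉ A c} := by
  rw [eq_sub_iff_add_eq, add_comm, ← measureReal_inter_add_sdiff₀
    (s := {ω | (∀ c ∈ F, W ω ∈ A c) ∧ ∀ c ∈ G, W ω ∉ A c}) hW]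
  congr 2
  · ext ω
    simp only [Finset.forall_mem_insert, mem_ofPred_eq, mem_inter_iff]
    tauto
  · ext ω
    simp only [Finset.forall_mem_insert, mem_ofPred_eq, Set.mem_sdiff]
    tauto

lemma isOpen_cylinder (F G : Finset C) :
    IsOpen {b : C → Bool | (∀ c ∈ F, b c = true) ∧ ∀ c ∈ G, b c = false} := by
  have : {b : C → Bool | (∀ c ∈ F, b c = true) ∧ ∀ c ∈ G, b c = false} =
      (⋂ c ∈ F, (fun b : C → Bool => b c) ⁻¹' {true}) ∩
      ⋂ c ∈ G, (fun b : C → Bool => b c) ⁻¹' {false} := by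
    ext b; simp
  rw [this]
  exact (isOpen_biInter_finset fun c _ => (isOpen_discrete _).preimage (continuous_apply c)).inter
    (isOpen_biInter_finset fun c _ => (isOpen_discrete _).preimage (continuous_apply c))

lemma map_setCode_cylinder [Countable C] {Ω : Type*} [MeasurableSpace Ω] {P : Measure Ω}
    {A : C → Set E} {W : Ω → E} (hW : AEMeasurable (fun ω => setCode A (W ω)) P)
    (F G : Finset C) :
    (P.map fun ω => setCode A (W ω)) {b | (∀ c ∈ F, b c = true) ∧ ∀ c ∈ G, b c = false} =
      P {ω | (∀ c ∈ F, W ω ∈ A c) ∧ ∀ c ∈ G, W ω ∉ A c} := by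
  rw [Measure.map_apply_of_aemeasurable hW (isOpen_cylinder F G).measurableSet]
  simp [setCode]

/-- Convergence of the probabilities of all cylinders with positive answers gives convergence of
the laws of the codes. -/
lemma tendsto_measureReal_cylinder {ι Ω Ω' : Type*} [MeasurableSpace Ω] [MeasurableSpace Ω']
    {P : Measure Ω} {P' : Measure Ω'} [IsProbabilityMeasure P] [IsProbabilityMeasure P']
    {l : Filter ι} {A : C → Set E} {Y : ι → Ω → E} {Z : Ω' → E}
    (hY : ∀ n c, NullMeasurableSet {ω | Y n ω ∈ A c} P)
    (hZ : ∀ c, NullMeasurableSet {ω | Z ω ∈ A c} P')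
    (hlim : ∀ F : Finset C, Tendsto (fun n => P.real {ω | ∀ c ∈ F, Y n ω ∈ A c}) l
      (𝓝 (P'.real {ω | ∀ c ∈ F, Z ω ∈ A c}))) (G : Finset C) (F : Finset C) :
    Tendsto (fun n => P.real {ω | (∀ c ∈ F, Y n ω ∈ A c) ∧ ∀ c ∈ G, Y n ω ∉ A c}) l
      (𝓝 (P'.real {ω | (∀ c ∈ F, Z ω ∈ A c) ∧ ∀ c ∈ G, Z ω ∉ A c})) := by
  classical
  induction G using Finset.induction_on generalizing F with
  | empty => simpa using hlim F
  | insert a G ha ih =>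
    rw [measureReal_cylinder_insert (hZ a)]
    exact ((ih F).sub (ih (insert a F))).congr fun n =>
      (measureReal_cylinder_insert (hY n a) F G).symm

/-- Cylinders form a π-system and a neighbourhood basis of the Cantor space, so their probabilities
decide weak convergence of the codes. Open sets of `E` agree on `D` with preimages of open sets of
codes, so the liminf inequality for open sets passes back to `E`. -/
theorem tendstoInDistribution_of_setCode [TopologicalSpace E] [MeasurableSpace E] [BorelSpace E]
    [Countable C] {A : C → Set E} {D : Set E}
    (hconv : ∀ x ∈ D, ∀ s : ℕ → E, (∀ n, s n ∈ D) →
      (∀ c, ∀ᶠ n in atTop, (s n ∈ A c ↔ x ∈ A c)) → Tendsto s atTop (𝓝 x))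
    {ι Ω Ω' : Type*} [MeasurableSpace Ω] [MeasurableSpace Ω']
    {P : Measure Ω} {P' : Measure Ω'} [IsProbabilityMeasure P] [IsProbabilityMeasure P']
    {l : Filter ι} [l.IsCountablyGenerated] {Y : ι → Ω → E} {Z : Ω' → E}
    (hYD : ∀ n, ∀ᵐ ω ∂P, Y n ω ∈ D) (hZD : ∀ᵐ ω ∂P', Z ω ∈ D)
    (hY : ∀ n c, NullMeasurableSet {ω | Y n ω ∈ A c} P)
    (hZ : ∀ c, NullMeasurableSet {ω | Z ω ∈ A c} P')
    (hlim : ∀ F : Finset C, Tendsto (fun n => P.real {ω | ∀ c ∈ F, Y n ω ∈ A c}) l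
      (𝓝 (P'.real {ω | ∀ c ∈ F, Z ω ∈ A c}))) :
    TendstoInDistribution Y l Z (fun _ => P) P' := by
  classical
  have hYm : ∀ n, AEMeasurable (Y n) P := fun n => aemeasurable_of_setCode hconv (hYD n) (hY n)
  have hZm : AEMeasurable Z P' := aemeasurable_of_setCode hconv hZD hZ
  have hYc := fun n => aemeasurable_setCode (hY n)
  have hZc := aemeasurable_setCode hZ
  refine ⟨hYm, hZm, ?_⟩
  let S : Set (Set (C → Bool)) := range fun FG : Finset C × Finset C =>
    {b | (∀ c ∈ FG.1, b c = true) ∧ ∀ c ∈ FG.2, b c = false}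
  have hS : IsPiSystem S := by
    rintro _ ⟨⟨F, G⟩, rfl⟩ _ ⟨⟨F', G'⟩, rfl⟩ _
    refine ⟨(F ∪ F', G ∪ G'), ?_⟩
    ext b
    simp only [Finset.mem_union, mem_ofPred_eq, mem_inter_iff]
    constructor
    · rintro ⟨h1, h2⟩
      exact ⟨⟨fun c hc => h1 c (.inl hc), fun c hc => h2 c (.inl hc)⟩,
        fun c hc => h1 c (.inr hc), fun c hc => h2 c (.inr hc)⟩
    · rintro ⟨⟨h1, h2⟩, h3, h4⟩
      exact ⟨fun c hc => hc.elim (h1 c) (h3 c), fun c hc => hc.elim (h2 c) (h4 c)⟩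
  let μ : ι → ProbabilityMeasure (C → Bool) := fun n =>
    ⟨P.map fun ω => setCode A (Y n ω), Measure.isProbabilityMeasure_map (hYc n)⟩
  let ν : ProbabilityMeasure (C → Bool) :=
    ⟨P'.map fun ω => setCode A (Z ω), Measure.isProbabilityMeasure_map hZc⟩
  have hμν : Tendsto μ l (𝓝 ν) := by
    refine hS.tendsto_probabilityMeasure_of_tendsto_of_mem ?_ ?_ ?_
    · rintro _ ⟨⟨F, G⟩, rfl⟩
      exact (isOpen_cylinder F G).measurableSet
    · intro u hu x hx
      obtain ⟨I, v, hv, hvu⟩ := isOpen_pi_iff.1 hu x hx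
      -- The cylinder that prescribes the answers of `x` on the finite set `I` of coordinates
      -- constrained by the basic open set.
      refine ⟨_, ⟨(I.filter fun c => x c = true, I.filter fun c => x c = false), rfl⟩,
        (isOpen_cylinder _ _).mem_nhds ?_, fun b hb => hvu fun c hc => ?_⟩
      · simp
      · have : b c = x c := by
          cases hxc : x c
          · exact hb.2 c (by simpa [hxc] using hc)
          · exact hb.1 c (by simpa [hxc] using hc)
        rw [this]
        exact (hv c hc).2
    · rintro _ ⟨⟨F, G⟩, rfl⟩
      have h := tendsto_measureReal_cylinder hY hZ hlim G F
      rw [← NNReal.tendsto_coe]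
      convert h using 2
      · exact congrArg ENNReal.toReal (map_setCode_cylinder (hYc _) F G)
      · exact congrArg ENNReal.toReal (map_setCode_cylinder hZc F G)
  refine tendsto_of_forall_isOpen_le_liminf' fun U hU => ?_
  obtain ⟨V, hV, hUV⟩ := exists_isOpen_setCode hconv hU
  have h := ProbabilityMeasure.le_liminf_measure_open_of_tendsto hμν hV
  convert h using 1
  · change P'.map Z U = (P'.map fun ω => setCode A (Z ω)) V
    rw [Measure.map_apply_of_aemeasurable hZm hU.measurableSet,
      Measure.map_apply_of_aemeasurable hZc hV.measurableSet]
    refine measure_congr ?_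
    filter_upwards [hZD] with ω hω
    exact propext (hUV _ hω)
  · congr 1
    funext n
    change P.map (Y n) U = (P.map fun ω => setCode A (Y n ω)) V
    rw [Measure.map_apply_of_aemeasurable (hYm n) hU.measurableSet,
      Measure.map_apply_of_aemeasurable (hYc n) hV.measurableSet]
    refine measure_congr ?_
    filter_upwards [hYD n] with ω hω
    exact propext (hUV _ hω)

end Coding

/-! ### The `M₁` distance of decreasing functions -/

section GraphTime

set_option linter.unusedSectionVars false

variable {I : Type*} [LinearOrder I] [MetricSpace I] {c : I → ℝ} {r : ℝ → I} {a b : I}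
  {g : I → ℝ}

/-- For a decreasing function `g`, the abscissa of the point of the completed graph on `[a, b]` at
which abscissa minus ordinate equals `s`. -/
noncomputable def graphTime (c : I → ℝ) (a b : I) (g : I → ℝ) (s : ℝ) : ℝ :=
  sSup (c '' {t | t ∈ Icc a b ∧ (t = a ∨ c t - g t ≤ s)})

lemma graphTime_bddAbove (hm : StrictMono c) (s : ℝ) :
    BddAbove (c '' {t | t ∈ Icc a b ∧ (t = a ∨ c t - g t ≤ s)}) :=
  ⟨c b, by rintro _ ⟨t, ht, rfl⟩; exact hm.monotone ht.1.2⟩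

lemma le_graphTime (hm : StrictMono c) {s : ℝ} {t : I} (ht : t ∈ Icc a b)
    (hs : c t - g t ≤ s) : c t ≤ graphTime c a b g s :=
  le_csSup (graphTime_bddAbove hm s) ⟨t, ⟨ht, .inr hs⟩, rfl⟩

lemma left_le_graphTime (hm : StrictMono c) (hab : a ≤ b) (s : ℝ) :
    c a ≤ graphTime c a b g s :=
  le_csSup (graphTime_bddAbove hm s) ⟨a, ⟨⟨le_rfl, hab⟩, .inl rfl⟩, rfl⟩

lemma graphTime_le (hab : a ≤ b) {s x : ℝ} (hx : c a ≤ x)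
    (h : ∀ t ∈ Icc a b, c t - g t ≤ s → c t ≤ x) : graphTime c a b g s ≤ x := by
  refine csSup_le ⟨c a, a, ⟨⟨le_rfl, hab⟩, .inl rfl⟩, rfl⟩ ?_
  rintro _ ⟨t, ⟨ht, rfl | hs⟩, rfl⟩
  · exact hx
  · exact h t ht hs

lemma graphTime_mem_Icc (hm : StrictMono c) (hab : a ≤ b) (s : ℝ) :
    graphTime c a b g s ∈ Icc (c a) (c b) :=
  ⟨left_le_graphTime hm hab s,
    graphTime_le hab (hm.monotone hab) fun _ ht _ => hm.monotone ht.2⟩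

lemma graphTime_mono (hm : StrictMono c) (hab : a ≤ b) : Monotone (graphTime c a b g) :=
  fun _ s' hs => graphTime_le hab (left_le_graphTime hm hab s') fun _ ht h =>
    le_graphTime hm ht (h.trans hs)

/-- Moving left by `s' - s` cannot lower `g`, so abscissa minus ordinate drops by at least `s' - s`.
Here `r` supplies the shifted point. Jumps of `g` do no harm: on them the abscissa stands still. -/
lemma graphTime_le_add (hm : StrictMono c) (hr : ∀ x ∈ Icc (c a) (c b), c (r x) = x)
    (hg : Antitone g) (hab : a ≤ b) {s s' : ℝ} (hs : s ≤ s') :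
    graphTime c a b g s' ≤ graphTime c a b g s + (s' - s) := by
  have h0 := left_le_graphTime (g := g) hm hab s
  refine graphTime_le hab (by linarith) fun t ht hts => ?_
  have htb : c t ≤ c b := hm.monotone ht.2
  by_cases h : c a ≤ c t - (s' - s)
  · have h1 := hr (c t - (s' - s)) ⟨h, by linarith⟩
    have h2 : r (c t - (s' - s)) ≤ t := hm.le_iff_le.1 (by rw [h1]; linarith)
    have h3 := le_graphTime (s := s) (g := g) hm
      (⟨hm.le_iff_le.1 (by rwa [h1]), h2.trans ht.2⟩ : r (c t - (s' - s)) ∈ Icc a b)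
      (by rw [h1]; linarith [hg h2])
    linarith
  · linarith

lemma abs_graphTime_sub_le (hm : StrictMono c) (hr : ∀ x ∈ Icc (c a) (c b), c (r x) = x)
    (hg : Antitone g) (hab : a ≤ b) (s s' : ℝ) :
    |graphTime c a b g s - graphTime c a b g s'| ≤ |s - s'| := by
  rcases le_total s s' with h | h
  · rw [abs_sub_comm, abs_sub_comm s, abs_of_nonneg (sub_nonneg.2 h),
      abs_of_nonneg (sub_nonneg.2 (graphTime_mono hm hab h))]
    linarith [graphTime_le_add hm hr hg hab h]
  · rw [abs_of_nonneg (sub_nonneg.2 h), abs_of_nonneg (sub_nonneg.2 (graphTime_mono hm hab h))]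
    linarith [graphTime_le_add hm hr hg hab h]

/-- Closeness is asked only at some `t'` slightly to the left of `t`, which can be chosen in a dense
set and need not be a point where `g₁` and `g₂` are close at `t` itself. One `ε` pays for the shift
in time, the other for the change of value through the Lipschitz bound. -/
lemma graphTime_le_of_close (hm : StrictMono c) (hr : ∀ x ∈ Icc (c a) (c b), c (r x) = x)
    {g₁ g₂ : I → ℝ} (hg₁ : Antitone g₁) (hg₂ : Antitone g₂) (hab : a ≤ b) {ε : ℝ} (hε : 0 ≤ ε)
    (h : ∀ t ∈ Icc a b, ∃ t' ∈ Icc a b, c t - ε ≤ c t' ∧ t' ≤ t ∧ |g₁ t' - g₂ t'| ≤ ε) (s : ℝ) :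
    graphTime c a b g₁ s ≤ graphTime c a b g₂ s + 2 * ε := by
  have h0 := left_le_graphTime (g := g₂) hm hab s
  refine graphTime_le hab (by linarith) fun t ht hts => ?_
  obtain ⟨t', ht', h1, h2, h3⟩ := h t ht
  have h4 := le_graphTime (s := s + ε) (g := g₂) hm ht'
    (by linarith [hg₁ h2, hm.monotone h2, abs_le.1 h3])
  have h5 := graphTime_le_add hm hr hg₂ hab (show s ≤ s + ε by linarith)
  linarith

lemma abs_graphTime_sub_le_of_close (hm : StrictMono c) (hr : ∀ x ∈ Icc (c a) (c b), c (r x) = x)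
    {g₁ g₂ : I → ℝ} (hg₁ : Antitone g₁) (hg₂ : Antitone g₂) (hab : a ≤ b) {ε : ℝ} (hε : 0 ≤ ε)
    (h : ∀ t ∈ Icc a b, ∃ t' ∈ Icc a b, c t - ε ≤ c t' ∧ t' ≤ t ∧ |g₁ t' - g₂ t'| ≤ ε) (s : ℝ) :
    |graphTime c a b g₁ s - graphTime c a b g₂ s| ≤ 2 * ε := by
  have h1 := graphTime_le_of_close hm hr hg₁ hg₂ hab hε h s
  have h2 := graphTime_le_of_close hm hr hg₂ hg₁ hab hε
    (by simpa only [abs_sub_comm] using h) s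
  exact abs_le.2 ⟨by linarith, by linarith⟩

variable [OrderTopology I] [DenselyOrdered I]

lemma le_leftLimFrom (hg : Antitone g) (t : I) : g t ≤ leftLimFrom a g t := by
  unfold leftLimFrom
  split_ifs with h
  · rw [h]
  · exact hg.le_leftLim le_rfl

lemma leftLimFrom_le (hg : Antitone g) {t' t : I} (hat : a ≤ t') (h : t' < t) :
    leftLimFrom a g t ≤ g t' := by
  unfold leftLimFrom
  rw [if_neg (hat.trans_lt h).ne']
  exact hg.leftLim_le h

lemma mem_completedGraph_iff (hg : Antitone g) {p : I × ℝ} :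
    p ∈ completedGraph a b g ↔
      p.1 ∈ Icc a b ∧ g p.1 ≤ p.2 ∧ p.2 ≤ leftLimFrom a g p.1 := by
  unfold completedGraph
  rw [mem_ofPred_eq, uIcc_of_ge (le_leftLimFrom hg _)]
  rfl

/-- To the right of the abscissa `t`, `c - g` is at least `s`, and right continuity gives `g t ≤ c t
- s`. To its left `c - g` is at most `s`, which gives the bound by the left limit. At `t = b` and `t
= a` the range assumed for `s` takes over. -/
lemma mem_completedGraph_graphTime (hm : StrictMono c)
    (hr : ∀ x ∈ Icc (c a) (c b), c (r x) = x) (hg : Antitone g)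
    (hgr : ∀ t, ContinuousWithinAt g (Ici t) t) (hc : Isometry c) (hab : a ≤ b) {s : ℝ}
    (hs : s ∈ Icc (c a - g a) (c b - g b)) :
    (r (graphTime c a b g s), graphTime c a b g s - s) ∈ completedGraph a b g := by
  have hmem := graphTime_mem_Icc (g := g) hm hab s
  set t := r (graphTime c a b g s) with ht
  have hct : c t = graphTime c a b g s := hr _ hmem
  rw [← hct] at hmem ⊢
  have hat : a ≤ t := hm.le_iff_le.1 hmem.1
  have htb : t ≤ b := hm.le_iff_le.1 hmem.2
  rw [mem_completedGraph_iff hg]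
  refine ⟨⟨hat, htb⟩, ?_, ?_⟩
  · rcases htb.eq_or_lt with h | h
    · change g t ≤ _
      rw [h]; linarith [hs.2]
    · have hlim : Tendsto (fun x => c x - g x) (𝓝[>] t) (𝓝 (c t - g t)) :=
        (hc.continuous.continuousWithinAt (s := Ioi t)).sub ((hgr t).mono Ioi_subset_Ici_self)
      have : (𝓝[>] t).NeBot := nhdsGT_neBot_of_exists_gt ⟨b, h⟩
      have h1 : s ≤ c t - g t := by
        refine ge_of_tendsto hlim ?_
        filter_upwards [Ioo_mem_nhdsGT h] with x hx
        by_contra! hcon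
        have := le_graphTime hm ⟨hat.trans hx.1.le, hx.2.le⟩ hcon.le
        rw [← hct, hm.le_iff_le] at this
        exact absurd hx.1 (not_lt.2 this)
      change g t ≤ _
      linarith
  · change c t - s ≤ leftLimFrom a g t
    unfold leftLimFrom
    split_ifs with h
    · rw [h]; linarith [hs.1]
    · have hat' : a < t := lt_of_le_of_ne hat (Ne.symm h)
      have : (𝓝[<] t).NeBot := nhdsLT_neBot_of_exists_lt ⟨a, hat'⟩
      have hlim : Tendsto (fun x => c x - g x) (𝓝[<] t) (𝓝 (c t - Function.leftLim g t)) :=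
        ((hc.continuous.tendsto t).mono_left nhdsWithin_le_nhds).sub (hg.tendsto_leftLim t)
      have h1 : c t - Function.leftLim g t ≤ s := by
        refine le_of_tendsto hlim ?_
        filter_upwards [Ioo_mem_nhdsLT hat'] with x hx
        by_contra! hcon
        have := graphTime_le (s := s) (g := g) (x := c x) hab (hm.monotone hx.1.le) fun y hy hys => by
          by_contra! hxy
          linarith [hg (hm.lt_iff_lt.1 hxy).le]
        rw [← hct, hm.le_iff_le] at this
        exact absurd hx.2 (not_lt.2 this)
      linarith

lemma graphTime_of_mem_completedGraph (hm : StrictMono c) (hg : Antitone g)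
    (hr : ∀ x ∈ Icc (c a) (c b), c (r x) = x)
    (hab : a ≤ b) {p : I × ℝ} (hp : p ∈ completedGraph a b g) :
    graphTime c a b g (c p.1 - p.2) = c p.1 ∧ c p.1 - p.2 ∈ Icc (c a - g a) (c b - g b) := by
  obtain ⟨t, y⟩ := p
  rw [mem_completedGraph_iff hg] at hp
  obtain ⟨⟨hat, htb⟩, h1, h2⟩ := hp
  dsimp only at *
  have hL : leftLimFrom a g t ≤ g a := by
    rcases hat.eq_or_lt with h | h
    · simp [leftLimFrom, ← h]
    · exact leftLimFrom_le hg le_rfl h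
  refine ⟨le_antisymm ?_ ?_, by linarith [hm.monotone hat], by linarith [hm.monotone htb, hg htb]⟩
  · refine graphTime_le hab (hm.monotone hat) fun t' ht' h => ?_
    by_contra! hlt
    linarith [hg (hm.lt_iff_lt.1 hlt).le]
  · refine le_of_forall_lt fun x hx => ?_
    by_cases hxa : x < c a
    · exact hxa.trans_le (left_le_graphTime hm hab _)
    · push Not at hxa
      -- A point strictly between `x` and `c t`: its value is at least the left limit at `t`, so it
      -- still counts towards the supremum.
      have hmid : (x + c t) / 2 ∈ Icc (c a) (c b) :=
        ⟨by linarith, by linarith [hm.monotone htb]⟩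
      have h3 := hr _ hmid
      have h4 : r ((x + c t) / 2) < t := hm.lt_iff_lt.1 (by rw [h3]; linarith)
      have h5 : a ≤ r ((x + c t) / 2) := hm.le_iff_le.1 (by rw [h3]; exact hmid.1)
      have h6 := leftLimFrom_le hg h5 h4
      have := le_graphTime (s := c t - y) (g := g) hm ⟨h5, h4.le.trans htb⟩ (by linarith)
      rw [h3] at this
      linarith

/-- The affine map from `[a, b]` onto the range of abscissa minus ordinate on the graph. -/
noncomputable def graphScale (c : I → ℝ) (a b : I) (g : I → ℝ) (x : I) : ℝ :=
  (c a - g a) + ((c b - g b) - (c a - g a)) * ((c x - c a) / (c b - c a))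

/-- The parametrization of the completed graph of a decreasing function by (affinely rescaled)
abscissa minus ordinate. -/
noncomputable def graphParam (c : I → ℝ) (r : ℝ → I) (a b : I) (g : I → ℝ) (x : I) : I × ℝ :=
  (r (graphTime c a b g (graphScale c a b g x)),
    graphTime c a b g (graphScale c a b g x) - graphScale c a b g x)

lemma fraction_mem (hm : StrictMono c) (hab : a < b) {x : I} (hx : x ∈ Icc a b) :
    (c x - c a) / (c b - c a) ∈ Icc (0 : ℝ) 1 := by
  have h := hm hab
  have h1 := hm.monotone hx.1
  have h2 := hm.monotone hx.2
  exact ⟨div_nonneg (by linarith) (by linarith), div_le_one_of_le₀ (by linarith) (by linarith)⟩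

/-- Along the graph of a decreasing function, abscissa minus ordinate strictly increases, both
between jumps and down a jump, so it serves as a global parameter. While the abscissa is constant
the ordinate falls towards `g t`, which is the order required at a jump. -/
lemma isParametrization_graphParam (hm : StrictMono c)
    (hr : ∀ x ∈ Icc (c a) (c b), c (r x) = x) (hg : Antitone g)
    (hgr : ∀ t, ContinuousWithinAt g (Ici t) t) (hc : Isometry c) (hab : a < b) :
    IsParametrization a b g (graphParam c r a b g) := by
  have hcab := hm hab
  have hlen : 0 < (c b - g b) - (c a - g a) := by linarith [hg hab.le]
  have hscale : Continuous (graphScale c a b g) := by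
    unfold graphScale
    have := hc.continuous
    fun_prop
  have htime : Continuous (graphTime c a b g) :=
    (LipschitzWith.of_dist_le_mul (K := 1) fun s s' => by
      simpa [Real.dist_eq] using abs_graphTime_sub_le hm hr hg hab.le s s').continuous
  have hmem : ∀ x ∈ Icc a b, graphScale c a b g x ∈ Icc (c a - g a) (c b - g b) := by
    intro x hx
    have h1 := fraction_mem hm hab hx
    unfold graphScale
    constructor
    · nlinarith [h1.1]
    · nlinarith [h1.2]
  have hG := fun x hx => mem_completedGraph_graphTime hm hr hg hgr hc hab.le (hmem x hx)
  refine ⟨?_, ?_, ?_⟩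
  · refine Continuous.continuousOn (Continuous.prodMk ?_ ((htime.comp hscale).sub hscale))
    rw [← hc.comp_continuous_iff]
    have : c ∘ (fun x => r (graphTime c a b g (graphScale c a b g x))) =
        graphTime c a b g ∘ graphScale c a b g :=
      funext fun x => hr _ (graphTime_mem_Icc hm hab.le _)
    rw [this]
    exact htime.comp hscale
  · refine Subset.antisymm ?_ fun p hp => ?_
    · rintro _ ⟨x, hx, rfl⟩
      exact hG x hx
    · obtain ⟨h1, h2⟩ := graphTime_of_mem_completedGraph hm hg hr hab.le hp
      have hp1 := ((mem_completedGraph_iff hg).1 hp).1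
      set q := ((c p.1 - p.2) - (c a - g a)) / ((c b - g b) - (c a - g a)) with hq
      have hq0 : 0 ≤ q := div_nonneg (by linarith [h2.1]) hlen.le
      have hq1 : q ≤ 1 := div_le_one_of_le₀ (by linarith [h2.2]) hlen.le
      have hx : c a + (c b - c a) * q ∈ Icc (c a) (c b) := ⟨by nlinarith, by nlinarith⟩
      have hcx := hr _ hx
      have hs : graphScale c a b g (r (c a + (c b - c a) * q)) = c p.1 - p.2 := by
        unfold graphScale
        have hne : c b - c a ≠ 0 := by linarith
        rw [hcx, add_sub_cancel_left, mul_div_cancel_left₀ _ hne, hq,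
          mul_div_cancel₀ _ hlen.ne']
        ring
      refine ⟨r (c a + (c b - c a) * q), ⟨hm.le_iff_le.1 (by rw [hcx]; exact hx.1),
        hm.le_iff_le.1 (by rw [hcx]; exact hx.2)⟩, ?_⟩
      unfold graphParam
      rw [hs, h1]
      refine Prod.ext (hm.injective ?_) (by simp)
      exact hr _ ⟨hm.monotone hp1.1, hm.monotone hp1.2⟩
  · intro s' hs' s hs hlt
    have h1 : graphScale c a b g s' < graphScale c a b g s := by
      unfold graphScale
      have := hm hlt
      gcongr
    have h2 := graphTime_mono (g := g) hm hab.le h1.le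
    have e1 := hr _ (graphTime_mem_Icc (g := g) hm hab.le (graphScale c a b g s'))
    have e2 := hr _ (graphTime_mem_Icc (g := g) hm hab.le (graphScale c a b g s))
    rcases h2.eq_or_lt with h | h
    · right
      have h3 := ((mem_completedGraph_iff hg).1 (hG s hs)).2.1
      have h4 := ((mem_completedGraph_iff hg).1 (hG s' hs')).2.1
      unfold graphParam
      dsimp only at *
      rw [h] at h4 ⊢
      refine ⟨rfl, ?_⟩
      rw [abs_of_nonneg (by linarith), abs_of_nonneg (by linarith)]
      linarith
    · left
      refine hm.lt_iff_lt.1 ?_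
      unfold graphParam
      dsimp only
      rw [e1, e2]
      exact h

/-- The canonical parametrizations are compared directly. Closeness at the end points makes the two
affine scales differ by at most `ε`; the abscissae then differ by at most `ε + 2 * ε`, and the
ordinates by one `ε` more. -/
lemma m1Dist_le_of_close (hm : StrictMono c) (hr : ∀ x ∈ Icc (c a) (c b), c (r x) = x)
    (hc : Isometry c) {g₁ g₂ : I → ℝ} (hg₁ : Antitone g₁) (hg₂ : Antitone g₂)
    (hgr₁ : ∀ t, ContinuousWithinAt g₁ (Ici t) t) (hgr₂ : ∀ t, ContinuousWithinAt g₂ (Ici t) t)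
    (hab : a < b) {ε : ℝ} (hε : 0 ≤ ε)
    (ha : |g₁ a - g₂ a| ≤ ε) (hb : |g₁ b - g₂ b| ≤ ε)
    (h : ∀ t ∈ Icc a b, ∃ t' ∈ Icc a b, c t - ε ≤ c t' ∧ t' ≤ t ∧ |g₁ t' - g₂ t'| ≤ ε) :
    m1Dist a b g₁ g₂ ≤ ENNReal.ofReal (4 * ε) := by
  have hscale : ∀ x ∈ Icc a b, |graphScale c a b g₁ x - graphScale c a b g₂ x| ≤ ε := by
    intro x hx
    have h1 := fraction_mem hm hab hx
    unfold graphScale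
    set q := (c x - c a) / (c b - c a)
    have e : (c a - g₁ a) + ((c b - g₁ b) - (c a - g₁ a)) * q -
        ((c a - g₂ a) + ((c b - g₂ b) - (c a - g₂ a)) * q) =
        -((1 - q) * (g₁ a - g₂ a) + q * (g₁ b - g₂ b)) := by ring
    rw [e, abs_neg]
    rw [abs_le] at ha hb ⊢
    constructor <;> nlinarith [h1.1, h1.2]
  have htime : ∀ x ∈ Icc a b, |graphTime c a b g₁ (graphScale c a b g₁ x) -
      graphTime c a b g₂ (graphScale c a b g₂ x)| ≤ 3 * ε := by
    intro x hx
    have h1 := abs_graphTime_sub_le hm hr hg₁ hab.le (graphScale c a b g₁ x)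
      (graphScale c a b g₂ x)
    have h2 := abs_graphTime_sub_le_of_close hm hr hg₁ hg₂ hab.le hε h (graphScale c a b g₂ x)
    have h3 := hscale x hx
    have := abs_sub_le (graphTime c a b g₁ (graphScale c a b g₁ x))
      (graphTime c a b g₁ (graphScale c a b g₂ x)) (graphTime c a b g₂ (graphScale c a b g₂ x))
    linarith
  refine (iInf₂_le_of_le _ (isParametrization_graphParam hm hr hg₁ hgr₁ hc hab) <|
    iInf₂_le_of_le _ (isParametrization_graphParam hm hr hg₂ hgr₂ hc hab) le_rfl).trans ?_
  refine sup_le (iSup₂_le fun x hx => ?_) (iSup₂_le fun x hx => ?_)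
  · rw [← hc.edist_eq, edist_dist]
    refine ENNReal.ofReal_le_ofReal ?_
    unfold graphParam
    dsimp only
    rw [hr _ (graphTime_mem_Icc hm hab.le _), hr _ (graphTime_mem_Icc hm hab.le _), Real.dist_eq]
    linarith [htime x hx]
  · rw [edist_dist]
    refine ENNReal.ofReal_le_ofReal ?_
    unfold graphParam
    dsimp only
    rw [Real.dist_eq, sub_sub_sub_comm]
    have := abs_sub (graphTime c a b g₁ (graphScale c a b g₁ x) -
      graphTime c a b g₂ (graphScale c a b g₂ x))
      (graphScale c a b g₁ x - graphScale c a b g₂ x)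
    linarith [htime x hx, hscale x hx]

/-- The degenerate interval has to be treated because `0` is always a continuity point of a path on
`[0, ∞)`, so `T = 0` occurs in `PathSpace.M1Conv`. -/
lemma m1Dist_self_le (a : I) (g₁ g₂ : I → ℝ) : m1Dist a a g₁ g₂ ≤ edist (g₁ a) (g₂ a) := by
  have h : ∀ g : I → ℝ, IsParametrization a a g fun _ => (a, g a) := by
    intro g
    refine ⟨continuousOn_const, ?_, ?_⟩
    · ext ⟨t, y⟩
      simp only [completedGraph, leftLimFrom, Icc_self, image_singleton, mem_singleton_iff,
        mem_ofPred_eq, Prod.mk.injEq]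
      refine and_congr_right fun h => ?_
      subst h
      simp
    · intro s' hs' s hs hlt
      rw [Icc_self, mem_singleton_iff] at hs hs'
      exact absurd (hs'.trans hs.symm) hlt.ne
  refine (iInf₂_le_of_le _ (h g₁) <| iInf₂_le_of_le _ (h g₂) le_rfl).trans ?_
  simp

/-- Decreasing right continuous functions that converge pointwise on a dense set and at the end
points converge in the `M₁` distance. -/
lemma tendsto_m1Dist_of_antitone (hm : StrictMono c)
    (hr : ∀ x ∈ Icc (c a) (c b), c (r x) = x) (hc : Isometry c) {gs : ℕ → I → ℝ}
    (hgs : ∀ n, Antitone (gs n)) (hg : Antitone g)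
    (hgsr : ∀ n t, ContinuousWithinAt (gs n) (Ici t) t)
    (hgr : ∀ t, ContinuousWithinAt g (Ici t) t)
    (hab : a < b) {Q : Set I} (hQ : Dense Q)
    (hlim : ∀ q ∈ Q, Tendsto (fun n => gs n q) atTop (𝓝 (g q)))
    (ha : Tendsto (fun n => gs n a) atTop (𝓝 (g a)))
    (hb : Tendsto (fun n => gs n b) atTop (𝓝 (g b))) :
    Tendsto (fun n => m1Dist a b (gs n) g) atTop (𝓝 0) := by
  have hclose : ∀ ε > 0, ∀ t, Tendsto (fun n => gs n t) atTop (𝓝 (g t)) →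
      ∀ᶠ n in atTop, |gs n t - g t| ≤ ε := fun ε hε t ht => by
    filter_upwards [(Metric.tendsto_nhds.1 ht) ε hε] with n hn
    exact hn.le
  have key : ∀ ε > 0, ∀ᶠ n in atTop, m1Dist a b (gs n) g ≤ ENNReal.ofReal (4 * ε) := by
    intro ε hε
    -- Compactness reduces uniformity in `t` to finitely many comparison points: the end point `a`
    -- for times within `ε` of it, otherwise some `q ∈ Q` just to the left.
    have hgrid : ∀ᶠ n in atTop, ∀ t ∈ Icc a b, c t ∈ Icc (c a) (c b) →
        ∃ t' ∈ Icc a b, c t - ε ≤ c t' ∧ t' ≤ t ∧ |gs n t' - g t'| ≤ ε := by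
      refine (isCompact_Icc (a := c a) (b := c b)).induction_on
        (p := fun s => ∀ᶠ n in atTop, ∀ t ∈ Icc a b, c t ∈ s →
          ∃ t' ∈ Icc a b, c t - ε ≤ c t' ∧ t' ≤ t ∧ |gs n t' - g t'| ≤ ε)
        (by simp) (fun s s' hss h => h.mono fun n hn t ht hts => hn t ht (hss hts)) ?_ ?_
      · intro s s' h h'
        filter_upwards [h, h'] with n hn hn' t ht hts
        exact hts.elim (hn t ht) (hn' t ht)
      · intro x hx
        by_cases hxa : x < c a + ε
        · refine ⟨Iio (c a + ε), mem_nhdsWithin_of_mem_nhds (Iio_mem_nhds hxa), ?_⟩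
          filter_upwards [hclose ε hε a ha] with n hn t ht hts
          exact ⟨a, ⟨le_rfl, hab.le⟩, by linarith [mem_Iio.1 hts], ht.1, hn⟩
        · push Not at hxa
          have e1 := hr x hx
          have e2 := hr (x - ε / 2) ⟨by linarith, by linarith [hx.2]⟩
          obtain ⟨q, hqQ, hq1, hq2⟩ := hQ.exists_between
            (show r (x - ε / 2) < r x from hm.lt_iff_lt.1 (by rw [e1, e2]; linarith))
          rw [← hm.lt_iff_lt, e2] at hq1
          rw [← hm.lt_iff_lt, e1] at hq2
          refine ⟨Ioo (c q) (c q + ε),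
            mem_nhdsWithin_of_mem_nhds (Ioo_mem_nhds hq2 (by linarith)), ?_⟩
          filter_upwards [hclose ε hε q (hlim q hqQ)] with n hn t ht hts
          have hqt : q ≤ t := hm.le_iff_le.1 hts.1.le
          exact ⟨q, ⟨hm.le_iff_le.1 (by linarith), hqt.trans ht.2⟩, by linarith [hts.2], hqt, hn⟩
    filter_upwards [hgrid, hclose ε hε a ha, hclose ε hε b hb] with n h1 h2 h3
    exact m1Dist_le_of_close hm hr hc (hgs n) hg (hgsr n) hgr hab hε.le h2 h3
      fun t ht => h1 t ht ⟨hm.monotone ht.1, hm.monotone ht.2⟩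
  refine ENNReal.tendsto_nhds_zero.2 fun δ hδ => ?_
  rcases eq_or_ne δ ⊤ with rfl | hδt
  · simp
  · filter_upwards [key (δ.toReal / 4) (by have := ENNReal.toReal_pos hδ.ne' hδt; positivity)]
      with n hn
    refine hn.trans ?_
    rw [mul_div_cancel₀ _ (by norm_num), ENNReal.ofReal_toReal hδt]

lemma tendsto_of_antitone_of_continuousAt {gs : ℕ → I → ℝ}
    (hgs : ∀ n, Antitone (gs n)) {Q : Set I} (hQ : Dense Q)
    (hlim : ∀ q ∈ Q, Tendsto (fun n => gs n q) atTop (𝓝 (g q))) {t a b : I} (hat : a < t)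
    (htb : t < b) (ht : ContinuousAt g t) : Tendsto (fun n => gs n t) atTop (𝓝 (g t)) := by
  rw [tendsto_order]
  constructor
  · intro x hx
    obtain ⟨u, hu, hut⟩ := exists_Ico_subset_of_mem_nhds (ht.eventually (lt_mem_nhds hx)) ⟨b, htb⟩
    obtain ⟨q, hqQ, hq1, hq2⟩ := hQ.exists_between hu
    filter_upwards [(hlim q hqQ).eventually (lt_mem_nhds (hut ⟨hq1.le, hq2⟩))] with n hn
    exact lt_of_lt_of_le hn (hgs n hq1.le)
  · intro x hx
    obtain ⟨u, hu, hut⟩ := exists_Ioc_subset_of_mem_nhds (ht.eventually (gt_mem_nhds hx)) ⟨a, hat⟩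
    obtain ⟨q, hqQ, hq1, hq2⟩ := hQ.exists_between hu
    filter_upwards [(hlim q hqQ).eventually (gt_mem_nhds (hut ⟨hq1, hq2.le⟩))] with n hn
    exact lt_of_le_of_lt (hgs n hq2.le) hn

end GraphTime

/-! ### Rational questions determine `M₁` convergence of decreasing paths -/

section Paths

lemma tendsto_nhds_sequentialTopology {α : Type*} {Conv : (ℕ → α) → α → Prop} {s : ℕ → α} {x : α}
    (h : Conv s x) : Tendsto s atTop (@nhds α (sequentialTopology Conv) x) := by
  let _ := sequentialTopology Conv
  exact tendsto_nhds.2 fun U hU hx => hU x hx s h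

lemma compactify_mono : Monotone compactify := by
  intro x y hxy
  unfold compactify
  have : (1 + x)⁻¹ ≠ ⊤ := by simp
  have := ENNReal.toReal_mono this (ENNReal.inv_le_inv.2 (add_le_add_right hxy 1))
  linarith

lemma continuous_compactify : Continuous compactify := by
  unfold compactify
  refine continuous_const.sub (continuous_iff_continuousAt.2 fun x => ?_)
  refine ContinuousAt.comp (g := ENNReal.toReal) (ENNReal.continuousAt_toReal (by simp)) ?_
  fun_prop

lemma exists_nnrat_btwn_real {x y : ℝ} (hx : 0 ≤ x) (h : x < y) :
    ∃ q : ℚ≥0, x < ((q : ℝ≥0) : ℝ) ∧ ((q : ℝ≥0) : ℝ) < y := by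
  obtain ⟨q, h1, h2⟩ := exists_rat_btwn h
  have hq : 0 ≤ q := by exact_mod_cast hx.trans h1.le
  lift q to ℚ≥0 using hq
  have e : ((q : ℝ≥0) : ℝ) = ((q : ℚ) : ℝ) := by
    rw [show ((q : ℝ≥0) : ℝ) = (q : ℝ) from rfl]; simp
  exact ⟨q, by rwa [e], by rwa [e]⟩

lemma exists_nnrat_btwn {x y : ℝ≥0∞} (h : x < y) :
    ∃ q : ℚ≥0, x < (q : ℝ≥0) ∧ ((q : ℝ≥0) : ℝ≥0∞) < y := by
  obtain ⟨z, hz1, hz2⟩ := ENNReal.lt_iff_exists_nnreal_btwn.1 h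
  lift x to ℝ≥0 using hz1.ne_top
  obtain ⟨q, h1, h2⟩ := exists_nnrat_btwn_real x.2 (show (x : ℝ) < z from by exact_mod_cast hz1)
  exact ⟨q, by exact_mod_cast h1, lt_trans (by exact_mod_cast h2) hz2⟩

/-- The set of decreasing paths in `D([0, ∞))`. -/
def antitonePaths : Set PathSpace := {g | Antitone g.toFun}

/-- Rational levels separate values, so stable answers mean pointwise convergence on `Q`. The time
`0` must belong to `Q`: it is the left end of every interval `[0, T]`, and convergence there cannot
be squeezed out of neighbouring times on both sides. -/
lemma tendsto_of_mem_antitonePaths {Q : Set ℝ≥0} (hQ : Dense Q) (h0 : 0 ∈ Q) {x : PathSpace}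
    (hx : x ∈ antitonePaths) {s : ℕ → PathSpace} (hs : ∀ n, s n ∈ antitonePaths)
    (h : ∀ c : Q × ℚ≥0, ∀ᶠ n in atTop,
      (s n ∈ {g : PathSpace | ((c.2 : ℝ≥0) : ℝ≥0∞) ≤ g c.1} ↔
        x ∈ {g : PathSpace | ((c.2 : ℝ≥0) : ℝ≥0∞) ≤ g c.1})) :
    Tendsto s atTop (𝓝 x) := by
  refine tendsto_nhds_sequentialTopology (Conv := PathSpace.M1Conv) fun T hT => ?_
  have hlim : ∀ q ∈ Q, Tendsto (fun n => s n q) atTop (𝓝 (x q)) := by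
    intro q hq
    rw [tendsto_order]
    constructor
    · intro y hy
      obtain ⟨a, ha1, ha2⟩ := exists_nnrat_btwn hy
      filter_upwards [h (⟨q, hq⟩, a)] with n hn
      exact ha1.trans_le (hn.2 ha2.le)
    · intro y hy
      obtain ⟨a, ha1, ha2⟩ := exists_nnrat_btwn hy
      filter_upwards [h (⟨q, hq⟩, a)] with n hn
      by_contra! hcon
      exact absurd (hn.1 (ha2.le.trans hcon)) (not_le.2 ha1)
  have hmono : ∀ g ∈ antitonePaths, Antitone (compactify ∘ g.toFun) :=
    fun g hg => compactify_mono.comp_antitone hg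
  have hright : ∀ (g : PathSpace) t, ContinuousWithinAt (compactify ∘ g.toFun) (Ici t) t :=
    fun g t => continuous_compactify.continuousAt.comp_continuousWithinAt (g.rightContinuous t)
  have hlim' : ∀ q ∈ Q, Tendsto (fun n => (compactify ∘ s n) q) atTop
      (𝓝 ((compactify ∘ x) q)) := fun q hq => (continuous_compactify.tendsto _).comp (hlim q hq)
  rcases eq_or_lt_of_le (zero_le (a := T)) with rfl | hT0
  · refine tendsto_of_tendsto_of_tendsto_of_le_of_le tendsto_const_nhds
      (tendsto_iff_edist_tendsto_0.1 (hlim' 0 h0)) (fun _ => zero_le) fun n => m1Dist_self_le _ _ _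
  · refine tendsto_m1Dist_of_antitone (c := fun t : ℝ≥0 => (t : ℝ)) (r := Real.toNNReal)
      (fun _ _ h => h) (fun y hy => Real.coe_toNNReal _ (NNReal.zero_le_coe.trans hy.1)) (fun _ _ => rfl)
      (fun n => hmono _ (hs n)) (hmono _ hx) (fun n => hright _) (hright _) hT0 hQ hlim' (hlim' 0 h0)
      (tendsto_of_antitone_of_continuousAt (fun n => hmono _ (hs n)) hQ hlim' hT0
        (b := T + 1) (by simp) ?_)
    exact continuous_compactify.continuousAt.comp hT

/-- The set of nonnegative decreasing paths in `D((0, ∞))`. -/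
def antitoneOpenPaths : Set OpenPathSpace := {g | Antitone g.toFun ∧ ∀ t, 0 ≤ g t}

/-- Both end points are interior continuity points of the limit, so monotonicity squeezes the values
there between points of `Q`. Nonnegativity of the paths makes nonnegative rational levels
sufficient. -/
lemma tendsto_of_mem_antitoneOpenPaths {Q : Set (Ioi (0 : ℝ))} (hQ : Dense Q) {x : OpenPathSpace}
    (hx : x ∈ antitoneOpenPaths) {s : ℕ → OpenPathSpace} (hs : ∀ n, s n ∈ antitoneOpenPaths)
    (h : ∀ c : Q × ℚ≥0, ∀ᶠ n in atTop,
      (s n ∈ {g : OpenPathSpace | ((c.2 : ℝ≥0) : ℝ) ≤ g c.1} ↔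
        x ∈ {g : OpenPathSpace | ((c.2 : ℝ≥0) : ℝ) ≤ g c.1})) :
    Tendsto s atTop (𝓝 x) := by
  refine tendsto_nhds_sequentialTopology (Conv := OpenPathSpace.M1Conv) fun a b hab ha hb => ?_
  have hlim : ∀ q ∈ Q, Tendsto (fun n => s n q) atTop (𝓝 (x q)) := by
    intro q hq
    rw [tendsto_order]
    constructor
    · intro y hy
      rcases lt_or_ge y 0 with hy0 | hy0
      · exact .of_forall fun n => hy0.trans_le ((hs n).2 q)
      obtain ⟨a, ha1, ha2⟩ := exists_nnrat_btwn_real hy0 hy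
      filter_upwards [h (⟨q, hq⟩, a)] with n hn
      exact ha1.trans_le (hn.2 ha2.le)
    · intro y hy
      obtain ⟨a, ha1, ha2⟩ := exists_nnrat_btwn_real (hx.2 q) hy
      filter_upwards [h (⟨q, hq⟩, a)] with n hn
      by_contra! hcon
      exact absurd (hn.1 (ha2.le.trans hcon)) (not_le.2 ha1)
  have hex : ∀ t : Ioi (0 : ℝ), (∃ u, u < t) ∧ ∃ u, t < u := fun t => ⟨exists_lt t, exists_gt t⟩
  have hpt : ∀ t, ContinuousAt x t → Tendsto (fun n => s n t) atTop (𝓝 (x t)) := fun t ht =>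
    let ⟨⟨_, h1⟩, ⟨_, h2⟩⟩ := hex t
    tendsto_of_antitone_of_continuousAt (fun n => (hs n).1) hQ hlim h1 h2 ht
  refine tendsto_m1Dist_of_antitone (c := fun t : Ioi (0 : ℝ) => (t : ℝ))
    (r := fun y => if h : 0 < y then ⟨y, h⟩ else ⟨1, mem_Ioi.2 one_pos⟩)
    (fun _ _ h => h) (fun y hy => ?_) (fun _ _ => rfl)
    (fun n => (hs n).1) hx.1 (fun n => (s n).rightContinuous) x.rightContinuous hab hQ hlim
    (hpt a ha) (hpt b hb)
  have : 0 < y := lt_of_lt_of_le a.2 hy.1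
  simp [this]

end Paths

/-! ### Void probabilities of a thinned Poisson process on a line -/

section VoidFactor

/-- The probability that a Poisson process of rate `θ`, thinned with the retention probability `p`,
has no point in `(s, R]`. -/
noncomputable def voidFactor (θ : ℝ) (p : ℝ → ℝ) (R s : ℝ) : ℝ :=
  Real.exp (-θ * ∫ x in s..R, p x)

variable {θ R : ℝ} {p : ℝ → ℝ}

lemma integral_nonneg_of_zero_beyond (h0 : ∀ x, 0 ≤ p x) (hR : ∀ x, R < x → p x = 0) (s : ℝ) :
    0 ≤ ∫ x in s..R, p x := by
  rcases le_total s R with h | h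
  · exact intervalIntegral.integral_nonneg h fun x _ => h0 x
  · rw [intervalIntegral.integral_symm, intervalIntegral.integral_zero_ae, neg_zero]
    refine ae_of_all _ fun x hx => hR x ?_
    rw [uIoc_of_le h] at hx
    exact hx.1

lemma voidFactor_le_one (hθ : 0 ≤ θ) (h0 : ∀ x, 0 ≤ p x) (hR : ∀ x, R < x → p x = 0) (s : ℝ) :
    voidFactor θ p R s ≤ 1 := by
  unfold voidFactor
  rw [Real.exp_le_one_iff]
  have := integral_nonneg_of_zero_beyond h0 hR s
  nlinarith

lemma voidFactor_of_le (hR : ∀ x, R < x → p x = 0) {s : ℝ} (hs : R ≤ s) :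
    voidFactor θ p R s = 1 := by
  unfold voidFactor
  rw [intervalIntegral.integral_symm, intervalIntegral.integral_zero_ae]
  · simp
  refine ae_of_all _ fun x hx => hR x ?_
  rw [uIoc_of_le hs] at hx
  exact hx.1

lemma continuous_voidFactor (hp : Antitone p) : Continuous (voidFactor θ p R) := by
  unfold voidFactor
  refine Real.continuous_exp.comp (continuous_const.mul ?_)
  simp_rw [fun s => intervalIntegral.integral_symm (f := p) (μ := volume) R s]
  exact (intervalIntegral.continuous_primitive (fun _ _ => hp.intervalIntegrable) R).neg

/-- First-arrival decomposition of the void probability. -/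
lemma integral_voidFactor (hθ : 0 < θ) (hp : Antitone p) (h0 : ∀ x, 0 ≤ p x) (h1 : ∀ x, p x ≤ 1)
    (hR : ∀ x, R < x → p x = 0) (s : ℝ) :
    IntegrableOn (fun x => θ * Real.exp (-(θ * x)) * ((1 - p (s + x)) * voidFactor θ p R (s + x)))
      (Ioi 0) ∧
    ∫ x in Ioi (0 : ℝ), θ * Real.exp (-(θ * x)) * ((1 - p (s + x)) * voidFactor θ p R (s + x)) =
      voidFactor θ p R s := by
  have hq := continuous_voidFactor (θ := θ) (R := R) hp
  have hq0 : ∀ x, 0 ≤ voidFactor θ p R x := fun x => (Real.exp_pos _).le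
  have hq1 := voidFactor_le_one hθ.le h0 hR
  have hmeas : Measurable fun x =>
      θ * Real.exp (-(θ * x)) * ((1 - p (s + x)) * voidFactor θ p R (s + x)) := by
    have := hp.measurable
    have := hq.measurable
    fun_prop
  have hint : IntegrableOn (fun x =>
      θ * Real.exp (-(θ * x)) * ((1 - p (s + x)) * voidFactor θ p R (s + x))) (Ioi 0) := by
    refine Integrable.mono' ((exp_neg_integrableOn_Ioi 0 hθ).const_mul θ)
      hmeas.aestronglyMeasurable (ae_of_all _ fun x => ?_)
    have e0 : 0 ≤ (1 - p (s + x)) * voidFactor θ p R (s + x) :=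
      mul_nonneg (sub_nonneg.2 (h1 _)) (hq0 _)
    have e1 : (1 - p (s + x)) * voidFactor θ p R (s + x) ≤ 1 :=
      mul_le_one₀ (by linarith [h0 (s + x)]) (hq0 _) (hq1 _)
    rw [Real.norm_of_nonneg (by positivity), neg_mul]
    exact mul_le_of_le_one_right (by positivity) e1
  refine ⟨hint, ?_⟩
  have hFTC : ∀ L : ℝ, ∫ x in (0 : ℝ)..L, θ * Real.exp (-(θ * x)) *
      ((1 - p (s + x)) * voidFactor θ p R (s + x)) =
      voidFactor θ p R s - Real.exp (-(θ * L)) * voidFactor θ p R (s + L) := by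
    intro L
    -- The antiderivative is `-exp (-θ x) q (s + x)` with `q` the void factor. It is differentiable
    -- where `p` is continuous, and a monotone `p` fails this only at countably many points.
    have hcount : {x | ¬ ContinuousAt p (s + x)}.Countable :=
      hp.countable_not_continuousAt.preimage (add_right_injective s)
    rw [integral_eq_of_hasDerivAt_off_countable
      (fun x => -Real.exp (-(θ * x)) * voidFactor θ p R (s + x)) _ hcount (by fun_prop) ?_ ?_]
    · simp; ring
    · intro x hx
      have hx2 : ContinuousAt p (s + x) := not_not.1 hx.2
      have d1 : HasDerivAt (fun y => voidFactor θ p R y)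
          (voidFactor θ p R (s + x) * (-θ * -p (s + x))) (s + x) :=
        ((intervalIntegral.integral_hasDerivAt_left hp.intervalIntegrable
          (hp.measurable.stronglyMeasurable.stronglyMeasurableAtFilter) hx2).const_mul (-θ)).exp
      have d2 := d1.comp_const_add s x
      convert! (hasDerivAt_neg_exp_mul_exp (r := θ) (x := x)).mul d2 using 1
      ring
    · refine (intervalIntegrable_iff).2 (Integrable.mono' (g := fun x => θ * Real.exp (-(θ * x)))
        ?_ hmeas.aestronglyMeasurable (ae_of_all _ fun x => ?_))
      · exact (intervalIntegrable_iff.1 (Continuous.intervalIntegrable (by fun_prop) _ _))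
      have e0 : 0 ≤ (1 - p (s + x)) * voidFactor θ p R (s + x) :=
        mul_nonneg (sub_nonneg.2 (h1 _)) (hq0 _)
      have e1 : (1 - p (s + x)) * voidFactor θ p R (s + x) ≤ 1 :=
        mul_le_one₀ (by linarith [h0 (s + x)]) (hq0 _) (hq1 _)
      rw [Real.norm_of_nonneg (by positivity)]
      exact mul_le_of_le_one_right (by positivity) e1
  have hlim := intervalIntegral_tendsto_integral_Ioi 0 hint tendsto_id
  refine tendsto_nhds_unique hlim ?_
  simp only [id, hFTC]
  have hexp : Tendsto (fun L : ℝ => Real.exp (-(θ * L))) atTop (𝓝 0) :=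
    Real.tendsto_exp_neg_atTop_nhds_zero.comp (tendsto_id.const_mul_atTop hθ)
  have : Tendsto (fun L : ℝ => Real.exp (-(θ * L)) * voidFactor θ p R (s + L)) atTop (𝓝 0) :=
    tendsto_of_tendsto_of_tendsto_of_le_of_le tendsto_const_nhds hexp
      (fun L => mul_nonneg (Real.exp_pos _).le (hq0 _))
      (fun L => mul_le_of_le_one_right (Real.exp_pos _).le (hq1 _))
  simpa using this.const_sub (voidFactor θ p R s)

lemma lintegral_expMeasure_voidFactor (hθ : 0 < θ) (hp : Antitone p) (h0 : ∀ x, 0 ≤ p x)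
    (h1 : ∀ x, p x ≤ 1) (hR : ∀ x, R < x → p x = 0) (s : ℝ) :
    ∫⁻ x, ENNReal.ofReal (1 - p (s + x)) * ENNReal.ofReal (voidFactor θ p R (s + x))
      ∂(expMeasure θ) = ENNReal.ofReal (voidFactor θ p R s) := by
  have hq := continuous_voidFactor (θ := θ) (R := R) hp
  obtain ⟨hint, heq⟩ := integral_voidFactor hθ hp h0 h1 hR s
  have hm : Measurable fun x =>
      ENNReal.ofReal (1 - p (s + x)) * ENNReal.ofReal (voidFactor θ p R (s + x)) := by
    have := hp.measurable
    have := hq.measurable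
    fun_prop
  change ∫⁻ x, _ ∂(volume.withDensity (exponentialPDF θ)) = _
  rw [lintegral_withDensity_eq_lintegral_mul _
    (show Measurable (exponentialPDF θ) from (measurable_exponentialPDFReal θ).ennreal_ofReal) hm,
    ← heq,
    ofReal_integral_eq_lintegral_ofReal hint (ae_of_all _ fun x => ?_),
    ← lintegral_indicator measurableSet_Ioi]
  · refine lintegral_congr_ae ?_
    filter_upwards [Measure.ae_ne volume (0 : ℝ)] with x hx
    rcases lt_or_gt_of_ne hx with h | h
    · rw [indicator_of_notMem (by simpa using h.le)]
      simp [exponentialPDF_of_neg h]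
    · rw [indicator_of_mem (mem_Ioi.2 h), Pi.mul_apply, exponentialPDF_of_nonneg h.le,
        ← ENNReal.ofReal_mul (sub_nonneg.2 (h1 _)), ← ENNReal.ofReal_mul (by positivity)]
  · have := sub_nonneg.2 (h1 (s + x))
    have : 0 ≤ voidFactor θ p R (s + x) := (Real.exp_pos _).le
    positivity

end VoidFactor

/-! ### Independence of pairs and averaging over a fresh variable -/

section Independence

variable {Ω ι : Type*} [MeasurableSpace Ω] {P : Measure Ω}

/-- If two independent families consist of independent random variables, then the family of pairs
is independent. -/
lemma iIndepFun_prodMk_of_indepFun {T U : ι → Ω → ℝ} (hTm : ∀ p, Measurable (T p))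
    (hUm : ∀ p, Measurable (U p)) (hT : iIndepFun T P) (hU : iIndepFun U P)
    (hTU : IndepFun (fun ω p => T p ω) (fun ω p => U p ω) P) :
    iIndepFun (fun p ω => (T p ω, U p ω)) P := by
  rw [iIndepFun_iff_iIndep]
  let π : Set (Set (ℝ × ℝ)) := image2 (· ×ˢ ·) {s | MeasurableSet s} {t | MeasurableSet t}
  refine iIndepSets.iIndep (fun p => ((hTm p).prodMk (hUm p)).comap_le)
    (fun p => preimage (fun ω => (T p ω, U p ω)) '' π) (fun p => ?_) (fun p => ?_) ?_
  · exact IsPiSystem.comap isPiSystem_prod (fun ω => (T p ω, U p ω))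
  · rw [← generateFrom_prod, MeasurableSpace.comap_generateFrom]
  · rw [iIndepSets_iff]
    intro s f hf
    -- It suffices to test rectangles. Indices outside `s` receive empty sets as placeholders, which
    -- are never used.
    have hf' : ∀ p, ∃ A B : Set ℝ, MeasurableSet A ∧ MeasurableSet B ∧
        (p ∈ s → f p = T p ⁻¹' A ∩ U p ⁻¹' B) := by
      intro p
      by_cases hp : p ∈ s
      · obtain ⟨_, ⟨A, hA, B, hB, rfl⟩, h⟩ := hf p hp
        exact ⟨A, B, hA, hB, fun _ => h.symm⟩
      · exact ⟨∅, ∅, .empty, .empty, fun h => absurd h hp⟩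
    choose A B hA hB hAB using hf'
    have e : ⋂ p ∈ s, f p = (fun ω p => T p ω) ⁻¹' {x | ∀ p ∈ s, x p ∈ A p} ∩
        (fun ω p => U p ω) ⁻¹' {x | ∀ p ∈ s, x p ∈ B p} := by
      ext ω
      simp only [mem_iInter, mem_inter_iff, mem_preimage, mem_ofPred_eq, ← forall₂_and]
      refine forall₂_congr fun p hp => ?_
      rw [hAB p hp]
      rfl
    have hms : ∀ C : ι → Set ℝ, (∀ p, MeasurableSet (C p)) →
        MeasurableSet {x : ι → ℝ | ∀ p ∈ s, x p ∈ C p} := fun C hC => by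
      have : {x : ι → ℝ | ∀ p ∈ s, x p ∈ C p} = ⋂ p ∈ s, (fun x => x p) ⁻¹' C p := by
        ext; simp
      rw [this]
      exact s.measurableSet_biInter fun p _ => measurable_pi_apply p (hC p)
    have e1 : ∀ (V : ι → Ω → ℝ) (C : ι → Set ℝ),
        (fun ω p => V p ω) ⁻¹' {x | ∀ p ∈ s, x p ∈ C p} = ⋂ p ∈ s, V p ⁻¹' C p := by
      intro V C; ext; simp
    rw [e, hTU.measure_inter_preimage_eq_mul _ _ (hms A hA) (hms B hB), e1, e1,
      hT.measure_inter_preimage_eq_mul s (fun p _ => hA p),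
      hU.measure_inter_preimage_eq_mul s (fun p _ => hB p), ← Finset.prod_mul_distrib]
    refine Finset.prod_congr rfl fun p hp => ?_
    rw [hAB p hp]
    exact ((hTU.comp (measurable_pi_apply p)
      (measurable_pi_apply p)).measure_inter_preimage_eq_mul _ _ (hA p) (hB p)).symm

/-- Averaging out a random variable that is independent of the past. -/
lemma lintegral_comp_of_iIndepFun [IsProbabilityMeasure P] {V : ι → Ω → ℝ × ℝ}
    (hVm : ∀ p, Measurable (V p)) (hV : iIndepFun V P) {S : Set ι} {p : ι} (hp : p ∉ S)
    {A : Ω → ℝ≥0∞} {B : Ω → ℝ}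
    (hA : Measurable[⨆ q ∈ S, MeasurableSpace.comap (V q) inferInstance] A)
    (hB : Measurable[⨆ q ∈ S, MeasurableSpace.comap (V q) inferInstance] B)
    {H : ℝ → ℝ × ℝ → ℝ≥0∞} (hH : Measurable (Function.uncurry H)) {h : ℝ → ℝ≥0∞}
    (hHh : ∀ b, ∫⁻ v, H b v ∂(P.map (V p)) = h b) :
    ∫⁻ ω, A ω * H (B ω) (V p ω) ∂P = ∫⁻ ω, A ω * h (B ω) ∂P := by
  have hle : ∀ q, MeasurableSpace.comap (V q) inferInstance ≤ ‹MeasurableSpace Ω› :=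
    fun q => (hVm q).comap_le
  have hle' : (⨆ q ∈ S, MeasurableSpace.comap (V q) inferInstance) ≤ ‹MeasurableSpace Ω› :=
    iSup₂_le fun q _ => hle q
  have hind := indep_iSup_of_disjoint hle ((iIndepFun_iff_iIndep _ _ _).1 hV)
    (Set.disjoint_singleton_right.2 hp)
  simp only [mem_singleton_iff, iSup_iSup_eq_left] at hind
  have hAB : Measurable[⨆ q ∈ S, MeasurableSpace.comap (V q) inferInstance]
      fun ω => (A ω, B ω) := hA.prodMk hB
  have hi : IndepFun (fun ω => (A ω, B ω)) (V p) P := by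
    rw [IndepFun_iff_Indep]
    exact indep_of_indep_of_le_left hind hAB.comap_le
  have hABm : Measurable fun ω => (A ω, B ω) := hAB.mono hle' le_rfl
  have hm := (indepFun_iff_map_prod_eq_prod_map_map hABm.aemeasurable (hVm p).aemeasurable).1 hi
  have : IsProbabilityMeasure (P.map (V p)) := Measure.isProbabilityMeasure_map (hVm p).aemeasurable
  have hK : Measurable fun z : (ℝ≥0∞ × ℝ) × (ℝ × ℝ) => z.1.1 * H z.1.2 z.2 :=
    measurable_fst.fst.mul (hH.comp (measurable_fst.snd.prodMk measurable_snd))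
  have hh : Measurable h := by
    have := hH.lintegral_prod_right' (ν := P.map (V p))
    simpa [hHh] using this
  calc ∫⁻ ω, A ω * H (B ω) (V p ω) ∂P
      = ∫⁻ z, z.1.1 * H z.1.2 z.2 ∂(P.map fun ω => ((A ω, B ω), V p ω)) :=
        (lintegral_map hK (hABm.prodMk (hVm p))).symm
    _ = ∫⁻ x, ∫⁻ v, x.1 * H x.2 v ∂(P.map (V p)) ∂(P.map fun ω => (A ω, B ω)) := by
        rw [hm, lintegral_prod _ hK.aemeasurable]
    _ = ∫⁻ x, x.1 * h x.2 ∂(P.map fun ω => (A ω, B ω)) := by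
        refine lintegral_congr fun x => ?_
        have : Measurable (H x.2) := hH.comp (measurable_const.prodMk measurable_id)
        rw [lintegral_const_mul _ this, hHh]
    _ = ∫⁻ ω, A ω * h (B ω) ∂P :=
        lintegral_map (measurable_fst.mul (hh.comp measurable_snd)) hABm

end Independence

/-! ### Lengths of the strips `(i, i + 1]` below a level -/

section Void

/-- The length of the part of `(i, i + 1]` below the level `x`. -/
noncomputable def stripLength (i : ℕ) (x : ℝ) : ℝ := max 0 (min 1 (x - i))

lemma stripLength_nonneg (i : ℕ) (x : ℝ) : 0 ≤ stripLength i x := le_max_left _ _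

lemma stripLength_le_one (i : ℕ) (x : ℝ) : stripLength i x ≤ 1 :=
  max_le zero_le_one (min_le_left _ _)

lemma monotone_stripLength (i : ℕ) : Monotone (stripLength i) := fun x y h =>
  max_le_max le_rfl (min_le_min le_rfl (by linarith))

lemma stripLength_zero (i : ℕ) : stripLength i 0 = 0 := by
  unfold stripLength
  have : (0 : ℝ) ≤ i := Nat.cast_nonneg i
  rw [max_eq_left]
  exact (min_le_right _ _).trans (by linarith)

lemma sum_stripLength {x : ℝ} (hx : 0 ≤ x) (n : ℕ) :
    ∑ i ∈ Finset.range n, stripLength i x = min x n := by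
  induction n with
  | zero => simp [hx]
  | succ n ih =>
    rw [Finset.sum_range_succ, ih, stripLength]
    push_cast
    rcases le_total x n with h | h
    · rw [min_eq_left h, min_eq_left (h.trans (by linarith)), max_eq_left, add_zero]
      exact (min_le_right _ _).trans (by linarith)
    · rw [min_eq_right h, max_eq_right (le_min zero_le_one (by linarith)),
        ← min_add_add_left, min_comm]
      congr 1; ring

lemma measure_restrict_Ioc_Ici (i : ℕ) (x : ℝ) :
    (volume.restrict (Ioc (i : ℝ) (i + 1))) (Ici x) =
      ENNReal.ofReal (1 - stripLength i x) := by
  rw [Measure.restrict_apply measurableSet_Ici]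
  unfold stripLength
  rcases le_or_gt x i with h | h
  · have : Ici x ∩ Ioc (i : ℝ) (i + 1) = Ioc (i : ℝ) (i + 1) := by
      refine inter_eq_right.2 fun u hu => ?_
      exact h.trans hu.1.le
    rw [this, Real.volume_Ioc, max_eq_left ((min_le_right _ _).trans (by linarith))]
    congr 1; ring
  · have : Ici x ∩ Ioc (i : ℝ) (i + 1) = Icc x (i + 1) := by
      ext u
      simp only [mem_inter_iff, mem_Ici, mem_Ioc, mem_Icc]
      exact ⟨fun h' => ⟨h'.1, h'.2.2⟩, fun h' => ⟨h'.1, h.trans_le h'.1, h'.2⟩⟩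
    rw [this, Real.volume_Icc, max_eq_right (le_min zero_le_one (by linarith))]
    rcases le_total x (i + 1) with h2 | h2
    · rw [min_eq_right (by linarith)]
      congr 1; ring
    · rw [min_eq_left (by linarith), ENNReal.ofReal_of_nonpos (by linarith)]
      simp

end Void

/-! ### The void probability of the marked arrivals -/

section VoidProbability

/-- The `m`-th arrival time in the `i`-th strip. -/
noncomputable def arrival {Ω : Type*} (T : ℕ × ℕ → Ω → ℝ) (i m : ℕ) (ω : Ω) : ℝ :=
  ∑ l ∈ Finset.range m, T (i, l) ω

lemma arrival_succ {Ω : Type*} (T : ℕ × ℕ → Ω → ℝ) (i m : ℕ) (ω : Ω) :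
    arrival T i (m + 1) ω = arrival T i m ω + T (i, m) ω := Finset.sum_range_succ _ _

lemma measurable_arrival {Ω : Type*} [MeasurableSpace Ω] {T : ℕ × ℕ → Ω → ℝ} {i m : ℕ}
    (hT : ∀ j < m, Measurable (T (i, j))) : Measurable (arrival T i m) :=
  Finset.measurable_fun_sum _ fun j hj => hT j (Finset.mem_range.1 hj)

open Classical in
/-- The indicator that none of the first `m` marks of the `i`-th strip lies below the level
function. -/
noncomputable def marksAbove {Ω : Type*} (T U : ℕ × ℕ → Ω → ℝ) (f : ℝ → ℝ) (i m : ℕ)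
    (ω : Ω) : ℝ≥0∞ :=
  ∏ j ∈ Finset.range m, if f (arrival T i (j + 1) ω) ≤ U (i, j) ω then 1 else 0

/-- The conditional probability, given the first `m` points of the `i`-th strip, that no mark of
this strip lies below the level function. -/
noncomputable def stripVoid {Ω : Type*} (T U : ℕ × ℕ → Ω → ℝ) (θ R : ℝ) (f : ℝ → ℝ) (i m : ℕ)
    (ω : Ω) : ℝ≥0∞ :=
  marksAbove T U f i m ω *
    ENNReal.ofReal (voidFactor θ (fun x => stripLength i (f x)) R (arrival T i m ω))

lemma measurable_marksAbove {Ω : Type*} [MeasurableSpace Ω] {T U : ℕ × ℕ → Ω → ℝ} {f : ℝ → ℝ}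
    {i m : ℕ} (hf : Measurable f) (hT : ∀ j < m, Measurable (T (i, j)))
    (hU : ∀ j < m, Measurable (U (i, j))) : Measurable (marksAbove T U f i m) := by
  classical
  refine Finset.measurable_fun_prod _ fun j hj => ?_
  rw [Finset.mem_range] at hj
  refine Measurable.ite (measurableSet_le (hf.comp (measurable_arrival fun l hl => hT l (by omega)))
    (hU j hj)) measurable_const measurable_const

lemma antitone_stripLength_comp {f : ℝ → ℝ} (hf : Antitone f) (i : ℕ) :
    Antitone fun x => stripLength i (f x) := (monotone_stripLength i).comp_antitone hf

lemma measurable_stripVoid {Ω : Type*} [MeasurableSpace Ω] {T U : ℕ × ℕ → Ω → ℝ} {f : ℝ → ℝ}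
    {θ R : ℝ} {i m : ℕ} (hf : Antitone f) (hT : ∀ j < m, Measurable (T (i, j)))
    (hU : ∀ j < m, Measurable (U (i, j))) : Measurable (stripVoid T U θ R f i m) :=
  (measurable_marksAbove hf.measurable hT hU).mul
    ((continuous_voidFactor (antitone_stripLength_comp hf i)).measurable.comp
      (measurable_arrival hT)).ennreal_ofReal

/-- The indices of the points explored before the `m`-th point of the `i`-th strip. -/
def explored (i m : ℕ) : Set (ℕ × ℕ) := {q | q.1 < i ∨ (q.1 = i ∧ q.2 < m)}

lemma measurable_iSup_comap_pair {Ω : Type*} {T U : ℕ × ℕ → Ω → ℝ} {S : Set (ℕ × ℕ)} {q : ℕ × ℕ} (hq : q ∈ S) :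
    Measurable[⨆ q ∈ S, MeasurableSpace.comap (fun ω => (T q ω, U q ω)) inferInstance] (T q) ∧
    Measurable[⨆ q ∈ S, MeasurableSpace.comap (fun ω => (T q ω, U q ω)) inferInstance] (U q) := by
  have h : Measurable[⨆ q ∈ S, MeasurableSpace.comap (fun ω => (T q ω, U q ω)) inferInstance]
      fun ω => (T q ω, U q ω) :=
    Measurable.of_comap_le (le_iSup₂ (f := fun q (_ : q ∈ S) =>
      MeasurableSpace.comap (fun ω => (T q ω, U q ω)) inferInstance) q hq)
  exact ⟨measurable_fst.comp h, measurable_snd.comp h⟩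

variable {Ω : Type*} [MeasurableSpace Ω] {P : Measure Ω} {T U : ℕ × ℕ → Ω → ℝ} {θ R : ℝ}
  {f : ℝ → ℝ}

/-- Adding one more point of the strip does not change the average. -/
lemma lintegral_stripVoid_succ [IsProbabilityMeasure P] (hθ : 0 < θ)
    (hTm : ∀ p, Measurable (T p)) (hUm : ∀ p, Measurable (U p))
    (hTlaw : ∀ p, HasLaw (T p) (expMeasure θ) P)
    (hUlaw : ∀ p, HasLaw (U p) (volume.restrict (Ioc (p.1 : ℝ) (p.1 + 1))) P)
    (hV : iIndepFun (fun p ω => (T p ω, U p ω)) P) (hTU : ∀ p, IndepFun (T p) (U p) P)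
    (hf : Antitone f) (hfR : ∀ x, R < x → f x = 0) (i m : ℕ) {A : Ω → ℝ≥0∞}
    (hA : Measurable[⨆ q ∈ explored i 0,
      MeasurableSpace.comap (fun ω => (T q ω, U q ω)) inferInstance] A) :
    ∫⁻ ω, A ω * stripVoid T U θ R f i (m + 1) ω ∂P = ∫⁻ ω, A ω * stripVoid T U θ R f i m ω ∂P := by
  classical
  -- `b` is the last arrival revealed and `v` the next pair (waiting time, mark). Averaging first
  -- over the mark gives the factor `1 - stripLength`, and then over the waiting time gives the
  -- first-arrival identity.
  let H : ℝ → ℝ × ℝ → ℝ≥0∞ := fun b v => (if f (b + v.1) ≤ v.2 then 1 else 0) *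
    ENNReal.ofReal (voidFactor θ (fun x => stripLength i (f x)) R (b + v.1))
  have hanti := antitone_stripLength_comp hf i
  have hH : Measurable (Function.uncurry H) := by
    have h1 := hf.measurable
    have h2 := (continuous_voidFactor (θ := θ) (R := R) hanti).measurable
    refine Measurable.mul (Measurable.ite (measurableSet_le ?_ ?_) measurable_const
      measurable_const) ?_ <;> fun_prop
  have hHh : ∀ b, ∫⁻ v, H b v ∂(P.map fun ω => (T (i, m) ω, U (i, m) ω)) =
      ENNReal.ofReal (voidFactor θ (fun x => stripLength i (f x)) R b) := by
    intro b
    have hHb : Measurable (H b) := hH.comp (measurable_const.prodMk measurable_id)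
    have := isProbabilityMeasure_expMeasure hθ
    rw [(indepFun_iff_map_prod_eq_prod_map_map (hTm _).aemeasurable (hUm _).aemeasurable).1
      (hTU (i, m)), (hTlaw _).map_eq, (hUlaw _).map_eq, lintegral_prod _ hHb.aemeasurable,
      ← lintegral_expMeasure_voidFactor hθ hanti (fun x => stripLength_nonneg i _)
        (fun x => stripLength_le_one i _)
        (fun x hx => by rw [hfR x hx, stripLength_zero]) b]
    refine lintegral_congr fun x => ?_
    have e : ∀ u : ℝ, H b (x, u) = (Ici (f (b + x))).indicator (fun _ =>
        ENNReal.ofReal (voidFactor θ (fun x => stripLength i (f x)) R (b + x))) u := by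
      intro u
      by_cases h : f (b + x) ≤ u <;> simp [H, h]
    simp_rw [e]
    rw [lintegral_indicator_const measurableSet_Ici, measure_restrict_Ioc_Ici, mul_comm]
  have hle : ∀ S : Set (ℕ × ℕ), S ⊆ explored i m →
      (⨆ q ∈ S, MeasurableSpace.comap (fun ω => (T q ω, U q ω)) inferInstance) ≤
      ⨆ q ∈ explored i m, MeasurableSpace.comap (fun ω => (T q ω, U q ω)) inferInstance :=
    fun S hS => biSup_mono hS
  have hmem : ∀ j < m, (i, j) ∈ explored i m := fun j hj => .inr ⟨rfl, hj⟩
  have key := lintegral_comp_of_iIndepFun (P := P)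
    (V := fun p ω => (T p ω, U p ω)) (fun p => (hTm p).prodMk (hUm p)) hV
    (S := explored i m) (p := (i, m)) (by simp [explored])
    (A := fun ω => A ω * marksAbove T U f i m ω) (B := arrival T i m)
    (Measurable.mul (hA.mono (hle _ fun q hq => .inl (by simpa [explored] using hq)) le_rfl)
      (@measurable_marksAbove _ (_) _ _ _ _ _ hf.measurable
        (fun j hj => (measurable_iSup_comap_pair (hmem j hj)).1)
        (fun j hj => (measurable_iSup_comap_pair (hmem j hj)).2)))
    (@measurable_arrival _ (_) _ _ _
      (fun j hj => (measurable_iSup_comap_pair (U := U) (hmem j hj)).1)) hH hHh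
  calc ∫⁻ ω, A ω * stripVoid T U θ R f i (m + 1) ω ∂P
      = ∫⁻ ω, A ω * marksAbove T U f i m ω * H (arrival T i m ω) (T (i, m) ω, U (i, m) ω) ∂P := by
        refine lintegral_congr fun ω => ?_
        simp only [H, stripVoid, marksAbove, Finset.prod_range_succ, arrival_succ, mul_assoc]
    _ = _ := by
        rw [key]
        refine lintegral_congr fun ω => ?_
        rw [stripVoid, mul_assoc]

/-- With no point of the strip revealed, `stripVoid` is a constant. The average does not change as
points are revealed, so the strip factors out of anything that depends on earlier strips only. -/
lemma lintegral_stripVoid [IsProbabilityMeasure P] (hθ : 0 < θ)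
    (hTm : ∀ p, Measurable (T p)) (hUm : ∀ p, Measurable (U p))
    (hTlaw : ∀ p, HasLaw (T p) (expMeasure θ) P)
    (hUlaw : ∀ p, HasLaw (U p) (volume.restrict (Ioc (p.1 : ℝ) (p.1 + 1))) P)
    (hV : iIndepFun (fun p ω => (T p ω, U p ω)) P) (hTU : ∀ p, IndepFun (T p) (U p) P)
    (hf : Antitone f) (hfR : ∀ x, R < x → f x = 0) (i m : ℕ) {A : Ω → ℝ≥0∞}
    (hA : Measurable[⨆ q ∈ explored i 0,
      MeasurableSpace.comap (fun ω => (T q ω, U q ω)) inferInstance] A) :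
    ∫⁻ ω, A ω * stripVoid T U θ R f i m ω ∂P = (∫⁻ ω, A ω ∂P) *
      ENNReal.ofReal (voidFactor θ (fun x => stripLength i (f x)) R 0) := by
  induction m with
  | zero =>
    rw [← lintegral_mul_const']
    · simp [stripVoid, marksAbove, arrival]
    · exact ENNReal.ofReal_ne_top
  | succ m ih =>
    rw [lintegral_stripVoid_succ hθ hTm hUm hTlaw hUlaw hV hTU hf hfR i m hA, ih]

lemma lintegral_prod_stripVoid [IsProbabilityMeasure P] (hθ : 0 < θ)
    (hTm : ∀ p, Measurable (T p)) (hUm : ∀ p, Measurable (U p))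
    (hTlaw : ∀ p, HasLaw (T p) (expMeasure θ) P)
    (hUlaw : ∀ p, HasLaw (U p) (volume.restrict (Ioc (p.1 : ℝ) (p.1 + 1))) P)
    (hV : iIndepFun (fun p ω => (T p ω, U p ω)) P) (hTU : ∀ p, IndepFun (T p) (U p) P)
    (hf : Antitone f) (hfR : ∀ x, R < x → f x = 0) (n m : ℕ) :
    ∫⁻ ω, ∏ i ∈ Finset.range n, stripVoid T U θ R f i m ω ∂P =
      ∏ i ∈ Finset.range n, ENNReal.ofReal (voidFactor θ (fun x => stripLength i (f x)) R 0) := by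
  induction n with
  | zero => simp
  | succ n ih =>
    simp_rw [Finset.prod_range_succ]
    rw [lintegral_stripVoid hθ hTm hUm hTlaw hUlaw hV hTU hf hfR n m, ih]
    refine Finset.measurable_fun_prod _ fun i hi => ?_
    have hi' : ∀ j, (i, j) ∈ explored n 0 := fun j => .inl (Finset.mem_range.1 hi)
    exact @measurable_stripVoid _ (_) _ _ _ _ _ _ _ hf
        (fun j _ => (measurable_iSup_comap_pair (hi' j)).1)
        (fun j _ => (measurable_iSup_comap_pair (hi' j)).2)

/-- The void probabilities of the Poisson process with rate `θ` whose points are the arrival times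
with their marks. -/
theorem measure_forall_le_mark [IsProbabilityMeasure P] (hθ : 0 < θ)
    (hTm : ∀ p, Measurable (T p)) (hUm : ∀ p, Measurable (U p))
    (hTlaw : ∀ p, HasLaw (T p) (expMeasure θ) P) (hTi : iIndepFun T P)
    (hUlaw : ∀ p, HasLaw (U p) (volume.restrict (Ioc (p.1 : ℝ) (p.1 + 1))) P)
    (hUi : iIndepFun U P) (hTU : IndepFun (fun ω p => T p ω) (fun ω p => U p ω) P)
    (hT0 : ∀ᵐ ω ∂P, ∀ p, 0 ≤ T p ω) (hU0 : ∀ᵐ ω ∂P, ∀ p : ℕ × ℕ, (p.1 : ℝ) ≤ U p ω)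
    (hdiv : ∀ᵐ ω ∂P, ∀ i (r : ℝ), ∃ m, r < arrival T i m ω)
    (hf : Antitone f) (hf0 : ∀ x, 0 ≤ f x) (hfR : ∀ x, R < x → f x = 0) (n : ℕ)
    (hn : ∀ x, f x ≤ n) :
    P {ω | ∀ i j, f (arrival T i (j + 1) ω) ≤ U (i, j) ω} =
      ENNReal.ofReal (Real.exp (-θ * ∫ x in (0 : ℝ)..R, f x)) := by
  classical
  have hV := iIndepFun_prodMk_of_indepFun hTm hUm hTi hUi hTU
  have hTUp : ∀ p, IndepFun (T p) (U p) P := fun p =>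
    hTU.comp (measurable_pi_apply p) (measurable_pi_apply p)
  -- The strips below the bound `n` exhaust the region under `f`, so the exponents add up to `∫ f`.
  have hval : ∏ i ∈ Finset.range n,
      ENNReal.ofReal (voidFactor θ (fun x => stripLength i (f x)) R 0) =
      ENNReal.ofReal (Real.exp (-θ * ∫ x in (0 : ℝ)..R, f x)) := by
    unfold voidFactor
    rw [← ENNReal.ofReal_prod_of_nonneg fun i _ => (Real.exp_pos _).le]
    rw [← Real.exp_sum, ← Finset.mul_sum, ← intervalIntegral.integral_finsetSum]
    · congr 4
      funext x
      rw [sum_stripLength (hf0 x), min_eq_left (hn x)]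
    · exact fun i _ => (antitone_stripLength_comp hf i).intervalIntegrable
  set E := {ω | ∀ i j, f (arrival T i (j + 1) ω) ≤ U (i, j) ω} with hE
  have hEm : MeasurableSet E := by
    have : E = ⋂ i, ⋂ j, {ω | f (arrival T i (j + 1) ω) ≤ U (i, j) ω} := by
      ext; simp [hE]
    rw [this]
    exact .iInter fun i => .iInter fun j => measurableSet_le
      (hf.measurable.comp (measurable_arrival fun _ _ => hTm _)) (hUm _)
  -- Once the arrivals of the finitely many relevant strips have passed `R`, nothing is left to
  -- avoid. The products become the indicator of the event, while their expectation is the same for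
  -- every `m`.
  have hlim : ∀ᵐ ω ∂P, Tendsto (fun m => ∏ i ∈ Finset.range n, stripVoid T U θ R f i m ω) atTop
      (𝓝 (E.indicator 1 ω)) := by
    filter_upwards [hT0, hU0, hdiv] with ω h1 h2 h3
    have hmono : ∀ i, Monotone fun m => arrival T i m ω := fun i =>
      monotone_nat_of_le_succ fun m => by rw [arrival_succ]; linarith [h1 (i, m)]
    have hbig : ∀ᶠ m in atTop, ∀ i ∈ Finset.range n, R < arrival T i m ω := by
      rw [Filter.eventually_all_finset]
      intro i _
      obtain ⟨m₀, hm₀⟩ := h3 i R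
      filter_upwards [eventually_ge_atTop m₀] with m hm
      exact hm₀.trans_le (hmono i hm)
    have hval1 : ∀ m, (∀ i ∈ Finset.range n, R < arrival T i m ω) →
        ∏ i ∈ Finset.range n, stripVoid T U θ R f i m ω =
        ∏ i ∈ Finset.range n, marksAbove T U f i m ω := by
      intro m hm
      refine Finset.prod_congr rfl fun i hi => ?_
      rw [stripVoid, voidFactor_of_le
        (fun x hx => by rw [hfR x hx, stripLength_zero]) (hm i hi).le]
      simp
    by_cases hω : ω ∈ E
    · rw [indicator_of_mem hω]
      refine tendsto_const_nhds.congr' ?_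
      filter_upwards [hbig] with m hm
      rw [hval1 m hm, Pi.one_apply]
      refine (Finset.prod_eq_one fun i _ => Finset.prod_eq_one fun j _ => ?_).symm
      rw [if_pos (hω i j)]
    · rw [indicator_of_notMem hω]
      refine tendsto_const_nhds.congr' ?_
      simp only [hE, mem_ofPred_eq, not_forall, not_le] at hω
      obtain ⟨i, j, hij⟩ := hω
      -- A mark below `f ≤ n` lies in one of the first `n` strips, so the omitted strips cannot
      -- violate the event.
      have hin : i < n := by
        have := (h2 (i, j)).trans_lt (hij.trans_le (hn _))
        exact_mod_cast this
      filter_upwards [hbig, eventually_gt_atTop j] with m hm hjm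
      rw [hval1 m hm]
      refine (Finset.prod_eq_zero (Finset.mem_range.2 hin)
        (Finset.prod_eq_zero (Finset.mem_range.2 hjm) ?_)).symm
      rw [if_neg (not_le.2 hij)]
  have hle : ∀ m ω, ∏ i ∈ Finset.range n, stripVoid T U θ R f i m ω ≤ 1 := by
    intro m ω
    refine Finset.prod_le_one' fun i _ => mul_le_one' (Finset.prod_le_one' fun j _ => ?_) ?_
    · split_ifs <;> simp
    · rw [ENNReal.ofReal_le_one]
      exact voidFactor_le_one hθ.le (fun x => stripLength_nonneg i _)
        (fun x hx => by rw [hfR x hx, stripLength_zero]) _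
  have hconv := tendsto_lintegral_of_dominated_convergence (fun _ => 1)
    (fun m => Finset.measurable_fun_prod _ fun i _ =>
      measurable_stripVoid hf (fun j _ => hTm (i, j)) (fun j _ => hUm (i, j)))
    (fun m => ae_of_all P (hle m)) (by simp) hlim
  simp_rw [lintegral_prod_stripVoid hθ hTm hUm hTlaw hUlaw hV hTUp hf hfR n, hval] at hconv
  rw [lintegral_indicator_one hEm] at hconv
  exact (tendsto_nhds_unique hconv tendsto_const_nhds)

end VoidProbability

/-! ### The level function of a finite-dimensional event -/

section Staircase

/-- The largest level `y i` among the indices `i ∈ [1, k]` with `s ≤ t i`. -/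
noncomputable def staircase (k : ℕ) (t : ℕ → ℝ) (y : ℕ → ℝ≥0) (s : ℝ) : ℝ :=
  (((Finset.Icc 1 k).filter fun i => s ≤ t i).sup y : ℝ≥0)

variable {k : ℕ} {t : ℕ → ℝ} {y : ℕ → ℝ≥0}

lemma antitone_staircase : Antitone (staircase k t y) := fun s s' h => by
  refine NNReal.coe_le_coe.2 (Finset.sup_mono fun i hi => ?_)
  rw [Finset.mem_filter] at hi ⊢
  exact ⟨hi.1, h.trans hi.2⟩

lemma staircase_nonneg (s : ℝ) : 0 ≤ staircase k t y s := NNReal.coe_nonneg _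

/-- Read with `s` an arrival time and `u` its mark, this says that the point violates none of the
constraints. The sign condition is needed because the supremum over no indices is `0`. -/
lemma staircase_le_iff {s u : ℝ} (hu : 0 ≤ u) :
    staircase k t y s ≤ u ↔ ∀ i ∈ Icc 1 k, s ≤ t i → (y i : ℝ) ≤ u := by
  unfold staircase
  rw [← Real.le_toNNReal_iff_coe_le hu, Finset.sup_le_iff]
  simp only [Finset.mem_filter, Finset.mem_Icc, Real.le_toNNReal_iff_coe_le hu, mem_Icc, and_imp]

lemma exists_nat_staircase_le : ∃ n : ℕ, ∀ s, staircase k t y s ≤ n := by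
  obtain ⟨n, hn⟩ := exists_nat_ge ((Finset.Icc 1 k).sup y)
  refine ⟨n, fun s => (staircase_le_iff (Nat.cast_nonneg n)).2 fun i hi _ => ?_⟩
  have := (Finset.le_sup (f := y) (Finset.mem_Icc.2 hi)).trans hn
  exact_mod_cast this

/-- On `(t_{i-1}, t_i]` exactly the constraints with index at least `i` are active, so the staircase
equals the maximum of the later levels there. -/
lemma integral_staircase (ht : StrictMonoOn t (Icc 1 k)) (ht0 : ∀ i ∈ Icc 1 k, 0 ≤ t i) :
    ∫ s in (0 : ℝ)..(if k = 0 then 0 else t k), staircase k t y s =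
      ∑ i ∈ Finset.Icc 1 k, (t i - if i = 1 then 0 else t (i - 1)) *
        ((Finset.Icc i k).sup y : ℝ≥0) := by
  -- The times with `t_0 = 0` put in front; the value of `t` at index `0` is irrelevant.
  set a : ℕ → ℝ := fun i => if i = 0 then 0 else t i with ha
  have h0 : (0 : ℝ) = a 0 := by simp [ha]
  have hIcc : Finset.Icc 1 k = Finset.Ico (0 + 1) (k + 1) := by
    ext i; simp only [Finset.mem_Icc, Finset.mem_Ico]; omega
  change ∫ s in (0 : ℝ)..a k, _ = _
  rw [h0, ← intervalIntegral.sum_integral_adjacent_intervals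
    (fun i _ => antitone_staircase.intervalIntegrable), hIcc, ← Finset.sum_Ico_add',
    Finset.range_eq_Ico]
  refine Finset.sum_congr rfl fun i hi => ?_
  rw [Finset.mem_Ico] at hi
  have hprev : a i ≤ a (i + 1) := by
    rcases Nat.eq_zero_or_pos i with rfl | hi0
    · simpa [ha] using ht0 1 ⟨le_rfl, by omega⟩
    · simp only [ha]
      rw [if_neg (by omega), if_neg (by omega)]
      exact (ht ⟨by omega, by omega⟩ ⟨by omega, by omega⟩ (Nat.lt_succ_self i)).le
  have hconst : ∀ s ∈ uIoc (a i) (a (i + 1)), staircase k t y s =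
      ((Finset.Icc (i + 1) k).sup y : ℝ≥0) := by
    intro s hs
    rw [uIoc_of_le hprev] at hs
    unfold staircase
    congr 2
    ext j
    simp only [Finset.mem_filter, Finset.mem_Icc]
    constructor
    · rintro ⟨⟨h1, h2⟩, h3⟩
      refine ⟨?_, h2⟩
      by_contra! hcon
      have h4 : t j ≤ t i := ht.monotoneOn ⟨h1, h2⟩ ⟨by omega, by omega⟩ (by omega)
      have h5 : a i = t i := by simp only [ha]; rw [if_neg (by omega)]
      linarith [hs.1]
    · rintro ⟨h1, h2⟩
      refine ⟨⟨by omega, h2⟩, hs.2.trans ?_⟩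
      have h5 : a (i + 1) = t (i + 1) := by simp [ha]
      rw [h5]
      exact ht.monotoneOn ⟨by omega, by omega⟩ ⟨by omega, h2⟩ h1
  rw [intervalIntegral.integral_congr_ae (ae_of_all _ hconst), intervalIntegral.integral_const,
    smul_eq_mul]
  simp [ha]

lemma exp_integral_staircase (θ : ℝ) (ht : StrictMonoOn t (Icc 1 k))
    (ht0 : ∀ i ∈ Icc 1 k, 0 ≤ t i) :
    Real.exp (-θ * ∫ s in (0 : ℝ)..(if k = 0 then 0 else t k), staircase k t y s) =
      fddProduct θ k t y := by
  rw [integral_staircase ht ht0, Finset.mul_sum, Real.exp_sum]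
  refine Finset.prod_congr rfl fun i _ => ?_
  rw [Hbar, ← Real.exp_mul]
  ring_nf

lemma staircase_eq_zero (ht : StrictMonoOn t (Icc 1 k)) {s : ℝ}
    (hs : (if k = 0 then 0 else t k) < s) : staircase k t y s = 0 := by
  refine le_antisymm ((staircase_le_iff le_rfl).2 fun i hi hsi => ?_) (staircase_nonneg s)
  have h1 : t i ≤ t k := ht.monotoneOn hi ⟨hi.1.trans hi.2, le_rfl⟩ hi.2
  rw [if_neg (by have := hi.1.trans hi.2; omega)] at hs
  linarith

end Staircase

/-! ### The running minimum of the marks as a version of `Z_H` -/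

section LimitPath

variable {Ω : Type*} {T U : ℕ × ℕ → Ω → ℝ}

/-- The smallest mark of the points that arrive up to time `t`. -/
noncomputable def minMark (T U : ℕ × ℕ → Ω → ℝ) (ω : Ω) (t : ℝ≥0) : ℝ≥0∞ :=
  ⨅ p : ℕ × ℕ, if arrival T p.1 (p.2 + 1) ω ≤ t then ENNReal.ofReal (U p ω) else ⊤

/-- The outcomes for which the points with the given arrival times and marks are locally finite. -/
def regularOutcomes (T U : ℕ × ℕ → Ω → ℝ) : Set Ω :=
  {ω | (∀ p, 0 < T p ω) ∧ (∀ p : ℕ × ℕ, U p ω ∈ Ioc (p.1 : ℝ) (p.1 + 1)) ∧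
    ∀ i r : ℕ, ∃ m, (r : ℝ) < arrival T i m ω}

lemma le_minMark_iff {ω : Ω} {t : ℝ≥0} {x : ℝ≥0∞} :
    x ≤ minMark T U ω t ↔
      ∀ p : ℕ × ℕ, arrival T p.1 (p.2 + 1) ω ≤ t → x ≤ ENNReal.ofReal (U p ω) := by
  unfold minMark
  rw [le_iInf_iff]
  refine forall_congr' fun p => ?_
  split_ifs with h <;> simp [h]

lemma antitone_minMark (ω : Ω) : Antitone (minMark T U ω) := fun _ _ h =>
  le_minMark_iff.2 fun p hp => le_minMark_iff.1 le_rfl p (hp.trans h)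

lemma monotone_arrival {ω : Ω} (hT : ∀ p, 0 ≤ T p ω) (i : ℕ) :
    Monotone fun m => arrival T i m ω :=
  monotone_nat_of_le_succ fun m => by rw [arrival_succ]; linarith [hT (i, m)]

/-- The bound on the mark leaves finitely many strips, and in each of them the arrivals eventually
exceed `r`. -/
lemma finite_points {ω : Ω} (hω : ω ∈ regularOutcomes T U) (r y : ℝ) :
    {p : ℕ × ℕ | arrival T p.1 (p.2 + 1) ω ≤ r ∧ U p ω ≤ y}.Finite := by
  obtain ⟨hT, hU, hdiv⟩ := hω
  obtain ⟨r', hr'⟩ := exists_nat_ge r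
  obtain ⟨n, hn⟩ := exists_nat_ge y
  choose m hm using fun i => hdiv i r'
  refine ((Finset.range n).sigma fun i => Finset.range (m i)).finite_toSet.image
    (fun q => (q.1, q.2)) |>.subset ?_
  rintro ⟨i, j⟩ ⟨h1, h2⟩
  refine ⟨⟨i, j⟩, ?_, rfl⟩
  simp only [Finset.coe_sigma, Finset.mem_coe, Set.mem_sigma_iff, Finset.mem_range]
  constructor
  · have : (i : ℝ) < n := (hU (i, j)).1.trans_le (h2.trans hn)
    exact_mod_cast this
  · by_contra! hcon
    have := monotone_arrival (fun p => (hT p).le) i (hcon.trans (Nat.le_succ j))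
    dsimp only at this h1
    linarith [hm i]

/-- Only a drop just after `t` could spoil this. Below a given level there are finitely many points
up to time `t + 1`, so those arriving after `t` keep a positive distance from it. -/
lemma rightContinuous_minMark {ω : Ω} (hω : ω ∈ regularOutcomes T U) (t : ℝ≥0) :
    ContinuousWithinAt (minMark T U ω) (Ici t) t := by
  refine tendsto_order.2 ⟨fun x hx => ?_, fun x hx => ?_⟩
  · obtain ⟨y, hxy, hy⟩ := ENNReal.lt_iff_exists_nnreal_btwn.1 hx
    have h1 : ∀ᶠ s in 𝓝[≥] t, s < t + 1 :=
      mem_nhdsWithin_of_mem_nhds (Iio_mem_nhds (lt_add_one t))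
    have h2 : ∀ᶠ s : ℝ≥0 in 𝓝[≥] t, ∀ p ∈ {p : ℕ × ℕ | arrival T p.1 (p.2 + 1) ω ≤ t + 1 ∧
        U p ω ≤ y}, (t : ℝ) < arrival T p.1 (p.2 + 1) ω →
        (s : ℝ) < arrival T p.1 (p.2 + 1) ω := by
      refine (Filter.eventually_all_finite (finite_points hω (t + 1) y)).2 fun p _ => ?_
      by_cases h : (t : ℝ) < arrival T p.1 (p.2 + 1) ω
      · have := (NNReal.continuous_coe.tendsto t).eventually (Iio_mem_nhds h)
        filter_upwards [mem_nhdsWithin_of_mem_nhds this] with s hs _ using hs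
      · exact .of_forall fun s h' => absurd h' h
    filter_upwards [h1, h2] with s hs1 hs2
    refine hxy.trans_le (le_minMark_iff.2 fun p hp => ?_)
    by_cases hpt : arrival T p.1 (p.2 + 1) ω ≤ t
    · exact hy.le.trans (le_minMark_iff.1 le_rfl p hpt)
    · have hs1' : (s : ℝ) < t + 1 := by exact_mod_cast hs1
      rw [← ENNReal.ofReal_coe_nnreal]
      refine ENNReal.ofReal_le_ofReal ?_
      by_contra! hcon
      exact absurd hp (not_le.2 (hs2 p ⟨hp.trans hs1'.le, hcon.le⟩ (not_le.1 hpt)))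
  · filter_upwards [self_mem_nhdsWithin] with s hs
    exact (antitone_minMark ω hs).trans_lt hx

/-- The constant path. -/
def constPath (I : Type*) {V : Type*} [TopologicalSpace I] [Preorder I] [TopologicalSpace V]
    (v : V) : Cadlag I V where
  toFun _ := v
  rightContinuous _ := continuousWithinAt_const
  exists_leftLimit _ := ⟨v, tendsto_const_nhds⟩

open Classical in
/-- The path of the smallest mark. -/
noncomputable def minMarkPath (T U : ℕ × ℕ → Ω → ℝ) (ω : Ω) : PathSpace :=
  if h : ω ∈ regularOutcomes T U then
    { toFun := minMark T U ω
      rightContinuous := rightContinuous_minMark h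
      exists_leftLimit := fun t => ⟨_, (antitone_minMark ω).tendsto_leftLim t⟩ }
  else constPath ℝ≥0 ⊤

lemma minMarkPath_apply {ω : Ω} (h : ω ∈ regularOutcomes T U) (t : ℝ≥0) :
    minMarkPath T U ω t = minMark T U ω t := by
  simp [minMarkPath, h]

lemma minMarkPath_of_notMem {ω : Ω} (h : ω ∉ regularOutcomes T U) (t : ℝ≥0) :
    minMarkPath T U ω t = ⊤ := by
  simp [minMarkPath, h, constPath]

lemma antitone_minMarkPath (ω : Ω) : Antitone (minMarkPath T U ω).toFun := by
  intro s t hst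
  by_cases h : ω ∈ regularOutcomes T U
  · rw [minMarkPath_apply h, minMarkPath_apply h]
    exact antitone_minMark ω hst
  · rw [minMarkPath_of_notMem h, minMarkPath_of_notMem h]

variable [MeasurableSpace Ω]

lemma measurableSet_regularOutcomes (hT : ∀ p, Measurable (T p)) (hU : ∀ p, Measurable (U p)) :
    MeasurableSet (regularOutcomes T U) := by
  have e : regularOutcomes T U = (⋂ p, {ω | 0 < T p ω}) ∩ ((⋂ p : ℕ × ℕ, U p ⁻¹' Ioc p.1 (p.1 + 1)) ∩
      ⋂ i, ⋂ r : ℕ, ⋃ m, {ω | (r : ℝ) < arrival T i m ω}) := by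
    ext ω; simp [regularOutcomes]
  rw [e]
  refine (MeasurableSet.iInter fun p => measurableSet_lt measurable_const (hT p)).inter
    ((MeasurableSet.iInter fun p => hU p measurableSet_Ioc).inter ?_)
  exact .iInter fun i => .iInter fun r => .iUnion fun m =>
    measurableSet_lt measurable_const (measurable_arrival fun _ _ => hT _)

lemma measurable_minMarkPath (hT : ∀ p, Measurable (T p)) (hU : ∀ p, Measurable (U p)) (t : ℝ≥0) :
    Measurable fun ω => minMarkPath T U ω t := by
  classical
  have e : (fun ω => minMarkPath T U ω t) =
      (regularOutcomes T U).piecewise (fun ω => minMark T U ω t) fun _ => ⊤ := by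
    funext ω
    by_cases h : ω ∈ regularOutcomes T U
    · simp [h, minMarkPath_apply h]
    · simp [h, minMarkPath_of_notMem h]
  rw [e]
  refine Measurable.piecewise (measurableSet_regularOutcomes hT hU) ?_ measurable_const
  refine Measurable.iInf fun p => Measurable.ite (measurableSet_le
    (measurable_arrival fun _ _ => hT _) measurable_const) (hU p).ennreal_ofReal measurable_const

/-- The finite-dimensional event says that no mark lies below the staircase at its arrival time, so
its probability is the void probability just computed. -/
theorem isZH_minMarkPath {P : Measure Ω} [IsProbabilityMeasure P] {θ : ℝ} (hθ : 0 < θ)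
    (hTm : ∀ p, Measurable (T p)) (hUm : ∀ p, Measurable (U p))
    (hTlaw : ∀ p, HasLaw (T p) (expMeasure θ) P) (hTi : iIndepFun T P)
    (hUlaw : ∀ p, HasLaw (U p) (volume.restrict (Ioc (p.1 : ℝ) (p.1 + 1))) P)
    (hUi : iIndepFun U P) (hTU : IndepFun (fun ω p => T p ω) (fun ω p => U p ω) P)
    (hreg : ∀ᵐ ω ∂P, ω ∈ regularOutcomes T U) :
    IsZH P θ (minMarkPath T U) := by
  refine ⟨measurable_minMarkPath hTm hUm, fun k t y ht => ?_⟩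
  have ht' : StrictMonoOn (fun i => (t i : ℝ)) (Icc 1 k) := fun i hi j hj h => ht hi hj h
  obtain ⟨n, hn⟩ := exists_nat_staircase_le (k := k) (t := fun i => (t i : ℝ)) (y := y)
  have h := measure_forall_le_mark hθ hTm hUm hTlaw hTi hUlaw hUi hTU
    (hreg.mono fun ω h p => (h.1 p).le) (hreg.mono fun ω h p => (h.2.1 p).1.le)
    (hreg.mono fun ω h i r => by
      obtain ⟨r', hr'⟩ := exists_nat_ge r
      obtain ⟨m, hm⟩ := h.2.2 i r'
      exact ⟨m, hr'.trans_lt hm⟩)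
    (antitone_staircase (k := k) (t := fun i => (t i : ℝ)) (y := y)) staircase_nonneg
    (fun x hx => staircase_eq_zero ht' hx) n hn
  rw [exp_integral_staircase θ ht' fun i _ => (t i).2] at h
  have hpos : 0 ≤ fddProduct θ k (fun i => t i) y :=
    Finset.prod_nonneg fun i _ => Real.rpow_nonneg (Real.exp_pos _).le _
  rw [measureReal_def, ← ENNReal.toReal_ofReal hpos, ← h]
  congr 1
  refine measure_congr ?_
  filter_upwards [hreg] with ω hω
  refine propext ?_
  change (∀ i ∈ Icc 1 k, (y i : ℝ≥0∞) ≤ minMarkPath T U ω (t i)) ↔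
    ∀ i j, staircase k (fun i => (t i : ℝ)) y (arrival T i (j + 1) ω) ≤ U (i, j) ω
  have hU0 : ∀ p, 0 ≤ U p ω := fun p => (Nat.cast_nonneg _).trans (hω.2.1 p).1.le
  simp_rw [minMarkPath_apply hω, le_minMark_iff, staircase_le_iff (hU0 _),
    ← ENNReal.ofReal_coe_nnreal, ENNReal.ofReal_le_ofReal_iff (hU0 _)]
  exact ⟨fun H i j l hl h' => H l hl (i, j) h', fun H l hl p h' => H p.1 p.2 l hl h'⟩

end LimitPath

/-! ### Level functions and partial maxima -/

section Levels

variable {Ω : Type*} [MeasurableSpace Ω] {P : Measure Ω} {X : ℕ → Ω → ℝ} {D : ℕ+ → Set ℝ}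
  {u : ℕ+ → ℝ → ℝ}

lemma levelInv_mem {n : ℕ+} {z : ℝ} (hz : z ∈ u n '' D n) : levelInv D u n z ∈ D n :=
  Function.invFunOn_mem hz

lemma apply_levelInv {n : ℕ+} {z : ℝ} (hz : z ∈ u n '' D n) : u n (levelInv D u n z) = z :=
  Function.invFunOn_eq hz

lemma levelInv_nonneg (hu : IsLevelSequence P X D u) {n : ℕ+} {z : ℝ} (hz : z ∈ u n '' D n) :
    0 ≤ levelInv D u n z := hu.nonneg n (levelInv_mem hz)

lemma antitoneOn_levelInv (hu : IsLevelSequence P X D u) (n : ℕ+) :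
    AntitoneOn (levelInv D u n) (u n '' D n) := by
  intro z hz z' hz' h
  by_contra! hcon
  have := hu.strictAntiOn n (levelInv_mem hz) (levelInv_mem hz') hcon
  rw [apply_levelInv hz, apply_levelInv hz'] at this
  linarith

lemma partialSups_mem_range {n : ℕ+} {x : ℕ → ℝ} (hx : ∀ j, x j ∈ u n '' D n) (k : ℕ) :
    partialSups x k ∈ u n '' D n := by
  obtain ⟨j, -, h⟩ := exists_partialSups_eq x k
  rw [h]; exact hx j

/-- The inverse level function is decreasing and the maximum is one of the values, so the maximum of
the observations becomes the minimum of their frequencies. -/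
lemma le_levelMax_iff (hu : IsLevelSequence P X D u) {n : ℕ+} {x : ℕ → ℝ}
    (hx : ∀ j, x j ∈ u n '' D n) {y : ℝ} {k : ℕ} :
    y ≤ levelMax D u n x k ↔ ∀ j ≤ k, y ≤ levelInv D u n (x j) := by
  unfold levelMax
  constructor
  · intro h j hj
    exact h.trans (antitoneOn_levelInv hu n (hx j) (partialSups_mem_range hx k)
      (le_partialSups_of_le x hj))
  · intro h
    obtain ⟨j, hj, e⟩ := exists_partialSups_eq x k
    rw [e]; exact h j hj

lemma antitone_levelMax (hu : IsLevelSequence P X D u) {n : ℕ+} {x : ℕ → ℝ}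
    (hx : ∀ j, x j ∈ u n '' D n) : Antitone (levelMax D u n x) := fun _ _ h =>
  antitoneOn_levelInv hu n (partialSups_mem_range hx _) (partialSups_mem_range hx _)
    ((partialSups x).monotone h)

lemma levelMax_nonneg (hu : IsLevelSequence P X D u) {n : ℕ+} {x : ℕ → ℝ}
    (hx : ∀ j, x j ∈ u n '' D n) (k : ℕ) : 0 ≤ levelMax D u n x k :=
  levelInv_nonneg hu (partialSups_mem_range hx k)

lemma ae_forall_mem_range (hu : IsLevelSequence P X D u) (n : ℕ+) :
    ∀ᵐ ω ∂P, ∀ j, X j ω ∈ u n '' D n := ae_all_iff.2 fun j => hu.mem_range n j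

/-- The range of `u n` is an interval, being a continuous image of one. The inverse is monotone on
it, and the law of `X j` is concentrated there. -/
lemma aemeasurable_levelInv (hu : IsLevelSequence P X D u) (hX : ∀ j, Measurable (X j)) (n : ℕ+)
    (j : ℕ) : AEMeasurable (fun ω => levelInv D u n (X j ω)) P := by
  have hR : MeasurableSet (u n '' D n) :=
    ((hu.ordConnected n).isPreconnected.image _ (hu.continuousOn n)).ordConnected.measurableSet
  have h := aemeasurable_restrict_of_antitoneOn (μ := P.map (X j)) hR (antitoneOn_levelInv hu n)
  rw [Measure.restrict_eq_self_of_ae_mem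
    (s := u n '' D n) ((ae_map_iff (hX j).aemeasurable hR).2 (hu.mem_range n j))] at h
  exact h.comp_measurable (hX j)

lemma nullMeasurableSet_le_levelMax (hu : IsLevelSequence P X D u) (hX : ∀ j, Measurable (X j))
    (n : ℕ+) (y : ℝ) (k : ℕ) :
    NullMeasurableSet {ω | y ≤ levelMax D u n (fun j => X j ω) k} P := by
  have h : NullMeasurableSet (⋂ j, ⋂ (_ : j ≤ k), {ω | y ≤ levelInv D u n (X j ω)}) P :=
    .iInter fun j => .iInter fun _ => nullMeasurableSet_le aemeasurable_const
      (aemeasurable_levelInv hu hX n j)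
  refine h.congr ?_
  filter_upwards [ae_forall_mem_range hu n] with ω hω
  refine propext ?_
  change ω ∈ (⋂ j, ⋂ (_ : j ≤ k), {ω | y ≤ levelInv D u n (X j ω)}) ↔
    y ≤ levelMax D u n (fun j => X j ω) k
  rw [le_levelMax_iff hu hω]
  simp

lemma coe_le_extremalProcess_iff (hu : IsLevelSequence P X D u) {n : ℕ+} {ω : Ω}
    (hω : ∀ j, X j ω ∈ u n '' D n) {y t : ℝ≥0} :
    (y : ℝ≥0∞) ≤ extremalProcess X D u n ω t ↔
      (y : ℝ) ≤ levelMax D u n (fun j => X j ω) ⌊(n : ℝ) * (t : ℝ)⌋₊ := by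
  change (y : ℝ≥0∞) ≤ ENNReal.ofReal _ ↔ _
  rw [← ENNReal.ofReal_coe_nnreal, ENNReal.ofReal_le_ofReal_iff (levelMax_nonneg hu hω _)]

end Levels

/-! ### Test functions for void events -/

section Tent

/-- A sum of products of truncated linear functions, which is positive exactly on the union of the
boxes `[0, c.1 + ε) × [0, c.2 + ε)`. -/
noncomputable def tent (F : Finset (ℝ≥0 × ℝ≥0)) (ε : ℝ≥0) : C_c(ℝ≥0 × ℝ≥0, ℝ) where
  toFun z := ∑ c ∈ F, (((c.1 + ε - z.1) * (c.2 + ε - z.2) : ℝ≥0) : ℝ)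
  continuous_toFun := by fun_prop
  hasCompactSupport' := by
    obtain ⟨b, hb⟩ := F.exists_le
    refine HasCompactSupport.intro (isCompact_Icc (a := (0 : ℝ≥0 × ℝ≥0)) (b := b + (ε, ε)))
      fun z hz => Finset.sum_eq_zero fun c hc => ?_
    have hcb := hb c hc
    rw [NNReal.coe_eq_zero, mul_eq_zero, tsub_eq_zero_iff_le, tsub_eq_zero_iff_le]
    by_contra! hcon
    refine hz ⟨zero_le, ?_, ?_⟩
    · exact hcon.1.le.trans (add_le_add_left hcb.1 ε)
    · exact hcon.2.le.trans (add_le_add_left hcb.2 ε)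

lemma tent_apply (F : Finset (ℝ≥0 × ℝ≥0)) (ε : ℝ≥0) (z : ℝ≥0 × ℝ≥0) :
    tent F ε z = ∑ c ∈ F, (((c.1 + ε - z.1) * (c.2 + ε - z.2) : ℝ≥0) : ℝ) := rfl

lemma tent_nonneg (F : Finset (ℝ≥0 × ℝ≥0)) (ε : ℝ≥0) (z : ℝ≥0 × ℝ≥0) : 0 ≤ tent F ε z :=
  Finset.sum_nonneg fun _ _ => NNReal.coe_nonneg _

lemma tent_eq_zero_iff {F : Finset (ℝ≥0 × ℝ≥0)} {ε : ℝ≥0} {z : ℝ≥0 × ℝ≥0} :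
    tent F ε z = 0 ↔ ∀ c ∈ F, z.1 < c.1 + ε → c.2 + ε ≤ z.2 := by
  rw [tent_apply, Finset.sum_eq_zero_iff_of_nonneg fun _ _ => NNReal.coe_nonneg _]
  refine forall₂_congr fun c _ => ?_
  rw [NNReal.coe_eq_zero, mul_eq_zero, tsub_eq_zero_iff_le, tsub_eq_zero_iff_le, ← not_lt,
    imp_iff_not_or]

/-- On the closed box below `c` both truncated factors are at least `ε`. A single point there
already forces the integral up to `ε²`, which makes emptiness detectable by an open condition. -/
lemma sq_le_tent {F : Finset (ℝ≥0 × ℝ≥0)} {ε : ℝ≥0} {z c : ℝ≥0 × ℝ≥0} (hc : c ∈ F)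
    (hz : z ≤ c) : (ε : ℝ) * ε ≤ tent F ε z := by
  rw [tent_apply]
  refine le_trans ?_ (Finset.single_le_sum
    (f := fun c : ℝ≥0 × ℝ≥0 => (((c.1 + ε - z.1) * (c.2 + ε - z.2) : ℝ≥0) : ℝ))
    (fun _ _ => NNReal.coe_nonneg _) hc)
  rw [← NNReal.coe_mul, NNReal.coe_le_coe]
  refine mul_le_mul' ?_ ?_
  · exact le_tsub_of_add_le_left (add_le_add_left hz.1 ε)
  · exact le_tsub_of_add_le_left (add_le_add_left hz.2 ε)

variable {E : Type*} [TopologicalSpace E] [MeasurableSpace E]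

lemma continuous_integral_pointMeasure (f : C_c(E, ℝ)) :
    Continuous fun m : PointMeasure E => ∫ x, f x ∂m.toMeasure :=
  continuous_iInf_dom (i := f) continuous_induced_dom

instance (m : PointMeasure E) : IsFiniteMeasureOnCompacts m.toMeasure :=
  ⟨fun K hK => m.lt_top_of_isCompact K hK⟩

lemma integrable_pointMeasure [OpensMeasurableSpace E] (m : PointMeasure E) (f : C_c(E, ℝ)) :
    Integrable f m.toMeasure :=
  f.continuous.integrable_of_hasCompactSupport f.hasCompactSupport

lemma integral_pointMeasure_nonpos_iff [OpensMeasurableSpace E] (m : PointMeasure E) {f : C_c(E, ℝ)}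
    (hf : ∀ x, 0 ≤ f x) : ∫ x, f x ∂m.toMeasure ≤ 0 ↔ ∀ᵐ x ∂m.toMeasure, f x = 0 := by
  have h := integral_eq_zero_iff_of_nonneg (μ := m.toMeasure) (f := fun x => f x) hf
    (integrable_pointMeasure m f)
  exact ⟨fun h' => h.1 (le_antisymm h' (integral_nonneg hf)), fun h' => (h.2 h').le⟩

end Tent

/-! ### Void events of the empirical point process -/

section Empirical

variable {Ω : Type*} [MeasurableSpace Ω] {P : Measure Ω} {X : ℕ → Ω → ℝ} {D : ℕ+ → Set ℝ}
  {u : ℕ+ → ℝ → ℝ}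

lemma div_le_iff_le_floor (n : ℕ+) (j : ℕ) (t : ℝ≥0) :
    (j : ℝ≥0) / (n : ℝ≥0) ≤ t ↔ j ≤ ⌊(n : ℝ) * (t : ℝ)⌋₊ := by
  have hn : (0 : ℝ≥0) < (n : ℝ≥0) := by exact_mod_cast n.pos
  rw [div_le_iff₀ hn, Nat.le_floor_iff (by positivity), ← NNReal.coe_le_coe, mul_comm]
  push_cast
  rfl

lemma coe_le_extremalProcess_iff_forall (hu : IsLevelSequence P X D u) {n : ℕ+} {ω : Ω}
    (hω : ∀ j, X j ω ∈ u n '' D n) {y t : ℝ≥0} :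
    (y : ℝ≥0∞) ≤ extremalProcess X D u n ω t ↔
      ∀ j : ℕ, (j : ℝ≥0) / (n : ℝ≥0) ≤ t → y ≤ (levelInv D u n (X j ω)).toNNReal := by
  rw [coe_le_extremalProcess_iff hu hω, le_levelMax_iff hu hω]
  refine forall_congr' fun j => ?_
  rw [div_le_iff_le_floor, Real.le_toNNReal_iff_coe_le (levelInv_nonneg hu (hω j))]

/-- `tent F 0` is positive only on the half-open boxes `[0, t) × [0, y)`, which contain no point
under `h`. This closed condition gives the upper bound. -/
lemma integral_tent_empirical_nonpos (hu : IsLevelSequence P X D u) {n : ℕ+} {ω : Ω}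
    (hω : ∀ j, X j ω ∈ u n '' D n) {F : Finset (ℝ≥0 × ℝ≥0)}
    (h : ∀ c ∈ F, (c.2 : ℝ≥0∞) ≤ extremalProcess X D u n ω c.1) :
    ∫ z, tent F 0 z ∂(empirical X D u n ω).toMeasure ≤ 0 := by
  rw [integral_pointMeasure_nonpos_iff _ (tent_nonneg F 0)]
  have hm : MeasurableSet {z | tent F 0 z = 0} :=
    (isClosed_eq (tent F 0).continuous continuous_const).measurableSet
  change ∀ᵐ x ∂(Measure.sum _), _
  rw [Measure.ae_sum_iff' hm]
  intro j
  rw [ae_dirac_iff hm, tent_eq_zero_iff]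
  intro c hc hj
  rw [add_zero] at *
  exact (coe_le_extremalProcess_iff_forall hu hω).1 (h c hc) j hj.le

lemma le_extremalProcess_of_integral_tent_lt (hu : IsLevelSequence P X D u) {n : ℕ+} {ω : Ω}
    (hω : ∀ j, X j ω ∈ u n '' D n) {F : Finset (ℝ≥0 × ℝ≥0)} {ε : ℝ≥0}
    (h : ∫ z, tent F ε z ∂(empirical X D u n ω).toMeasure < (ε : ℝ) * ε) :
    ∀ c ∈ F, (c.2 : ℝ≥0∞) ≤ extremalProcess X D u n ω c.1 := by
  intro c hc
  rw [coe_le_extremalProcess_iff_forall hu hω]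
  intro j hj
  by_contra! hcon
  refine absurd h (not_lt.2 ?_)
  calc (ε : ℝ) * ε ≤ tent F ε ((j : ℝ≥0) / (n : ℝ≥0), (levelInv D u n (X j ω)).toNNReal) :=
        sq_le_tent hc ⟨hj, hcon.le⟩
    _ = ∫ z, tent F ε z
          ∂(Measure.dirac ((j : ℝ≥0) / (n : ℝ≥0), (levelInv D u n (X j ω)).toNNReal)) :=
        (integral_dirac _ _).symm
    _ ≤ ∫ z, tent F ε z ∂(empirical X D u n ω).toMeasure :=
        integral_mono_measure (Measure.le_sum (fun j : ℕ => Measure.dirac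
          ((j : ℝ≥0) / (n : ℝ≥0), (levelInv D u n (X j ω)).toNNReal)) j)
          (ae_of_all _ (tent_nonneg F ε)) (integrable_pointMeasure _ _)

end Empirical

/-! ### Portmanteau bounds and a union bound -/

section Portmanteau

variable {ι Ω Ω' E : Type*} [MeasurableSpace Ω] [MeasurableSpace Ω'] {P : Measure Ω}
  {P' : Measure Ω'} [IsProbabilityMeasure P] [IsProbabilityMeasure P'] {l : Filter ι}
  [TopologicalSpace E] [MeasurableSpace E] [BorelSpace E] [HasOuterApproxClosed E]
  {Y : ι → Ω → E} {Z : Ω' → E}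

lemma eventually_measureReal_preimage_lt (h : TendstoInDistribution Y l Z (fun _ => P) P')
    {C : Set E} (hC : IsClosed C) {x : ℝ} (hx : P'.real (Z ⁻¹' C) < x) :
    ∀ᶠ n in l, P.real (Y n ⁻¹' C) < x := by
  have h1 := ProbabilityMeasure.limsup_measure_closed_le_of_tendsto h.tendsto hC
  change limsup (fun n => P.map (Y n) C) l ≤ P'.map Z C at h1
  rw [Measure.map_apply_of_aemeasurable h.aemeasurable_limit hC.measurableSet] at h1
  have h2 : P' (Z ⁻¹' C) < ENNReal.ofReal x :=
    (ENNReal.lt_ofReal_iff_toReal_lt (measure_ne_top _ _)).2 hx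
  filter_upwards [eventually_lt_of_limsup_lt (h1.trans_lt h2)] with n hn
  rw [Measure.map_apply_of_aemeasurable (h.forall_aemeasurable n) hC.measurableSet] at hn
  exact (ENNReal.lt_ofReal_iff_toReal_lt (measure_ne_top _ _)).1 hn

lemma eventually_lt_measureReal_preimage (h : TendstoInDistribution Y l Z (fun _ => P) P')
    {C : Set E} (hC : IsOpen C) {x : ℝ} (hx : x < P'.real (Z ⁻¹' C)) :
    ∀ᶠ n in l, x < P.real (Y n ⁻¹' C) := by
  rcases lt_or_ge x 0 with hx0 | hx0
  · exact .of_forall fun n => hx0.trans_le measureReal_nonneg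
  have h1 := ProbabilityMeasure.le_liminf_measure_open_of_tendsto h.tendsto hC
  change P'.map Z C ≤ liminf (fun n => P.map (Y n) C) l at h1
  rw [Measure.map_apply_of_aemeasurable h.aemeasurable_limit hC.measurableSet] at h1
  have h2 : ENNReal.ofReal x < P' (Z ⁻¹' C) :=
    (ENNReal.ofReal_lt_iff_lt_toReal hx0 (measure_ne_top _ _)).2 hx
  filter_upwards [eventually_lt_of_lt_liminf (h2.trans_le h1)] with n hn
  rw [Measure.map_apply_of_aemeasurable (h.forall_aemeasurable n) hC.measurableSet] at hn
  exact (ENNReal.ofReal_lt_iff_lt_toReal hx0 (measure_ne_top _ _)).1 hn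

/-- Reduces the error of perturbing a joint event to the errors of its single constraints, so
continuity of the one-time probabilities is enough. -/
lemma measureReal_forall_mem_le_add {κ : Type*} (F : Finset κ) {A B : κ → Set Ω}
    (hAB : ∀ c, A c ⊆ B c) (hA : ∀ c, MeasurableSet (A c)) :
    P.real {ω | ∀ c ∈ F, ω ∈ B c} ≤
      P.real {ω | ∀ c ∈ F, ω ∈ A c} + ∑ c ∈ F, (P.real (B c) - P.real (A c)) := by
  have hsub : {ω | ∀ c ∈ F, ω ∈ B c} ⊆ {ω | ∀ c ∈ F, ω ∈ A c} ∪ ⋃ c ∈ F, (B c \ A c) := by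
    intro ω hω
    by_cases h : ∀ c ∈ F, ω ∈ A c
    · exact .inl h
    · push Not at h
      obtain ⟨c, hc, hcA⟩ := h
      exact .inr (mem_biUnion hc ⟨hω c hc, hcA⟩)
  refine (measureReal_mono hsub).trans ((measureReal_union_le _ _).trans ?_)
  refine add_le_add_right ((measureReal_biUnion_finset_le _ _).trans (le_of_eq ?_)) _
  exact Finset.sum_congr rfl fun c _ => measureReal_sdiff (hAB c) (hA c)

end Portmanteau

/-! ### Void events of the Mori–Hsing process -/

section MoriHsing

variable {Ω' : Type*} {T U : ℕ × ℕ → Ω' → ℝ}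

/-- The measure of a Mori–Hsing configuration. -/
noncomputable def moriHsingMeasure (T U : ℕ × ℕ → Ω' → ℝ)
    (γ : ℕ × ℕ → Ω' → PointMeasure (Ici (1 : ℝ))) (ω : Ω') : Measure (ℝ≥0 × ℝ≥0) :=
  Measure.sum fun p : ℕ × ℕ => (γ p ω).toMeasure.map fun y : Ici (1 : ℝ) =>
    ((arrival T p.1 (p.2 + 1) ω).toNNReal, (U p ω * (y : ℝ)).toNNReal)

variable {γ : ℕ × ℕ → Ω' → PointMeasure (Ici (1 : ℝ))} {ω : Ω'}

lemma measurable_moriHsing_point (T U : ℕ × ℕ → Ω' → ℝ) (p : ℕ × ℕ) (ω : Ω') :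
    Measurable fun y : Ici (1 : ℝ) =>
      ((arrival T p.1 (p.2 + 1) ω).toNNReal, (U p ω * (y : ℝ)).toNNReal) := by
  fun_prop

lemma ae_moriHsingMeasure_iff {q : ℝ≥0 × ℝ≥0 → Prop} (hq : MeasurableSet {z | q z}) :
    (∀ᵐ z ∂(moriHsingMeasure T U γ ω), q z) ↔ ∀ p, ∀ᵐ y : Ici (1 : ℝ) ∂(γ p ω).toMeasure,
      q ((arrival T p.1 (p.2 + 1) ω).toNNReal, (U p ω * (y : ℝ)).toNNReal) := by
  unfold moriHsingMeasure
  rw [Measure.ae_sum_iff' hq]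
  exact forall_congr' fun p => ae_map_iff (measurable_moriHsing_point T U p ω).aemeasurable hq

lemma one_le_moriHsingMeasure_point (hγ : ∀ p, 1 ≤ (γ p ω).toMeasure {⟨1, le_refl (1 : ℝ)⟩})
    {K : Set (ℝ≥0 × ℝ≥0)} (hK : MeasurableSet K) (p : ℕ × ℕ)
    (hp : ((arrival T p.1 (p.2 + 1) ω).toNNReal, (U p ω).toNNReal) ∈ K) :
    1 ≤ ((γ p ω).toMeasure.map fun y : Ici (1 : ℝ) =>
      ((arrival T p.1 (p.2 + 1) ω).toNNReal, (U p ω * (y : ℝ)).toNNReal)) K := by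
  rw [Measure.map_apply (measurable_moriHsing_point T U p ω) hK]
  refine (hγ p).trans (measure_mono ?_)
  rintro _ rfl
  simpa using hp

/-- If the arrivals of a strip stayed bounded, the atoms at `1` would put infinitely many points
into a compact box. Divergence thus comes from local finiteness of the point measure, with no limit
theorem. -/
lemma exists_lt_arrival {N : PointMeasure (ℝ≥0 × ℝ≥0)}
    (hN : N.toMeasure = moriHsingMeasure T U γ ω)
    (hγ : ∀ p, 1 ≤ (γ p ω).toMeasure {⟨1, le_refl (1 : ℝ)⟩})
    (hU : ∀ p : ℕ × ℕ, U p ω ∈ Ioc (p.1 : ℝ) (p.1 + 1)) (i r : ℕ) :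
    ∃ m, (r : ℝ) < arrival T i m ω := by
  by_contra! hcon
  have hK : IsCompact (Icc (0 : ℝ≥0 × ℝ≥0) (r, i + 1)) := isCompact_Icc
  refine (N.lt_top_of_isCompact _ hK).ne (top_le_iff.1 ?_)
  rw [hN, moriHsingMeasure, Measure.sum_apply _ hK.measurableSet]
  refine le_trans ?_ (ENNReal.tsum_comp_le_tsum_of_injective
    (f := fun j : ℕ => (i, j)) (fun _ _ h => (Prod.mk.inj h).2) _)
  refine le_trans (ENNReal.tsum_const_eq_top_of_ne_zero (α := ℕ) one_ne_zero).ge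
    (ENNReal.tsum_le_tsum fun j => one_le_moriHsingMeasure_point hγ hK.measurableSet (i, j)
      ⟨zero_le, ?_, ?_⟩)
  · exact Real.toNNReal_le_iff_le_coe.2 (by simpa using hcon (j + 1))
  · exact Real.toNNReal_le_iff_le_coe.2 (by simpa using (hU (i, j)).2)

/-- The atom at `1` makes `(T, U)` itself a point of the configuration, so it must avoid the boxes.
The loss of `δ` in time is due to the boxes being open at the right. -/
lemma le_minMarkPath_of_integral_tent_nonpos {N : PointMeasure (ℝ≥0 × ℝ≥0)}
    (hN : N.toMeasure = moriHsingMeasure T U γ ω)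
    (hγ : ∀ p, 1 ≤ (γ p ω).toMeasure {⟨1, le_refl (1 : ℝ)⟩})
    (hω : ω ∈ regularOutcomes T U) {F : Finset (ℝ≥0 × ℝ≥0)}
    (h : ∫ z, tent F 0 z ∂N.toMeasure ≤ 0) {δ : ℝ≥0} (hδ : 0 < δ) :
    ∀ c ∈ F, (c.2 : ℝ≥0∞) ≤ minMarkPath T U ω (c.1 - δ) := by
  intro c hc
  have hm : MeasurableSet {z | tent F 0 z = 0} :=
    (isClosed_eq (tent F 0).continuous continuous_const).measurableSet
  rw [integral_pointMeasure_nonpos_iff _ (tent_nonneg F 0), hN, ae_moriHsingMeasure_iff hm] at h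
  rw [minMarkPath_apply hω, le_minMark_iff]
  intro p hp
  have hpos : 0 < arrival T p.1 (p.2 + 1) ω := Finset.sum_pos (fun _ _ => hω.1 _) (by simp)
  -- For `c.1 = 0` the truncated difference is `0` and there is no slack, but arrivals are strictly
  -- positive, so no point has come by then.
  have hc1 : c.1 - δ < c.1 := by
    refine tsub_lt_self ?_ hδ
    by_contra! hcon
    have : c.1 - δ = 0 := by rw [le_zero_iff.1 hcon, zero_tsub]
    rw [this] at hp
    exact absurd hp (not_le.2 hpos)
  have h1 : tent F 0 ((arrival T p.1 (p.2 + 1) ω).toNNReal, (U p ω * (1 : ℝ)).toNNReal) = 0 := by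
    by_contra hcon
    have h2 := ae_iff.1 (h p)
    have h3 := (hγ p).trans (measure_mono (singleton_subset_iff.2
      (show (⟨1, le_refl (1 : ℝ)⟩ : Ici (1 : ℝ)) ∈ {y : Ici (1 : ℝ) | ¬ tent F 0
        ((arrival T p.1 (p.2 + 1) ω).toNNReal, (U p ω * (y : ℝ)).toNNReal) = 0} from hcon)))
    rw [h2] at h3
    exact absurd h3 (by simp)
  rw [mul_one, tent_eq_zero_iff] at h1
  have h4 := h1 c hc
  rw [add_zero, add_zero] at h4
  exact ENNReal.coe_le_coe.2 (h4 ((Real.toNNReal_le_iff_le_coe.2 hp).trans_lt hc1))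

/-- Cluster points have the same arrival time as their first point and a mark multiplied by `y ≥ 1`,
so they stay out of the boxes whenever `(T, U)` does. -/
lemma integral_tent_nonpos_of_le_minMarkPath {N : PointMeasure (ℝ≥0 × ℝ≥0)}
    (hN : N.toMeasure = moriHsingMeasure T U γ ω) (hω : ω ∈ regularOutcomes T U)
    {F : Finset (ℝ≥0 × ℝ≥0)} {ε : ℝ≥0}
    (h : ∀ c ∈ F, ((c.2 + ε : ℝ≥0) : ℝ≥0∞) ≤ minMarkPath T U ω (c.1 + ε)) :
    ∫ z, tent F ε z ∂N.toMeasure ≤ 0 := by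
  have hm : MeasurableSet {z | tent F ε z = 0} :=
    (isClosed_eq (tent F ε).continuous continuous_const).measurableSet
  rw [integral_pointMeasure_nonpos_iff _ (tent_nonneg F ε), hN, ae_moriHsingMeasure_iff hm]
  refine fun p => ae_of_all _ fun y => tent_eq_zero_iff.2 fun c hc hp => ?_
  have h1 := h c hc
  rw [minMarkPath_apply hω, le_minMark_iff] at h1
  have h2 : c.2 + ε ≤ (U p ω).toNNReal :=
    ENNReal.coe_le_coe.1 (h1 p (Real.toNNReal_le_iff_le_coe.1 hp.le))
  refine h2.trans (Real.toNNReal_le_toNNReal ?_)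
  have h3 : 0 ≤ U p ω := (Nat.cast_nonneg _).trans (hω.2.1 p).1.le
  have h4 : (1 : ℝ) ≤ y := y.2
  nlinarith

variable [MeasurableSpace Ω'] {P' : Measure Ω'} {θ : ℝ}

lemma ae_mem_regularOutcomes {N : Ω' → PointMeasure (ℝ≥0 × ℝ≥0)}
    (hTlaw : ∀ p, HasLaw (T p) (expMeasure θ) P')
    (hUlaw : ∀ p, HasLaw (U p) (volume.restrict (Ioc (p.1 : ℝ) (p.1 + 1))) P')
    (hγ : ∀ p, ∀ᵐ ω ∂P', 1 ≤ (γ p ω).toMeasure {⟨1, le_refl (1 : ℝ)⟩})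
    (hN : ∀ᵐ ω ∂P', (N ω).toMeasure = moriHsingMeasure T U γ ω) :
    ∀ᵐ ω ∂P', ω ∈ regularOutcomes T U := by
  have hT : ∀ᵐ ω ∂P', ∀ p, 0 < T p ω := by
    refine ae_all_iff.2 fun p => ?_
    have h : ∀ᵐ x ∂(expMeasure θ), 0 < x := by
      rw [ae_iff]
      have e : {x : ℝ | ¬ 0 < x} = Iic 0 := by ext; simp
      rw [e]
      change volume.withDensity (exponentialPDF θ) (Iic 0) = 0
      rw [withDensity_apply _ measurableSet_Iic, setLIntegral_congr Iio_ae_eq_Iic.symm]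
      exact lintegral_exponentialPDF_of_nonpos le_rfl
    rw [← (hTlaw p).map_eq] at h
    exact ae_of_ae_map (hTlaw p).aemeasurable h
  have hU : ∀ᵐ ω ∂P', ∀ p : ℕ × ℕ, U p ω ∈ Ioc (p.1 : ℝ) (p.1 + 1) := by
    refine ae_all_iff.2 fun p => ?_
    have h := ae_restrict_mem (μ := volume) (measurableSet_Ioc (a := (p.1 : ℝ)) (b := p.1 + 1))
    rw [← (hUlaw p).map_eq] at h
    exact ae_of_ae_map (hUlaw p).aemeasurable h
  filter_upwards [hT, hU, ae_all_iff.2 hγ, hN] with ω h1 h2 h3 h4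
  exact ⟨h1, h2, exists_lt_arrival h4 h3 h2⟩

lemma measureReal_le_apply {Z : Ω' → PathSpace} (hZ : IsZH P' θ Z) (t y : ℝ≥0) :
    P'.real {ω | (y : ℝ≥0∞) ≤ Z ω t} = Real.exp (-θ * y * t) := by
  have h := hZ.2 1 (fun _ => t) (fun _ => y) (by
    intro i hi j hj hij
    have := hi.1; have := hj.2; omega)
  have e : {ω | ∀ i ∈ Icc 1 1, (y : ℝ≥0∞) ≤ Z ω t} = {ω | (y : ℝ≥0∞) ≤ Z ω t} := by
    ext; simp
  rw [e] at h
  rw [h]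
  simp [fddProduct, Hbar, ← Real.exp_mul]

end MoriHsing

/-! ### Convergence of the finite-dimensional probabilities -/

section Fdd

variable {Ω Ω' : Type*} [MeasurableSpace Ω] [MeasurableSpace Ω'] {P : Measure Ω}
  {P' : Measure Ω'} [IsProbabilityMeasure P] [IsProbabilityMeasure P'] {X : ℕ → Ω → ℝ}
  {D : ℕ+ → Set ℝ} {u : ℕ+ → ℝ → ℝ} {θ : ℝ} {T U : ℕ × ℕ → Ω' → ℝ}
  {γ : ℕ × ℕ → Ω' → PointMeasure (Ici (1 : ℝ))} {Ntil : Ω' → PointMeasure (ℝ≥0 × ℝ≥0)}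

/-- The lower bound enlarges the boxes by `ε` and uses the open condition `∫ < ε²`; the upper bound
shortens the times by `δ` and uses the closed condition `∫ ≤ 0`. Both perturbations cost arbitrarily
little because `exp (-θ y t)` is continuous in `(t, y)`. -/
theorem tendsto_measureReal_extremalProcess (hu : IsLevelSequence P X D u)
    (hγ : ∀ p, ∀ᵐ ω ∂P', 1 ≤ (γ p ω).toMeasure {⟨1, le_refl (1 : ℝ)⟩})
    (hNtil : ∀ᵐ ω ∂P', (Ntil ω).toMeasure = moriHsingMeasure T U γ ω)
    (hreg : ∀ᵐ ω ∂P', ω ∈ regularOutcomes T U) (hZ : IsZH P' θ (minMarkPath T U))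
    (hN : TendstoInDistribution (fun n : ℕ+ => empirical X D u n) atTop Ntil (fun _ => P) P')
    (F : Finset (ℝ≥0 × ℝ≥0)) :
    Tendsto (fun n : ℕ+ => P.real {ω | ∀ c ∈ F, (c.2 : ℝ≥0∞) ≤ extremalProcess X D u n ω c.1})
      atTop (𝓝 (P'.real {ω | ∀ c ∈ F, (c.2 : ℝ≥0∞) ≤ minMarkPath T U ω c.1})) := by
  have hJ := fun ε => hN.continuous_comp (continuous_integral_pointMeasure (tent F ε))
  have hmeas : ∀ t y : ℝ≥0, MeasurableSet {ω | (y : ℝ≥0∞) ≤ minMarkPath T U ω t} :=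
    fun t y => measurableSet_le measurable_const (hZ.1 t)
  have hNeBot : (𝓝[>] (0 : ℝ≥0)).NeBot := nhdsGT_neBot_of_exists_gt ⟨1, one_pos⟩
  rw [tendsto_order]
  constructor
  · intro x hx
    have hε : ∀ᶠ ε : ℝ≥0 in 𝓝[>] 0, ∑ c ∈ F, (Real.exp (-θ * c.2 * c.1) -
        Real.exp (-θ * (c.2 + ε : ℝ≥0) * (c.1 + ε : ℝ≥0))) <
        P'.real {ω | ∀ c ∈ F, (c.2 : ℝ≥0∞) ≤ minMarkPath T U ω c.1} - x := by
      refine eventually_nhdsWithin_of_eventually_nhds (ContinuousAt.eventually_lt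
        (Continuous.continuousAt (by fun_prop)) continuousAt_const ?_)
      simpa using hx
    obtain ⟨ε, hε1, hε0⟩ := (hε.and self_mem_nhdsWithin).exists
    have hε0' : (0 : ℝ) < ε := hε0
    have h1 := measureReal_forall_mem_le_add (P := P') F
      (A := fun c : ℝ≥0 × ℝ≥0 => {ω | ((c.2 + ε : ℝ≥0) : ℝ≥0∞) ≤ minMarkPath T U ω (c.1 + ε)})
      (B := fun c => {ω | (c.2 : ℝ≥0∞) ≤ minMarkPath T U ω c.1})
      (fun c ω hω => le_trans (by simp) (le_trans hω (antitone_minMarkPath ω (by simp))))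
      (fun c => hmeas _ _)
    simp_rw [measureReal_le_apply hZ, mem_ofPred_eq] at h1
    have h2 : P'.real {ω | ∀ c ∈ F, ((c.2 + ε : ℝ≥0) : ℝ≥0∞) ≤ minMarkPath T U ω (c.1 + ε)} ≤
        P'.real (((fun m : PointMeasure (ℝ≥0 × ℝ≥0) => ∫ z, tent F ε z ∂m.toMeasure) ∘ Ntil) ⁻¹'
          Iio ((ε : ℝ) * ε)) := by
      refine ENNReal.toReal_mono (measure_ne_top _ _) (measure_mono_ae ?_)
      filter_upwards [hNtil, hreg] with ω h3 h4 h5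
      exact (integral_tent_nonpos_of_le_minMarkPath h3 h4 h5).trans_lt (mul_pos hε0' hε0')
    filter_upwards [eventually_lt_measureReal_preimage (hJ ε) isOpen_Iio
      (show x < _ from lt_of_lt_of_le (by linarith) h2)] with n hn
    refine hn.trans_le (ENNReal.toReal_mono (measure_ne_top _ _) (measure_mono_ae ?_))
    filter_upwards [ae_forall_mem_range hu n] with ω hω h
    exact le_extremalProcess_of_integral_tent_lt hu hω h
  · intro x hx
    have hδ : ∀ᶠ δ : ℝ≥0 in 𝓝[>] 0, ∑ c ∈ F, (Real.exp (-θ * c.2 * (c.1 - δ : ℝ≥0)) -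
        Real.exp (-θ * c.2 * c.1)) <
        x - P'.real {ω | ∀ c ∈ F, (c.2 : ℝ≥0∞) ≤ minMarkPath T U ω c.1} := by
      refine eventually_nhdsWithin_of_eventually_nhds (ContinuousAt.eventually_lt
        (Continuous.continuousAt (by fun_prop)) continuousAt_const ?_)
      simpa using hx
    obtain ⟨δ, hδ1, hδ0⟩ := (hδ.and self_mem_nhdsWithin).exists
    have h1 := measureReal_forall_mem_le_add (P := P') F
      (A := fun c : ℝ≥0 × ℝ≥0 => {ω | (c.2 : ℝ≥0∞) ≤ minMarkPath T U ω c.1})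
      (B := fun c => {ω | (c.2 : ℝ≥0∞) ≤ minMarkPath T U ω (c.1 - δ)})
      (fun c ω hω => le_trans hω (antitone_minMarkPath ω tsub_le_self)) (fun c => hmeas _ _)
    simp_rw [measureReal_le_apply hZ, mem_ofPred_eq] at h1
    have h2 : P'.real (((fun m : PointMeasure (ℝ≥0 × ℝ≥0) => ∫ z, tent F 0 z ∂m.toMeasure) ∘ Ntil)
        ⁻¹' Iic 0) ≤
        P'.real {ω | ∀ c ∈ F, (c.2 : ℝ≥0∞) ≤ minMarkPath T U ω (c.1 - δ)} := by
      refine ENNReal.toReal_mono (measure_ne_top _ _) (measure_mono_ae ?_)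
      filter_upwards [hNtil, hreg, ae_all_iff.2 hγ] with ω h3 h4 h5 h6
      exact le_minMarkPath_of_integral_tent_nonpos h3 h5 h4 h6 hδ0
    filter_upwards [eventually_measureReal_preimage_lt (hJ 0) isClosed_Iic
      (show _ < x from h2.trans_lt (by linarith))] with n hn
    refine lt_of_le_of_lt (ENNReal.toReal_mono (measure_ne_top _ _) (measure_mono_ae ?_)) hn
    filter_upwards [ae_forall_mem_range hu n] with ω hω h
    exact integral_tent_empirical_nonpos hu hω h

end Fdd

/-! ### From ordered times to arbitrary finite sets of constraints -/

section FiniteDimensional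

variable {I Ω Ω' : Type*} [LinearOrder I] [MeasurableSpace Ω] [MeasurableSpace Ω']
  {P : Measure Ω} {P' : Measure Ω'} {A : I → ℝ≥0 → Set Ω} {B : I → ℝ≥0 → Set Ω'}

/-- The distinct times are sorted and at each one only the largest level is kept, since it implies
the smaller ones. This lets formula (1) determine the probability of any finite family of
constraints. -/
lemma exists_strictMonoOn_forall_iff [Nonempty I] (F : Finset (I × ℝ≥0)) :
    ∃ (k : ℕ) (t : ℕ → I) (y : ℕ → ℝ≥0), StrictMonoOn t (Icc 1 k) ∧
      ∀ q : I → ℝ≥0 → Prop, (∀ a x y, x ≤ y → q a y → q a x) →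
        ((∀ c ∈ F, q c.1 c.2) ↔ ∀ i ∈ Icc 1 k, q (t i) (y i)) := by
  set S := F.image Prod.fst with hS
  let e := S.orderEmbOfFin rfl
  -- Indices run from `1`, hence the shift by one; the default value beyond the range is never read.
  let t : ℕ → I := fun i => if h : i - 1 < S.card then e ⟨i - 1, h⟩ else Classical.arbitrary I
  have ht : ∀ i ∈ Icc 1 S.card, ∃ h : i - 1 < S.card, t i = e ⟨i - 1, h⟩ := by
    intro i hi
    have h : i - 1 < S.card := by have := hi.1; have := hi.2; omega
    exact ⟨h, dif_pos h⟩
  refine ⟨S.card, t, fun i => (F.filter fun c => c.1 = t i).sup Prod.snd, ?_, fun q hq => ?_⟩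
  · intro i hi j hj hij
    obtain ⟨h1, e1⟩ := ht i hi
    obtain ⟨h2, e2⟩ := ht j hj
    rw [e1, e2]
    refine e.strictMono (Fin.mk_lt_mk.2 ?_)
    have := hi.1
    omega
  constructor
  · intro h i hi
    obtain ⟨h1, e1⟩ := ht i hi
    have hmem : t i ∈ S := by rw [e1]; exact S.orderEmbOfFin_mem rfl _
    obtain ⟨c, hc, hct⟩ := Finset.mem_image.1 hmem
    obtain ⟨d, hd, hdy⟩ := Finset.exists_mem_eq_sup (F.filter fun c => c.1 = t i)
      ⟨c, Finset.mem_filter.2 ⟨hc, hct⟩⟩ Prod.snd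
    obtain ⟨hdF, hdt⟩ := Finset.mem_filter.1 hd
    beta_reduce
    rw [hdy, ← hdt]
    exact h d hdF
  · intro h c hc
    have hmem : c.1 ∈ Set.range e := by
      rw [Finset.range_orderEmbOfFin]
      exact Finset.mem_image_of_mem _ hc
    obtain ⟨j, hj⟩ := hmem
    have hj1 : (j : ℕ) + 1 ∈ Icc 1 S.card := ⟨by omega, j.2⟩
    obtain ⟨h1, e1⟩ := ht _ hj1
    have htj : c.1 = t (j + 1) := by rw [e1, ← hj]; rfl
    have h2 := h _ hj1
    rw [htj]
    exact hq _ _ _ (Finset.le_sup (f := Prod.snd) (Finset.mem_filter.2 ⟨hc, htj⟩)) h2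

lemma measureReal_forall_mem_eq [Nonempty I] (hA : ∀ t, Antitone (A t)) (hB : ∀ t, Antitone (B t))
    (h : ∀ (k : ℕ) (t : ℕ → I) (y : ℕ → ℝ≥0), StrictMonoOn t (Icc 1 k) →
      P.real {ω | ∀ i ∈ Icc 1 k, ω ∈ A (t i) (y i)} =
        P'.real {ω | ∀ i ∈ Icc 1 k, ω ∈ B (t i) (y i)}) (F : Finset (I × ℝ≥0)) :
    P.real {ω | ∀ c ∈ F, ω ∈ A c.1 c.2} = P'.real {ω | ∀ c ∈ F, ω ∈ B c.1 c.2} := by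
  obtain ⟨k, t, y, ht, hF⟩ := exists_strictMonoOn_forall_iff F
  have e1 : {ω | ∀ c ∈ F, ω ∈ A c.1 c.2} = {ω | ∀ i ∈ Icc 1 k, ω ∈ A (t i) (y i)} :=
    ext fun ω => hF (fun t y => ω ∈ A t y) fun a _ _ hxy hy => hA a hxy hy
  have e2 : {ω | ∀ c ∈ F, ω ∈ B c.1 c.2} = {ω | ∀ i ∈ Icc 1 k, ω ∈ B (t i) (y i)} :=
    ext fun ω => hF (fun t y => ω ∈ B t y) fun a _ _ hxy hy => hB a hxy hy
  rw [e1, e2, h k t y ht]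

/-- For `B` the event at `t` is contained in the event at `s`. Equal one- and two-time probabilities
carry this inclusion over to `A`, up to a null set. -/
lemma ae_mem_of_measureReal_eq [IsFiniteMeasure P] (hA : ∀ t y, MeasurableSet (A t y))
    (h : ∀ F : Finset (I × ℝ≥0), P.real {ω | ∀ c ∈ F, ω ∈ A c.1 c.2} =
      P'.real {ω | ∀ c ∈ F, ω ∈ B c.1 c.2}) (hB : ∀ y, Antitone fun t => B t y) {s t : I}
    (hst : s ≤ t) (y : ℝ≥0) : ∀ᵐ ω ∂P, ω ∈ A t y → ω ∈ A s y := by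
  have h1 := h {(t, y)}
  have h2 := h {(s, y), (t, y)}
  simp only [Finset.mem_insert, Finset.mem_singleton, forall_eq_or_imp, forall_eq] at h1 h2
  have e : {ω | ω ∈ B s y ∧ ω ∈ B t y} = {ω | ω ∈ B t y} :=
    ext fun ω => ⟨fun h => h.2, fun h => ⟨hB y hst h, h⟩⟩
  rw [e, ← h1] at h2
  have h3 := measureReal_sdiff (μ := P) (show {ω | ω ∈ A s y ∧ ω ∈ A t y} ⊆ {ω | ω ∈ A t y} from
    fun ω h => h.2) ((hA s y).inter (hA t y))
  rw [h2, sub_self, measureReal_eq_zero_iff] at h3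
  refine measure_mono_null (fun ω hω => ?_) h3
  simp only [mem_compl_iff, mem_ofPred_eq, Classical.not_imp] at hω
  exact ⟨hω.1, fun h => hω.2 h.1⟩

end FiniteDimensional

/-! ### Right continuous functions are governed by a dense set of times -/

section RightContinuous

variable {I V : Type*} [LinearOrder I] [TopologicalSpace I] [OrderTopology I] [NoMaxOrder I]
  [DenselyOrdered I] [LinearOrder V] [TopologicalSpace V] [OrderClosedTopology V] {g : I → V}
  {Q : Set I}

lemma nhdsWithin_inter_Ioi_neBot (hQ : Dense Q) (t : I) : (𝓝[Ioi t ∩ Q] t).NeBot := by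
  rw [← mem_closure_iff_nhdsWithin_neBot]
  have h : closure (Ioi t) ⊆ closure (Ioi t ∩ Q) :=
    closure_minimal (hQ.open_subset_closure_inter isOpen_Ioi) isClosed_closure
  refine h ?_
  rw [closure_Ioi]
  exact self_mem_Ici

lemma antitone_of_antitoneOn_dense (hQ : Dense Q) (hg : ∀ t, ContinuousWithinAt g (Ici t) t)
    (h : AntitoneOn g Q) : Antitone g := by
  have hlim : ∀ t, Tendsto g (𝓝[Ioi t ∩ Q] t) (𝓝 (g t)) := fun t =>
    (hg t).mono fun s hs => le_of_lt hs.1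
  have h1 : ∀ t, ∀ r ∈ Q, t < r → g r ≤ g t := fun t r hr htr => by
    have := nhdsWithin_inter_Ioi_neBot hQ t
    refine ge_of_tendsto (hlim t) ?_
    filter_upwards [self_mem_nhdsWithin, mem_nhdsWithin_of_mem_nhds (Iio_mem_nhds htr)] with s hs hs'
    exact h hs.2 hr (le_of_lt hs')
  intro s t hst
  have := nhdsWithin_inter_Ioi_neBot hQ t
  refine le_of_tendsto (hlim t) ?_
  filter_upwards [self_mem_nhdsWithin] with r hr
  exact h1 s r hr.2 (hst.trans_lt hr.1)

lemma forall_le_of_dense {a : V} (hQ : Dense Q) (hg : ∀ t, ContinuousWithinAt g (Ici t) t)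
    (h : ∀ q ∈ Q, a ≤ g q) (t : I) : a ≤ g t := by
  have := nhdsWithin_inter_Ioi_neBot hQ t
  refine ge_of_tendsto ((hg t).mono fun s (hs : s ∈ Ioi t ∩ Q) => le_of_lt hs.1) ?_
  filter_upwards [self_mem_nhdsWithin] with r hr using h r hr.2

end RightContinuous

/-! ### The limit path at positive times -/

section OpenLimitPath

variable {Ω : Type*} {T U : ℕ × ℕ → Ω → ℝ}

/-- The outcomes for which the path of the smallest mark is finite at positive times. -/
def finiteOutcomes (T U : ℕ × ℕ → Ω → ℝ) : Set Ω :=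
  {ω | ∀ n : ℕ, minMarkPath T U ω (1 / ((n : ℝ≥0) + 1)) ≠ ⊤}

/-- The time `t > 0` as an element of `[0, ∞)`. -/
def closedTime (t : Ioi (0 : ℝ)) : ℝ≥0 := ⟨t, le_of_lt t.2⟩

lemma continuous_closedTime : Continuous closedTime :=
  continuous_subtype_val.subtype_mk _

lemma minMarkPath_ne_top {ω : Ω} (h : ω ∈ finiteOutcomes T U) (t : Ioi (0 : ℝ)) :
    minMarkPath T U ω (closedTime t) ≠ ⊤ := by
  obtain ⟨n, hn⟩ := exists_nat_one_div_lt (show (0 : ℝ≥0) < closedTime t from t.2)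
  exact ne_top_of_le_ne_top (h n) (antitone_minMarkPath ω hn.le)

lemma antitone_toReal_minMarkPath {ω : Ω} (h : ω ∈ finiteOutcomes T U) :
    Antitone fun t => (minMarkPath T U ω (closedTime t)).toReal := fun s _ hst =>
  ENNReal.toReal_mono (minMarkPath_ne_top h s) (antitone_minMarkPath ω hst)

open Classical in
/-- The path of the smallest mark at positive times. -/
noncomputable def openMinMarkPath (T U : ℕ × ℕ → Ω → ℝ) (ω : Ω) : OpenPathSpace :=
  if h : ω ∈ finiteOutcomes T U then
    { toFun := fun t => (minMarkPath T U ω (closedTime t)).toReal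
      rightContinuous := fun t => by
        have h1 : ContinuousWithinAt (fun t => minMarkPath T U ω (closedTime t)) (Ici t) t :=
          ContinuousWithinAt.comp (t := Ici (closedTime t))
            ((minMarkPath T U ω).rightContinuous (closedTime t))
            continuous_closedTime.continuousWithinAt fun s hs => hs
        exact (ENNReal.tendsto_toReal (minMarkPath_ne_top h t)).comp h1
      exists_leftLimit := fun t => ⟨_, (antitone_toReal_minMarkPath h).tendsto_leftLim t⟩ }
  else constPath (Ioi (0 : ℝ)) 0

lemma openMinMarkPath_apply {ω : Ω} (h : ω ∈ finiteOutcomes T U) (t : Ioi (0 : ℝ)) :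
    openMinMarkPath T U ω t = (minMarkPath T U ω (closedTime t)).toReal := by
  simp [openMinMarkPath, h]

lemma openMinMarkPath_of_notMem {ω : Ω} (h : ω ∉ finiteOutcomes T U) (t : Ioi (0 : ℝ)) :
    openMinMarkPath T U ω t = 0 := by
  simp [openMinMarkPath, h, constPath]

variable [MeasurableSpace Ω] {P : Measure Ω} [IsProbabilityMeasure P] {θ : ℝ}

/-- An infinite value at `t > 0` exceeds every level `y`, and `exp (-θ y t)` tends to `0` as `y`
grows. By monotonicity the countably many times `1 / (n + 1)` cover all positive times. -/
lemma ae_mem_finiteOutcomes (hθ : 0 < θ) (hZ : IsZH P θ (minMarkPath T U)) :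
    ∀ᵐ ω ∂P, ω ∈ finiteOutcomes T U := by
  refine ae_all_iff.2 fun n => ?_
  set t : ℝ≥0 := 1 / ((n : ℝ≥0) + 1) with ht
  have ht0 : (0 : ℝ) < t := NNReal.coe_pos.2 (by positivity)
  have hlim : Tendsto (fun y : ℕ => Real.exp (-θ * ((y : ℝ≥0) : ℝ) * t)) atTop (𝓝 0) := by
    refine Real.tendsto_exp_atBot.comp ?_
    have h1 : Tendsto (fun y : ℕ => (y : ℝ) * (θ * t)) atTop atTop :=
      tendsto_natCast_atTop_atTop.atTop_mul_const (by positivity)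
    refine (tendsto_neg_atTop_atBot.comp h1).congr fun y => ?_
    simp only [Function.comp, NNReal.coe_natCast]
    ring
  have h0 : P.real {ω | minMarkPath T U ω t = ⊤} ≤ 0 := by
    refine ge_of_tendsto' hlim fun y => ?_
    rw [← measureReal_le_apply hZ]
    exact measureReal_mono fun ω (hω : _ = ⊤) => by simp [hω]
  have h1 := (measureReal_eq_zero_iff (by finiteness)).1 (le_antisymm h0 measureReal_nonneg)
  rw [ae_iff]
  simpa using h1

theorem isOpenZH_openMinMarkPath (hθ : 0 < θ) (hZ : IsZH P θ (minMarkPath T U)) :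
    IsOpenZH P θ (openMinMarkPath T U) := by
  classical
  refine ⟨fun t => ?_, fun k t y ht => ?_⟩
  · have e : (fun ω => openMinMarkPath T U ω t) = (finiteOutcomes T U).piecewise
        (fun ω => (minMarkPath T U ω (closedTime t)).toReal) fun _ => 0 := by
      funext ω
      by_cases h : ω ∈ finiteOutcomes T U
      · simp [h, openMinMarkPath_apply h]
      · simp [h, openMinMarkPath_of_notMem h]
    rw [e]
    refine Measurable.piecewise ?_ (hZ.1 _).ennreal_toReal measurable_const
    rw [show finiteOutcomes T U = ⋂ n : ℕ, {ω | minMarkPath T U ω (1 / ((n : ℝ≥0) + 1)) = ⊤}ᶜ by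
      ext; simp [finiteOutcomes]]
    exact .iInter fun n => (hZ.1 _ (measurableSet_singleton ⊤)).compl
  · rw [show fddProduct θ k (fun i => t i) y = fddProduct θ k (fun i => closedTime (t i)) y from rfl,
      ← hZ.2 k (fun i => closedTime (t i)) y fun i hi j hj hij => ht hi hj hij]
    refine measureReal_congr ?_
    filter_upwards [ae_mem_finiteOutcomes hθ hZ] with ω hω
    refine propext (forall₂_congr fun i _ => ?_)
    rw [openMinMarkPath_apply hω, ← ENNReal.ofReal_le_iff_le_toReal (minMarkPath_ne_top hω _),
      ENNReal.ofReal_coe_nnreal]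

end OpenLimitPath

/-! ### Every version of `Z_H` is almost surely decreasing -/

section Limit

variable {Ω Ω' : Type*} [MeasurableSpace Ω] [MeasurableSpace Ω'] {P : Measure Ω}
  {P' : Measure Ω'} {θ : ℝ} {Z' : Ω' → PathSpace}

lemma REPP.IsZH.measureReal_forall_mem_eq {Z : Ω → PathSpace} (hZ : IsZH P θ Z) (hZ' : IsZH P' θ Z')
    (F : Finset (ℝ≥0 × ℝ≥0)) :
    P.real {ω | ∀ c ∈ F, (c.2 : ℝ≥0∞) ≤ Z ω c.1} =
      P'.real {ω | ∀ c ∈ F, (c.2 : ℝ≥0∞) ≤ Z' ω c.1} :=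
  _root_.measureReal_forall_mem_eq (A := fun t y => {ω | (y : ℝ≥0∞) ≤ Z ω t})
    (B := fun t y => {ω | (y : ℝ≥0∞) ≤ Z' ω t})
    (fun _ _ _ h _ h' => le_trans (ENNReal.coe_le_coe.2 h) h')
    (fun _ _ _ h _ h' => le_trans (ENNReal.coe_le_coe.2 h) h')
    (fun k t y ht => (hZ.2 k t y ht).trans (hZ'.2 k t y ht).symm) F

lemma REPP.IsOpenZH.measureReal_forall_mem_eq {Z : Ω → OpenPathSpace} (hZ : IsOpenZH P θ Z)
    (hZ' : IsZH P' θ Z') (F : Finset (Ioi (0 : ℝ) × ℝ≥0)) :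
    P.real {ω | ∀ c ∈ F, (c.2 : ℝ) ≤ Z ω c.1} =
      P'.real {ω | ∀ c ∈ F, (c.2 : ℝ≥0∞) ≤ Z' ω (closedTime c.1)} :=
  have : Nonempty (Ioi (0 : ℝ)) := ⟨⟨1, mem_Ioi.2 one_pos⟩⟩
  _root_.measureReal_forall_mem_eq (A := fun t y => {ω | (y : ℝ) ≤ Z ω t})
    (B := fun t y => {ω | (y : ℝ≥0∞) ≤ Z' ω (closedTime t)})
    (fun _ _ _ h _ h' => le_trans (NNReal.coe_le_coe.2 h) h')
    (fun _ _ _ h _ h' => le_trans (ENNReal.coe_le_coe.2 h) h')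
    (fun k t y ht => (hZ.2 k t y ht).trans
      (hZ'.2 k (fun i => closedTime (t i)) y fun _ hi _ hj hij => ht hi hj hij).symm) F

/-- An arbitrary version is only given through its finite-dimensional probabilities. Comparison with
the decreasing version `Z'` makes it decreasing on a countable dense set almost surely, and right
continuity does the rest. -/
lemma REPP.IsZH.ae_mem_antitonePaths [IsProbabilityMeasure P] {Z : Ω → PathSpace} (hZ : IsZH P θ Z) (hZ' : IsZH P' θ Z')
    (hanti : ∀ ω, Antitone (Z' ω).toFun) : ∀ᵐ ω ∂P, Z ω ∈ antitonePaths := by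
  obtain ⟨Q, hQc, hQ⟩ := TopologicalSpace.exists_countable_dense ℝ≥0
  have : Countable Q := hQc.to_subtype
  have h : ∀ᵐ ω ∂P, ∀ s t : Q, (s : ℝ≥0) ≤ t → ∀ y : ℚ≥0,
      ((y : ℝ≥0) : ℝ≥0∞) ≤ Z ω t → ((y : ℝ≥0) : ℝ≥0∞) ≤ Z ω s :=
    ae_all_iff.2 fun s => ae_all_iff.2 fun t => ae_all_iff.2 fun hst => ae_all_iff.2 fun y =>
      ae_mem_of_measureReal_eq (A := fun t y => {ω | (y : ℝ≥0∞) ≤ Z ω t})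
        (B := fun t y => {ω | (y : ℝ≥0∞) ≤ Z' ω t})
        (fun t y => measurableSet_le measurable_const (hZ.1 t)) (hZ.measureReal_forall_mem_eq hZ')
        (fun y _ _ hst ω h => le_trans h (hanti ω hst)) hst _
  filter_upwards [h] with ω hω
  refine antitone_of_antitoneOn_dense hQ (Z ω).rightContinuous fun s hs t ht hst => ?_
  by_contra! hcon
  obtain ⟨y, h1, h2⟩ := exists_nnrat_btwn hcon
  exact absurd (hω ⟨s, hs⟩ ⟨t, ht⟩ hst y h2.le) (not_le.2 h1)

lemma REPP.IsOpenZH.ae_mem_antitoneOpenPaths [IsProbabilityMeasure P] [IsProbabilityMeasure P']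
    {Z : Ω → OpenPathSpace}
    (hZ : IsOpenZH P θ Z) (hZ' : IsZH P' θ Z') (hanti : ∀ ω, Antitone (Z' ω).toFun) :
    ∀ᵐ ω ∂P, Z ω ∈ antitoneOpenPaths := by
  obtain ⟨Q, hQc, hQ⟩ := TopologicalSpace.exists_countable_dense (Ioi (0 : ℝ))
  have : Countable Q := hQc.to_subtype
  have hmeas : ∀ (t : Ioi (0 : ℝ)) (y : ℝ≥0), MeasurableSet {ω | (y : ℝ) ≤ Z ω t} :=
    fun t y => measurableSet_le measurable_const (hZ.1 t)
  have h : ∀ᵐ ω ∂P, ∀ s t : Q, (s : Ioi (0 : ℝ)) ≤ t → ∀ y : ℚ≥0,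
      ((y : ℝ≥0) : ℝ) ≤ Z ω t → ((y : ℝ≥0) : ℝ) ≤ Z ω s :=
    ae_all_iff.2 fun s => ae_all_iff.2 fun t => ae_all_iff.2 fun hst => ae_all_iff.2 fun y =>
      ae_mem_of_measureReal_eq (A := fun t y => {ω | (y : ℝ) ≤ Z ω t})
        (B := fun t y => {ω | (y : ℝ≥0∞) ≤ Z' ω (closedTime t)}) hmeas
        (hZ.measureReal_forall_mem_eq hZ')
        (fun y s t hst ω h => le_trans h (hanti ω (show closedTime s ≤ closedTime t from hst))) hst _
  -- Level `y = 0` has probability one for `Z'`, whose values lie in `[0, ∞]`, and hence also for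
  -- `Z`.
  have h0 : ∀ᵐ ω ∂P, ∀ t : Q, 0 ≤ Z ω t := by
    refine ae_all_iff.2 fun t => ?_
    have h1 := hZ.measureReal_forall_mem_eq hZ' {((t : Ioi (0 : ℝ)), 0)}
    simp only [Finset.mem_singleton, forall_eq, NNReal.coe_zero, ENNReal.coe_zero, zero_le,
      ofPred_true, probReal_univ] at h1
    have h2 := hmeas t 0
    rw [NNReal.coe_zero] at h2
    rw [measureReal_def, ENNReal.toReal_eq_one_iff] at h1
    exact (prob_compl_eq_zero_iff h2).2 h1
  filter_upwards [h, h0] with ω hω hω0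
  refine ⟨antitone_of_antitoneOn_dense hQ (Z ω).rightContinuous fun s hs t ht hst => ?_,
    forall_le_of_dense hQ (Z ω).rightContinuous fun q hq => hω0 ⟨q, hq⟩⟩
  by_contra! hcon
  obtain ⟨y, h1, h2⟩ := exists_nnrat_btwn_real (hω0 ⟨s, hs⟩) hcon
  exact absurd (hω ⟨s, hs⟩ ⟨t, ht⟩ hst y h2.le) (not_le.2 h1)

end Limit

/-! ### Weak convergence in the two path spaces -/

section Convergence

variable {Ω Ω' Ω'' : Type*} [MeasurableSpace Ω] [MeasurableSpace Ω'] [MeasurableSpace Ω'']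
  {P : Measure Ω} {P' : Measure Ω'} {P'' : Measure Ω''} [IsProbabilityMeasure P] [IsProbabilityMeasure P''] {X : ℕ → Ω → ℝ}
  {D : ℕ+ → Set ℝ} {u : ℕ+ → ℝ → ℝ} {θ : ℝ} {Z' : Ω' → PathSpace}

theorem tendstoInDistribution_extremalProcess (hX : ∀ j, Measurable (X j))
    (hu : IsLevelSequence P X D u) (hZ' : IsZH P' θ Z') (hanti : ∀ ω, Antitone (Z' ω).toFun)
    (hlim : ∀ F : Finset (ℝ≥0 × ℝ≥0), Tendsto
      (fun n : ℕ+ => P.real {ω | ∀ c ∈ F, (c.2 : ℝ≥0∞) ≤ extremalProcess X D u n ω c.1})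
      atTop (𝓝 (P'.real {ω | ∀ c ∈ F, (c.2 : ℝ≥0∞) ≤ Z' ω c.1})))
    {Z : Ω'' → PathSpace} (hZ : IsZH P'' θ Z) :
    TendstoInDistribution (fun n : ℕ+ => extremalProcess X D u n) atTop Z (fun _ => P) P'' := by
  obtain ⟨Q, hQc, hQ⟩ := TopologicalSpace.exists_countable_dense ℝ≥0
  -- The time `0` is added to the questions so that convergence holds at the left end point.
  have : Countable ↥(insert 0 Q) := (hQc.insert 0).to_subtype
  refine tendstoInDistribution_of_setCode (C := ↥(insert 0 Q) × ℚ≥0)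
    (fun x hx s hs h => tendsto_of_mem_antitonePaths (hQ.mono (subset_insert 0 Q))
      (mem_insert 0 Q) hx hs h) (fun n => ?_) (hZ.ae_mem_antitonePaths hZ' hanti) (fun n c => ?_)
    (fun c => (measurableSet_le measurable_const (hZ.1 _)).nullMeasurableSet) fun F => ?_
  · filter_upwards [ae_forall_mem_range hu n] with ω hω s t hst
    exact ENNReal.ofReal_le_ofReal (antitone_levelMax hu hω (Nat.floor_mono
      (mul_le_mul_of_nonneg_left (NNReal.coe_le_coe.2 hst) (Nat.cast_nonneg _))))
  · refine (nullMeasurableSet_le_levelMax hu hX n (c.2 : ℝ≥0) ⌊(n : ℝ) * (c.1 : ℝ≥0)⌋₊).congr ?_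
    filter_upwards [ae_forall_mem_range hu n] with ω hω
    exact propext (coe_le_extremalProcess_iff hu hω).symm
  · have h := hlim (F.image fun c => ((c.1 : ℝ≥0), (c.2 : ℝ≥0)))
    rw [← hZ.measureReal_forall_mem_eq hZ'] at h
    simp only [Finset.forall_mem_image] at h
    exact h

theorem tendstoInDistribution_openExtremalProcess [IsProbabilityMeasure P']
    (hX : ∀ j, Measurable (X j)) (hu : IsLevelSequence P X D u) (hZ' : IsZH P' θ Z') (hanti : ∀ ω, Antitone (Z' ω).toFun)
    (hlim : ∀ F : Finset (ℝ≥0 × ℝ≥0), Tendsto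
      (fun n : ℕ+ => P.real {ω | ∀ c ∈ F, (c.2 : ℝ≥0∞) ≤ extremalProcess X D u n ω c.1})
      atTop (𝓝 (P'.real {ω | ∀ c ∈ F, (c.2 : ℝ≥0∞) ≤ Z' ω c.1})))
    {Z : Ω'' → OpenPathSpace} (hZ : IsOpenZH P'' θ Z) :
    TendstoInDistribution (fun n : ℕ+ => openExtremalProcess X D u n) atTop Z
      (fun _ => P) P'' := by
  obtain ⟨Q, hQc, hQ⟩ := TopologicalSpace.exists_countable_dense (Ioi (0 : ℝ))
  have : Countable Q := hQc.to_subtype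
  refine tendstoInDistribution_of_setCode (C := Q × ℚ≥0)
    (fun x hx s hs h => tendsto_of_mem_antitoneOpenPaths hQ hx hs h) (fun n => ?_)
    (hZ.ae_mem_antitoneOpenPaths hZ' hanti)
    (fun n c => nullMeasurableSet_le_levelMax hu hX n (c.2 : ℝ≥0) ⌊(n : ℝ) * (c.1 : ℝ)⌋₊)
    (fun c => (measurableSet_le measurable_const (hZ.1 _)).nullMeasurableSet) fun F => ?_
  · filter_upwards [ae_forall_mem_range hu n] with ω hω
    exact ⟨fun s t hst => antitone_levelMax hu hω (Nat.floor_mono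
      (mul_le_mul_of_nonneg_left (show (s : ℝ) ≤ t from hst) (Nat.cast_nonneg _))),
      fun t => levelMax_nonneg hu hω _⟩
  -- The questions about real paths are questions about `[0, ∞]`-valued paths at the same positive
  -- times, so the limit already found applies again.
  · have h := hlim (F.image fun c => (closedTime c.1, (c.2 : ℝ≥0)))
    have e := hZ.measureReal_forall_mem_eq hZ'
      (F.image fun c => ((c.1 : Ioi (0 : ℝ)), (c.2 : ℝ≥0)))
    simp only [Finset.forall_mem_image] at h e
    rw [← e] at h
    refine h.congr fun n => measureReal_congr ?_
    filter_upwards [ae_forall_mem_range hu n] with ω hω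
    exact propext (forall₂_congr fun c _ => coe_le_extremalProcess_iff hu hω)

end Convergence

theorem mainTheorem7 {Ω Ω' Ω'' : Type*}
    [MeasurableSpace Ω] [MeasurableSpace Ω'] [MeasurableSpace Ω'']
    (P : Measure Ω) (P' : Measure Ω') (P'' : Measure Ω'')
    [IsProbabilityMeasure P] [IsProbabilityMeasure P'] [IsProbabilityMeasure P'']
    -- a stationary process and its levels
    (X : ℕ → Ω → ℝ) (hX : ∀ j, Measurable (X j))
    (hstat : P.map (fun ω j => X (j + 1) ω) = P.map (fun ω j => X j ω))
    (D : ℕ+ → Set ℝ) (u : ℕ+ → ℝ → ℝ) (hu : IsLevelSequence P X D u)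
    -- `N_n` converges weakly to a process of Mori–Hsing type
    (θ : ℝ) (hθ : θ ∈ Ioc (0 : ℝ) 1)
    (Ntil : Ω' → PointMeasure (ℝ≥0 × ℝ≥0)) (hMH : IsMoriHsing P' θ Ntil)
    (hN : TendstoInDistribution (fun n : ℕ+ => empirical X D u n) atTop Ntil (fun _ => P) P') :
    -- `Z_H` exists and `Z_n` converges weakly to it in `D([0, ∞))` (paths valued in `[0, ∞]`)
    ((∃ Z : Ω' → PathSpace, IsZH P' θ Z) ∧
      ∀ Z : Ω'' → PathSpace, IsZH P'' θ Z →
        TendstoInDistribution (fun n : ℕ+ => extremalProcess X D u n) atTop Z (fun _ => P) P'') ∧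
    -- the same in `D((0, ∞))` (real paths)
    ((∃ Z : Ω' → OpenPathSpace, IsOpenZH P' θ Z) ∧
      ∀ Z : Ω'' → OpenPathSpace, IsOpenZH P'' θ Z →
        TendstoInDistribution (fun n : ℕ+ => openExtremalProcess X D u n) atTop Z
          (fun _ => P) P'') := by
  obtain ⟨T, U, γ, hTm, hUm, -, hTlaw, hTi, hUlaw, hUi, -, hγ, hTU, -, hNtil⟩ := hMH
  have hreg := ae_mem_regularOutcomes hTlaw hUlaw hγ hNtil
  have hZ' := isZH_minMarkPath hθ.1 hTm hUm hTlaw hTi hUlaw hUi hTU hreg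
  have hlim := tendsto_measureReal_extremalProcess hu hγ hNtil hreg hZ' hN
  exact ⟨⟨⟨_, hZ'⟩, fun Z hZ =>
      tendstoInDistribution_extremalProcess hX hu hZ' antitone_minMarkPath hlim hZ⟩,
    ⟨_, isOpenZH_openMinMarkPath hθ.1 hZ'⟩, fun Z hZ =>
      tendstoInDistribution_openExtremalProcess hX hu hZ' antitone_minMarkPath hlim hZ⟩
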